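/- Let $n\ge 3$ and let $\Omega\subset\mathbb{R}^n$ be a bounded domain with smooth boundary and outward unit normal $\nu$. For positive $\sigma\in C(\bar\Omega)$ consider the isotropic-scattering radiative transport equation $$\theta\cdot\nabla_x u(x,\theta)=\sigma(x)\bigl(\langle u\rangle(x)-u(x,\theta)\bigr)\quad\text{in }\Omega\times S^{n-1},\qquad \langle u\rangle(x)=\frac1{|S^{n-1}|}\int_{S^{n-1}}u(x,\theta)\,d\theta,$$ for $u\in L^1(\Omega\times S^{n-1})$; the equation is understood along almost every line in direction $\theta$, and boundary values on $\partial\Omega_\pm=\{(x,\theta):x\in\partial\Omega,\ \pm\nu(x)\cdot\theta>0\}$ are limits along almost every such line. Let $E\subset\partial\Omega$ be relatively open and $E_\pm=\{(x,\theta):x\in E,\ \pm\nu(x)\cdot\theta\ge 0\}$, with $L^1(E_\pm)$ taken with respect to $|\nu(x)\cdot\theta|\,dS(x)\,d\theta$. The local albedo map $\mathcal{A}|_E:L^1(E_-)\to L^1(E_+)$ sends $f$, extended by zero to $\partial\Omega_-$, to $u|_{E_+}$, where $u$ is the solution with $u|_{\partial\Omega_-}=f$. Say that $\Omega$ can be scanned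 from $E$ if every $\varphi\in C(\bar\Omega)$ satisfying $\int_\ell\varphi\,d\ell=0$ for each line segment $\ell\subset\bar\Omega$ that has its endpoints on $\partial\Omega$, has its relative interior in $\Omega$, and meets $E$, is identically zero. **Theorem.** Suppose that $\Omega$ can be scanned from $E$. Let $\sigma_1,\sigma_2\in C(\bar\Omega)$ be positive in $\Omega$, with local albedo maps $\mathcal{A}_1|_E$ and $\mathcal{A}_2|_E$. If $\mathcal{A}_1|_E=\mathcal{A}_2|_E$, then $\sigma_1=\sigma_2$ on $\bar\Omega$. -/

import Mathlib

open Set Filter Topology MeasureTheory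
open scoped ContDiff

namespace RTE

/-- The space of positions, `ℝⁿ` with its Euclidean norm. -/
abbrev Space (n : ℕ) : Type := EuclideanSpace ℝ (Fin n)

/-- The unit sphere `S^{n-1}` of directions. -/
abbrev Dir (n : ℕ) : Type := Metric.sphere (0 : Space n) 1

/-- `ρ` is a smooth defining function of `Ω` near the boundary point `x`: near `x`, the set `Ω` is
`{ρ < 0}`, and `ρ x = 0`, `∇ρ(x) ≠ 0`. -/
def IsLocalDefiningFunction {n : ℕ} (Ω : Set (Space n)) (x : Space n) (ρ : Space n → ℝ) : Prop :=
  ContDiff ℝ ∞ ρ ∧ ρ x = 0 ∧ gradient ρ x ≠ 0 ∧ ∀ᶠ y in 𝓝 x, (y ∈ Ω ↔ ρ y < 0)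

/-- Bounded domains (connected, nonempty, open) with smooth boundary, lying locally on one side
of the boundary. -/
structure IsSmoothBoundedDomain {n : ℕ} (Ω : Set (Space n)) : Prop where
  isOpen : IsOpen Ω
  isConnected : IsConnected Ω
  isBounded : Bornology.IsBounded Ω
  smooth : ∀ x ∈ frontier Ω, ∃ ρ, IsLocalDefiningFunction Ω x ρ

open Classical in
/-- The outward unit normal `ν(x) = ∇ρ(x) / |∇ρ(x)|` at a boundary point `x`, for any local
defining function `ρ` (the value does not depend on `ρ`); it is `0` where there is none. -/
noncomputable def outwardNormal {n : ℕ} (Ω : Set (Space n)) (x : Space n) : Space n :=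
  if h : ∃ ρ, IsLocalDefiningFunction Ω x ρ then ‖gradient h.choose x‖⁻¹ • gradient h.choose x
  else 0

/-- The surface measure on the sphere of directions. -/
noncomputable def dirMeasure (n : ℕ) : Measure (Dir n) := (volume : Measure (Space n)).toSphere

/-- The surface measure `dS(x)` on `∂Ω`, as a measure on the whole space. -/
noncomputable def surfaceMeasure {n : ℕ} (Ω : Set (Space n)) : Measure (Space n) :=
  (Measure.euclideanHausdorffMeasure (n - 1)).restrict (frontier Ω)

/-- The product measure `dS(x) dθ` on `∂Ω × S^{n-1}`. -/
noncomputable def boundaryMeasure {n : ℕ} (Ω : Set (Space n)) : Measure (Space n × Dir n) :=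
  (surfaceMeasure Ω).prod (dirMeasure n)

/-- The flux measure `|ν(x)·θ| dS(x) dθ` on `∂Ω × S^{n-1}`. -/
noncomputable def fluxMeasure {n : ℕ} (Ω : Set (Space n)) : Measure (Space n × Dir n) :=
  (boundaryMeasure Ω).withDensity
    fun p => ENNReal.ofReal |inner ℝ (outwardNormal Ω p.1) (p.2 : Space n)|

/-- `E₋ = {(x, θ) : x ∈ E, ν(x)·θ ≤ 0}`. -/
def incoming {n : ℕ} (Ω E : Set (Space n)) : Set (Space n × Dir n) :=
  {p | p.1 ∈ E ∧ inner ℝ (outwardNormal Ω p.1) (p.2 : Space n) ≤ 0}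

/-- `E₊ = {(x, θ) : x ∈ E, ν(x)·θ ≥ 0}`. -/
def outgoing {n : ℕ} (Ω E : Set (Space n)) : Set (Space n × Dir n) :=
  {p | p.1 ∈ E ∧ 0 ≤ inner ℝ (outwardNormal Ω p.1) (p.2 : Space n)}

/-- `L¹(E₋)`. -/
abbrev L1Incoming {n : ℕ} (Ω E : Set (Space n)) : Type :=
  Lp ℝ 1 ((fluxMeasure Ω).restrict (incoming Ω E))

/-- `L¹(E₊)`. -/
abbrev L1Outgoing {n : ℕ} (Ω E : Set (Space n)) : Type :=
  Lp ℝ 1 ((fluxMeasure Ω).restrict (outgoing Ω E))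

/-- The angular average `⟨u⟩(x) = |S^{n-1}|⁻¹ ∫ u(x, θ) dθ`. -/
noncomputable def angularAverage {n : ℕ} (u : Space n × Dir n → ℝ) (x : Space n) : ℝ :=
  ⨍ θ, u (x, θ) ∂(dirMeasure n)

/-- The right-hand side `σ (⟨u⟩ - u)` of the transport equation. -/
noncomputable def collision {n : ℕ} (σ : Space n → ℝ) (u : Space n × Dir n → ℝ)
    (p : Space n × Dir n) : ℝ :=
  σ p.1 * (angularAverage u p.1 - u p)

/-- `u ∈ L¹(Ω × S^{n-1})` solves `θ·∇u = σ (⟨u⟩ - u)` in `Ω × S^{n-1}`: along almost every line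
`s ↦ x + sθ`, `u` is on the parts of the line inside `Ω` an (absolutely continuous) primitive of
the right-hand side. The function `u` is thus the representative of its class that is
absolutely continuous along almost every characteristic line. -/
structure IsSolution {n : ℕ} (Ω : Set (Space n)) (σ : Space n → ℝ)
    (u : Space n × Dir n → ℝ) : Prop where
  integrable : Integrable u ((volume.restrict Ω).prod (dirMeasure n))
  transport : ∀ᵐ p ∂((volume.restrict Ω).prod (dirMeasure n)), ∀ a b : ℝ, a ≤ b →
    (∀ s ∈ Icc a b, p.1 + s • (p.2 : Space n) ∈ Ω) →
      IntervalIntegrable (fun s => collision σ u (p.1 + s • (p.2 : Space n), p.2)) volume a b ∧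
      u (p.1 + b • (p.2 : Space n), p.2) - u (p.1 + a • (p.2 : Space n), p.2) =
        ∫ s in a..b, collision σ u (p.1 + s • (p.2 : Space n), p.2)

/-- `u = f` on `∂Ω₋ = {(x, θ) : x ∈ ∂Ω, ν(x)·θ < 0}`, in the sense of traces along lines. -/
def HasIncomingTrace {n : ℕ} (Ω : Set (Space n)) (u f : Space n × Dir n → ℝ) : Prop :=
  ∀ᵐ p ∂(boundaryMeasure Ω), inner ℝ (outwardNormal Ω p.1) (p.2 : Space n) < 0 →
    Tendsto (fun t : ℝ => u (p.1 + t • (p.2 : Space n), p.2)) (𝓝[>] 0) (𝓝 (f p))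

/-- `u = g` on `{(x, θ) : x ∈ E, ν(x)·θ > 0}`, in the sense of traces along lines. -/
def HasOutgoingTraceOn {n : ℕ} (Ω E : Set (Space n)) (u g : Space n × Dir n → ℝ) : Prop :=
  ∀ᵐ p ∂(boundaryMeasure Ω), p.1 ∈ E → 0 < inner ℝ (outwardNormal Ω p.1) (p.2 : Space n) →
    Tendsto (fun t : ℝ => u (p.1 - t • (p.2 : Space n), p.2)) (𝓝[>] 0) (𝓝 (g p))

/-- The local albedo map `𝒜|_E : L¹(E₋) → L¹(E₊)`, as the set of pairs `(f, 𝒜|_E f)`: extend `f`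
by zero to `∂Ω₋`, solve the transport equation with this incoming boundary value, and restrict
the outgoing boundary value of the solution to `E₊`. -/
def localAlbedo {n : ℕ} (Ω E : Set (Space n)) (σ : Space n → ℝ) :
    Set (L1Incoming Ω E × L1Outgoing Ω E) :=
  {fg | ∃ u : Space n × Dir n → ℝ, IsSolution Ω σ u ∧
    HasIncomingTrace Ω u ((incoming Ω E).indicator fg.1) ∧ HasOutgoingTraceOn Ω E u fg.2}

/-- The integral of `φ` with respect to arc length over the segment from `x` to `y`. -/
noncomputable def segmentIntegral {n : ℕ} (φ : Space n → ℝ) (x y : Space n) : ℝ :=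
  dist x y * ∫ t in (0 : ℝ)..1, φ (AffineMap.lineMap x y t)

/-- `Ω` can be scanned from `E`: a continuous function on `Ω̄` vanishes if its integrals over all
chords of `Ω` that meet `E` vanish. A chord is a line segment with endpoints on `∂Ω` that runs
inside `Ω` in between, so it meets `E ⊆ ∂Ω` if and only if one of its endpoints (say `x`) is
in `E`. -/
def CanBeScannedFrom {n : ℕ} (Ω E : Set (Space n)) : Prop :=
  ∀ φ : Space n → ℝ, ContinuousOn φ (closure Ω) →
    (∀ x ∈ E, ∀ y ∈ frontier Ω, x ≠ y → openSegment ℝ x y ⊆ Ω → segmentIntegral φ x y = 0) →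
      ∀ x ∈ closure Ω, φ x = 0

end RTE

/-! The coefficient is read off from single backscattering. Send in a beam of width and aperture of
order δ about a chord that starts at x₀ ∈ E in direction θ₀, and observe near x₀ the radiation that
returns in directions near -θ₀. Let m be the normalized measure of the directions of the beam, and
a(s) = exp(-∫₀ˢ σ) the attenuation down to depth s. To leading order in m the returning flux has
been scattered exactly once: it is attenuated on the way to depth s, scattered with density σ, and
attenuated over the same segment on the way back. Divided by m it tends to ∫₀ᴸ a·σ·a ds = (1 -
a(L)²)/2, because the integrand is the derivative of -a²/2. If the albedo maps agree, both media
give the same limit, so the attenuations over the chord agree, and so do the integrals of σ₁ and σ₂;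
scanning finishes the proof. Only the end x₀ of the chord has to lie in E, since the far end is
never observed.

Multiple scattering is negligible for the following reason. The average of the unscattered flux is
at most m and is supported in a tube of radius of order δ. One more scattering averages it over the
lines through a point, and almost all of these meet a thin tube in a short segment only, so a factor
tending to 0 is gained (`tendsto_tubeBound`, `IsMedium.density_beam_le_add`). The limits are
`IsMedium.tendsto_densityReal_beam` for the density on the axis and `IsMedium.tendsto_mildReal_beam`
for the returning flux.

The rest connects these pointwise limits with the L¹ setting. Solutions with bounded data are given
explicitly by a Neumann series (`mild`), which converges because the kernel a·σ has mass 1 - a < 1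
on each ray. Any other solution agrees with it almost everywhere, because scattering is also a
contraction in L¹(σ dx) (`IsSmoothBoundedDomain.ae_eq_mildReal`). Traces are known on almost every
line only, so the measurement is made on a generic nearby line, just before its exit
(`IsSmoothBoundedDomain.exists_near_chord`). This needs exit times that are continuous at both ends
of the chord, which holds for transversal ends; an arbitrary chord is a limit of transversal ones
(`IsSmoothBoundedDomain.exists_transversal`). -/

namespace RTE

open scoped ENNReal NNReal

/-! ### Backward rays, exit times and entry points. -/

section Geometry

variable {n : ℕ} {Ω : Set (Space n)}

/-- The point reached from `x` after travelling backwards for time `t` in direction `θ`. -/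
noncomputable def backPoint (p : Space n × Dir n) (t : ℝ) : Space n := p.1 - t • (p.2 : Space n)

/-- The time at which the backward ray from `x` in direction `-θ` first leaves `Ω`. -/
noncomputable def backExit (Ω : Set (Space n)) (p : Space n × Dir n) : ℝ :=
  sInf {t | 0 ≤ t ∧ backPoint p t ∉ Ω}

/-- The point and direction of entry into `Ω` of the line through `p`. -/
noncomputable def entry (Ω : Set (Space n)) (p : Space n × Dir n) : Space n × Dir n :=
  (backPoint p (backExit Ω p), p.2)

@[simp] lemma norm_dir (θ : Dir n) : ‖(θ : Space n)‖ = 1 := norm_eq_of_mem_sphere θ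

@[simp] lemma backPoint_zero (p : Space n × Dir n) : backPoint p 0 = p.1 := by simp [backPoint]

lemma continuous_backPoint :
    Continuous fun q : (Space n × Dir n) × ℝ => backPoint q.1 q.2 := by
  unfold backPoint; fun_prop

lemma continuous_backPoint_right (p : Space n × Dir n) : Continuous (backPoint p) :=
  continuous_backPoint.comp (by fun_prop : Continuous fun t : ℝ => (p, t))

lemma backPoint_backPoint (x : Space n) (θ : Dir n) (s t : ℝ) :
    backPoint (backPoint (x, θ) s, θ) t = backPoint (x, θ) (s + t) := by
  simp only [backPoint, add_smul]; abel

lemma backPoint_neg_dir (x : Space n) (θ : Dir n) (t : ℝ) :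
    backPoint (x, -θ) t = x + t • (θ : Space n) := by
  simp [backPoint]

lemma backPoint_neg (x : Space n) (θ : Dir n) (t : ℝ) :
    backPoint (x, θ) (-t) = x + t • (θ : Space n) := by
  simp [backPoint]

lemma dist_backPoint (x : Space n) (θ : Dir n) (s t : ℝ) :
    dist (backPoint (x, θ) s) (backPoint (x, θ) t) = |s - t| := by
  have : backPoint (x, θ) s - backPoint (x, θ) t = (t - s) • (θ : Space n) := by
    simp only [backPoint, sub_smul]; abel
  rw [dist_eq_norm, this, norm_smul, norm_dir, mul_one, Real.norm_eq_abs, abs_sub_comm]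

lemma backExit_nonneg (p : Space n × Dir n) : 0 ≤ backExit Ω p :=
  Real.sInf_nonneg fun _ h => h.1

lemma bddBelow_exitTimes (p : Space n × Dir n) : BddBelow {t | 0 ≤ t ∧ backPoint p t ∉ Ω} :=
  ⟨0, fun _ h => h.1⟩

lemma backPoint_mem_of_lt {p : Space n × Dir n} {s : ℝ} (h0 : 0 ≤ s) (h : s < backExit Ω p) :
    backPoint p s ∈ Ω :=
  not_not.1 fun hn => absurd (csInf_le (bddBelow_exitTimes p) ⟨h0, hn⟩) (not_le.2 h)

lemma backExit_le {p : Space n × Dir n} {t : ℝ} (h0 : 0 ≤ t) (h : backPoint p t ∉ Ω) :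
    backExit Ω p ≤ t := csInf_le (bddBelow_exitTimes p) ⟨h0, h⟩

lemma exitTimes_nonempty (hb : Bornology.IsBounded Ω) (p : Space n × Dir n) :
    {t | 0 ≤ t ∧ backPoint p t ∉ Ω}.Nonempty := by
  obtain ⟨R, hR⟩ := hb.subset_closedBall 0
  refine ⟨|R| + ‖p.1‖ + 1, by positivity, fun h => ?_⟩
  have h1 := hR h
  rw [mem_closedBall_zero_iff] at h1
  have h2 : ‖(|R| + ‖p.1‖ + 1) • (p.2 : Space n)‖ ≤ ‖p.1‖ + ‖backPoint p (|R| + ‖p.1‖ + 1)‖ := by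
    have : (|R| + ‖p.1‖ + 1) • (p.2 : Space n) = p.1 - backPoint p (|R| + ‖p.1‖ + 1) := by
      simp [backPoint]
    rw [this]; exact norm_sub_le _ _
  rw [norm_smul, norm_dir, mul_one, Real.norm_of_nonneg (by positivity)] at h2
  linarith [le_abs_self R]

lemma backPoint_backExit_notMem (ho : IsOpen Ω) (hb : Bornology.IsBounded Ω)
    (p : Space n × Dir n) : backPoint p (backExit Ω p) ∉ Ω := by
  have hc : IsClosed {t | 0 ≤ t ∧ backPoint p t ∉ Ω} :=
    isClosed_Ici.inter ((ho.preimage (continuous_backPoint_right p)).isClosed_compl)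
  exact (hc.csInf_mem (exitTimes_nonempty hb p) (bddBelow_exitTimes p)).2

/-- The exit times form a closed set, so their infimum is attained outside Ω; this makes the strict
inequality a condition on a compact segment. -/
lemma lt_backExit_iff (ho : IsOpen Ω) (hb : Bornology.IsBounded Ω) {p : Space n × Dir n} {s : ℝ} :
    s < backExit Ω p ↔ ∀ r ∈ Icc 0 s, backPoint p r ∈ Ω := by
  refine ⟨fun h r hr => backPoint_mem_of_lt hr.1 (hr.2.trans_lt h), fun h => ?_⟩
  by_contra hn
  exact backPoint_backExit_notMem ho hb p (h _ ⟨backExit_nonneg p, not_lt.1 hn⟩)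

lemma backExit_pos (ho : IsOpen Ω) (hb : Bornology.IsBounded Ω) {p : Space n × Dir n}
    (hp : p.1 ∈ Ω) : 0 < backExit Ω p := by
  rw [lt_backExit_iff ho hb]
  intro r hr
  obtain rfl : r = 0 := by simpa using hr
  simpa using hp

lemma backExit_of_notMem {p : Space n × Dir n} (hp : p.1 ∉ Ω) : backExit Ω p = 0 :=
  le_antisymm (backExit_le le_rfl (by simpa using hp)) (backExit_nonneg p)

lemma backExit_le_diam {D : ℝ} (hD0 : 0 ≤ D) (hD : ∀ x ∈ Ω, ∀ y ∈ Ω, dist x y ≤ D)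
    (p : Space n × Dir n) : backExit Ω p ≤ D := by
  by_contra hn
  push Not at hn
  obtain ⟨s, hs1, hs2⟩ := exists_between hn
  have h0 : 0 < backExit Ω p := hD0.trans_lt hn
  have := hD _ (backPoint_mem_of_lt (p := p) le_rfl h0) _
    (backPoint_mem_of_lt (hD0.trans hs1.le) hs2)
  rw [dist_backPoint p.1 p.2, zero_sub, abs_neg, abs_of_nonneg (hD0.trans hs1.le)] at this
  linarith

lemma backExit_shift (ho : IsOpen Ω) (hb : Bornology.IsBounded Ω) {x : Space n} {θ : Dir n} {t : ℝ}
    (ht : 0 ≤ t) (h : t ≤ backExit Ω (x, θ)) :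
    backExit Ω (backPoint (x, θ) t, θ) = backExit Ω (x, θ) - t := by
  apply le_antisymm
  · refine backExit_le (by linarith) ?_
    rw [backPoint_backPoint]
    simpa using backPoint_backExit_notMem ho hb (x, θ)
  · by_contra hn
    push Not at hn
    refine backPoint_backExit_notMem ho hb (backPoint (x, θ) t, θ) ?_
    rw [backPoint_backPoint]
    exact backPoint_mem_of_lt (add_nonneg ht (backExit_nonneg _)) (by linarith)

/-- The point x itself may lie outside Ω, so this also computes the exit time of points just behind
a boundary point. -/
lemma backExit_advance (ho : IsOpen Ω) (hb : Bornology.IsBounded Ω) {x : Space n} {θ : Dir n}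
    {t : ℝ} (ht : 0 ≤ t) (h : ∀ r ∈ Ioc 0 t, x + r • (θ : Space n) ∈ Ω) :
    backExit Ω (x + t • (θ : Space n), θ) = backExit Ω (x, θ) + t := by
  have hx : backPoint (x + t • (θ : Space n), θ) t = x := by simp [backPoint]
  have h1 : t ≤ backExit Ω (x + t • (θ : Space n), θ) := by
    by_contra hn
    push Not at hn
    refine backPoint_backExit_notMem ho hb (x + t • (θ : Space n), θ) ?_
    set s := backExit Ω (x + t • (θ : Space n), θ)
    have : backPoint (x + t • (θ : Space n), θ) s = x + (t - s) • (θ : Space n) := by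
      simp only [backPoint, sub_smul]; abel
    rw [this]
    exact h _ ⟨by linarith, by linarith [backExit_nonneg (Ω := Ω) (x + t • (θ : Space n), θ)]⟩
  have h2 := backExit_shift ho hb ht h1
  rw [hx] at h2
  linarith

lemma entry_mem_frontier (ho : IsOpen Ω) (hb : Bornology.IsBounded Ω) {p : Space n × Dir n}
    (hp : p.1 ∈ Ω) : (entry Ω p).1 ∈ frontier Ω := by
  rw [ho.frontier_eq]
  refine ⟨?_, backPoint_backExit_notMem ho hb p⟩
  have hpos := backExit_pos ho hb hp
  have : Tendsto (backPoint p) (𝓝[<] backExit Ω p) (𝓝 (backPoint p (backExit Ω p))) :=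
    (continuous_backPoint_right p).continuousAt.tendsto.mono_left nhdsWithin_le_nhds
  refine mem_closure_of_tendsto this ?_
  filter_upwards [Ioo_mem_nhdsLT hpos] with s hs
  exact backPoint_mem_of_lt hs.1.le hs.2

/-- Exit times are lower semicontinuous, since a compact segment in the open set Ω stays in Ω under
small perturbations. This alone gives measurability. -/
lemma isOpen_lt_backExit (ho : IsOpen Ω) (hb : Bornology.IsBounded Ω) (a : ℝ) :
    IsOpen {p : Space n × Dir n | a < backExit Ω p} := by
  simp_rw [lt_backExit_iff ho hb]
  rw [isOpen_iff_eventually]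
  intro p hp
  refine isCompact_Icc.eventually_forall_of_forall_eventually fun r hr => ?_
  exact (continuous_backPoint.continuousAt (x := (p, r))).eventually (ho.mem_nhds (hp r hr))

lemma measurable_backExit (ho : IsOpen Ω) (hb : Bornology.IsBounded Ω) :
    Measurable (backExit Ω) :=
  measurable_of_Ioi fun a => (isOpen_lt_backExit ho hb a).measurableSet

lemma measurable_entry (ho : IsOpen Ω) (hb : Bornology.IsBounded Ω) :
    Measurable (entry Ω) :=
  (continuous_backPoint.measurable.comp
    (measurable_id.prodMk (measurable_backExit ho hb))).prodMk measurable_snd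

/-- Upper semicontinuity needs a point of the ray outside the closure: a ray that only touches the
boundary may be perturbed into one that continues inside Ω. -/
lemma eventually_backExit_le {p : Space n × Dir n} {t : ℝ} (h0 : 0 ≤ t)
    (h : backPoint p t ∉ closure Ω) : ∀ᶠ q in 𝓝 p, backExit Ω q ≤ t := by
  have hc : Continuous fun q : Space n × Dir n => backPoint q t :=
    continuous_backPoint.comp (continuous_id.prodMk continuous_const)
  filter_upwards [hc.continuousAt.eventually (isClosed_closure.isOpen_compl.mem_nhds h)] with q hq
  exact backExit_le h0 fun h' => hq (subset_closure h')

/-- The exit time is continuous where the ray leaves the closure of `Ω` immediately. -/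
lemma continuousAt_backExit (ho : IsOpen Ω) (hb : Bornology.IsBounded Ω) {p : Space n × Dir n}
    (h : ∃ᶠ t in 𝓝[>] backExit Ω p, backPoint p t ∉ closure Ω) :
    ContinuousAt (backExit Ω) p := by
  rw [ContinuousAt, tendsto_order]
  constructor
  · exact fun a ha => (isOpen_lt_backExit ho hb a).mem_nhds ha
  · intro a ha
    obtain ⟨t, ht, ht1, ht2⟩ := (h.and_eventually (Ioo_mem_nhdsGT ha)).exists
    filter_upwards [eventually_backExit_le ((backExit_nonneg p).trans ht1.le) ht] with q hq
    exact hq.trans_lt ht2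

end Geometry

/-! ### The scattering operator and the Neumann series. -/

section Kernel

variable {n : ℕ} {Ω : Set (Space n)} {σ : Space n → ℝ} {M D : ℝ}

/-- The normalized surface measure on the sphere of directions. -/
noncomputable def dirProb (n : ℕ) : Measure (Dir n) := (dirMeasure n univ)⁻¹ • dirMeasure n

instance : IsFiniteMeasure (dirMeasure n) := by unfold dirMeasure; infer_instance

instance : (dirMeasure n).IsOpenPosMeasure := by unfold dirMeasure; infer_instance

lemma dirMeasure_univ_ne_zero [NeZero n] : dirMeasure n univ ≠ 0 := by
  have : Nontrivial (Space n) := by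
    have : Nonempty (Fin n) := ⟨0⟩
    unfold Space; infer_instance
  rw [Measure.measure_univ_ne_zero]
  exact Measure.toSphere_ne_zero _

instance [NeZero n] : IsProbabilityMeasure (dirProb n) := by
  refine ⟨?_⟩
  rw [dirProb, Measure.smul_apply, smul_eq_mul]
  exact ENNReal.inv_mul_cancel dirMeasure_univ_ne_zero (measure_ne_top _ _)

lemma dirProb_ac : dirProb n ≪ dirMeasure n := Measure.smul_absolutelyContinuous

lemma dirMeasure_ac [NeZero n] : dirMeasure n ≪ dirProb n :=
  Measure.absolutelyContinuous_smul (by simp)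

lemma angularAverage_eq (u : Space n × Dir n → ℝ) (x : Space n) :
    angularAverage u x = ∫ θ, u (x, θ) ∂(dirProb n) := rfl

/-- An open bounded set of diameter at most `D` with a continuous scattering coefficient that is
bounded by `M`. -/
structure IsMedium (Ω : Set (Space n)) (σ : Space n → ℝ) (M D : ℝ) : Prop where
  isOpen : IsOpen Ω
  isBounded : Bornology.IsBounded Ω
  continuous : Continuous σ
  nonneg : ∀ x, 0 ≤ σ x
  le : ∀ x, σ x ≤ M
  diam_pos : 0 < D
  dist_le : ∀ x ∈ Ω, ∀ y ∈ Ω, dist x y ≤ D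

lemma IsMedium.bound_nonneg (h : IsMedium Ω σ M D) : 0 ≤ M := (h.nonneg 0).trans (h.le 0)

lemma IsMedium.backExit_le (h : IsMedium Ω σ M D) (p : Space n × Dir n) : backExit Ω p ≤ D :=
  backExit_le_diam h.diam_pos.le h.dist_le p

/-- The attenuation along the backward segment of length `s` from `p`. -/
noncomputable def attenuation (σ : Space n → ℝ) (p : Space n × Dir n) (s : ℝ) : ℝ :=
  Real.exp (-∫ r in (0 : ℝ)..s, σ (backPoint p r))

/-- The attenuated incoming flux that reaches `p` without being scattered. -/
noncomputable def ballistic (Ω : Set (Space n)) (σ : Space n → ℝ) (f : Space n × Dir n → ℝ)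
    (p : Space n × Dir n) : ℝ≥0∞ :=
  ENNReal.ofReal (f (entry Ω p) * attenuation σ p (backExit Ω p))

/-- The flux at `p` of an isotropic source `σ F` in `Ω`. -/
noncomputable def lineIntegral (Ω : Set (Space n)) (σ : Space n → ℝ) (F : Space n → ℝ≥0∞)
    (p : Space n × Dir n) : ℝ≥0∞ :=
  ∫⁻ s in Ioo 0 (backExit Ω p),
    ENNReal.ofReal (attenuation σ p s * σ (backPoint p s)) * F (backPoint p s)

/-- The angular average for functions with values in `[0, ∞]`. -/
noncomputable def lavg (g : Space n × Dir n → ℝ≥0∞) (x : Space n) : ℝ≥0∞ :=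
  ∫⁻ θ, g (x, θ) ∂(dirProb n)

/-- The scattering operator. -/
noncomputable def scatter (Ω : Set (Space n)) (σ : Space n → ℝ) (F : Space n → ℝ≥0∞) :
    Space n → ℝ≥0∞ :=
  lavg (lineIntegral Ω σ F)

/-- The angular average of the solution with incoming flux `f`, as a sum over the number of
scattering events. -/
noncomputable def density (Ω : Set (Space n)) (σ : Space n → ℝ) (f : Space n × Dir n → ℝ)
    (x : Space n) : ℝ≥0∞ :=
  ∑' k, (scatter Ω σ)^[k] (lavg (ballistic Ω σ f)) x

/-- The mild solution with incoming flux `f`. -/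
noncomputable def mild (Ω : Set (Space n)) (σ : Space n → ℝ) (f : Space n × Dir n → ℝ)
    (p : Space n × Dir n) : ℝ≥0∞ :=
  ballistic Ω σ f p + lineIntegral Ω σ (density Ω σ f) p

lemma attenuation_pos (p : Space n × Dir n) (s : ℝ) : 0 < attenuation σ p s := Real.exp_pos _

lemma attenuation_nonneg (p : Space n × Dir n) (s : ℝ) : 0 ≤ attenuation σ p s := Real.exp_nonneg _

@[simp] lemma attenuation_zero (p : Space n × Dir n) : attenuation σ p 0 = 1 := by
  simp [attenuation]

lemma IsMedium.continuous_along (h : IsMedium Ω σ M D) (p : Space n × Dir n) :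
    Continuous fun s => σ (backPoint p s) := h.continuous.comp (continuous_backPoint_right p)

lemma IsMedium.attenuation_le_one (h : IsMedium Ω σ M D) (p : Space n × Dir n) {s : ℝ}
    (hs : 0 ≤ s) : attenuation σ p s ≤ 1 := by
  rw [attenuation, Real.exp_le_one_iff, neg_nonpos]
  exact intervalIntegral.integral_nonneg hs fun _ _ => h.nonneg _

lemma IsMedium.attenuation_ge (h : IsMedium Ω σ M D) (p : Space n × Dir n) {s : ℝ}
    (hs : 0 ≤ s) (hsD : s ≤ D) : Real.exp (-(M * D)) ≤ attenuation σ p s := by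
  rw [attenuation, Real.exp_le_exp, neg_le_neg_iff]
  calc ∫ r in (0 : ℝ)..s, σ (backPoint p r) ≤ ∫ r in (0 : ℝ)..s, M :=
        intervalIntegral.integral_mono_on hs ((h.continuous_along p).intervalIntegrable _ _)
          (by simp) fun r _ => h.le _
    _ = M * s := by simp [mul_comm]
    _ ≤ M * D := mul_le_mul_of_nonneg_left hsD h.bound_nonneg

lemma continuous_attenuation (hσ : Continuous σ) :
    Continuous fun q : (Space n × Dir n) × ℝ => attenuation σ q.1 q.2 := by
  unfold attenuation
  refine Real.continuous_exp.comp (Continuous.neg ?_)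
  refine intervalIntegral.continuous_parametric_intervalIntegral_of_continuous
    (f := fun (q : (Space n × Dir n) × ℝ) r => σ (backPoint q.1 r)) ?_ continuous_snd
  exact hσ.comp (continuous_backPoint.comp
    ((continuous_fst.comp continuous_fst).prodMk continuous_snd))

lemma IsMedium.hasDerivAt_attenuation (h : IsMedium Ω σ M D) (p : Space n × Dir n) (s : ℝ) :
    HasDerivAt (attenuation σ p) (-(attenuation σ p s * σ (backPoint p s))) s := by
  have h1 := intervalIntegral.integral_hasDerivAt_right
    ((h.continuous_along p).intervalIntegrable 0 s)
    ((h.continuous_along p).stronglyMeasurableAtFilter _ _) (h.continuous_along p).continuousAt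
  have h2 := h1.neg.exp
  rw [mul_neg] at h2
  exact h2

lemma measurable_lineIntegral_integrand (h : IsMedium Ω σ M D) {F : Space n → ℝ≥0∞}
    (hF : Measurable F) : Measurable fun q : (Space n × Dir n) × ℝ =>
      ENNReal.ofReal (attenuation σ q.1 q.2 * σ (backPoint q.1 q.2)) * F (backPoint q.1 q.2) := by
  have h1 := (continuous_attenuation h.continuous).measurable
  have h2 := (h.continuous.comp continuous_backPoint).measurable
  exact (h1.mul h2).ennreal_ofReal.mul (hF.comp continuous_backPoint.measurable)

lemma measurable_lineIntegral_integrand_along (h : IsMedium Ω σ M D) {F : Space n → ℝ≥0∞}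
    (hF : Measurable F) (p : Space n × Dir n) : Measurable fun s =>
      ENNReal.ofReal (attenuation σ p s * σ (backPoint p s)) * F (backPoint p s) := by
  have h1 : Continuous (attenuation σ p) :=
    continuous_iff_continuousAt.2 fun s => (h.hasDerivAt_attenuation p s).continuousAt
  exact (h1.mul (h.continuous_along p)).measurable.ennreal_ofReal.mul
    (hF.comp (continuous_backPoint_right p).measurable)

lemma measurableSet_ray (ho : IsOpen Ω) (hb : Bornology.IsBounded Ω) :
    MeasurableSet {q : (Space n × Dir n) × ℝ | q.2 ∈ Ioo 0 (backExit Ω q.1)} :=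
  (measurableSet_lt measurable_const measurable_snd).inter
    (measurableSet_lt measurable_snd ((measurable_backExit ho hb).comp measurable_fst))

/-- Integrals over the backward rays depend measurably on the ray. -/
lemma measurable_lintegral_ray (ho : IsOpen Ω) (hb : Bornology.IsBounded Ω)
    {g : (Space n × Dir n) × ℝ → ℝ≥0∞} (hg : Measurable g) :
    Measurable fun p => ∫⁻ s in Ioo 0 (backExit Ω p), g (p, s) := by
  have : (fun p => ∫⁻ s in Ioo 0 (backExit Ω p), g (p, s)) = fun p => ∫⁻ s,
      {q : (Space n × Dir n) × ℝ | q.2 ∈ Ioo 0 (backExit Ω q.1)}.indicator g (p, s) := by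
    funext p
    rw [← lintegral_indicator measurableSet_Ioo]
    rfl
  rw [this]
  exact (hg.indicator (measurableSet_ray ho hb)).lintegral_prod_right'

lemma IsMedium.measurable_lineIntegral (h : IsMedium Ω σ M D) {F : Space n → ℝ≥0∞}
    (hF : Measurable F) : Measurable (lineIntegral Ω σ F) :=
  measurable_lintegral_ray h.isOpen h.isBounded (measurable_lineIntegral_integrand h hF)

lemma measurable_lavg [NeZero n] {g : Space n × Dir n → ℝ≥0∞} (hg : Measurable g) :
    Measurable (lavg g) := hg.lintegral_prod_right'

lemma IsMedium.measurable_scatter [NeZero n] (h : IsMedium Ω σ M D) {F : Space n → ℝ≥0∞}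
    (hF : Measurable F) : Measurable (scatter Ω σ F) :=
  measurable_lavg (h.measurable_lineIntegral hF)

lemma IsMedium.measurable_ballistic (h : IsMedium Ω σ M D) {f : Space n × Dir n → ℝ}
    (hf : Measurable f) : Measurable (ballistic Ω σ f) := by
  have hb := measurable_backExit h.isOpen h.isBounded
  exact ((hf.comp (measurable_entry h.isOpen h.isBounded)).mul
    ((continuous_attenuation h.continuous).measurable.comp (measurable_id.prodMk hb))).ennreal_ofReal

lemma IsMedium.measurable_scatter_iterate [NeZero n] (h : IsMedium Ω σ M D) {F : Space n → ℝ≥0∞}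
    (hF : Measurable F) (k : ℕ) : Measurable ((scatter Ω σ)^[k] F) := by
  induction k with
  | zero => exact hF
  | succ k ih => rw [Function.iterate_succ_apply']; exact h.measurable_scatter ih

lemma IsMedium.measurable_density [NeZero n] (h : IsMedium Ω σ M D) {f : Space n × Dir n → ℝ}
    (hf : Measurable f) : Measurable (density Ω σ f) :=
  Measurable.tsum fun k =>
    h.measurable_scatter_iterate (measurable_lavg (h.measurable_ballistic hf)) k

lemma IsMedium.measurable_mild [NeZero n] (h : IsMedium Ω σ M D) {f : Space n × Dir n → ℝ}
    (hf : Measurable f) : Measurable (mild Ω σ f) :=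
  (h.measurable_ballistic hf).add (h.measurable_lineIntegral (h.measurable_density hf))

/-- The albedo of a medium, a bound for the norm of the scattering operator. -/
noncomputable def albedoBound (M D : ℝ) : ℝ≥0∞ := ENNReal.ofReal (1 - Real.exp (-(M * D)))

lemma albedoBound_lt_one : albedoBound M D < 1 := by
  rw [albedoBound, ← ENNReal.ofReal_one, ENNReal.ofReal_lt_ofReal_iff one_pos]
  linarith [Real.exp_pos (-(M * D))]

lemma one_sub_albedoBound_inv_ne_top : (1 - albedoBound M D)⁻¹ ≠ ⊤ :=
  ENNReal.inv_ne_top.2 (tsub_pos_of_lt albedoBound_lt_one).ne'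

/-- The kernel is minus the derivative of the attenuation, so its mass over a ray is 1 minus the
attenuation at the end. Every contraction estimate below rests on this. -/
lemma IsMedium.lintegral_kernel_le (h : IsMedium Ω σ M D) (p : Space n × Dir n) {b : ℝ}
    (hb : 0 ≤ b) (hbD : b ≤ D) :
    ∫⁻ s in Ioo 0 b, ENNReal.ofReal (attenuation σ p s * σ (backPoint p s)) ≤
      albedoBound M D := by
  have hc : Continuous fun s => attenuation σ p s * σ (backPoint p s) :=
    ((continuous_attenuation h.continuous).comp (continuous_const.prodMk continuous_id)).mul
      (h.continuous_along p)
  have hint : ∫ s in (0 : ℝ)..b, attenuation σ p s * σ (backPoint p s) = 1 - attenuation σ p b := by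
    have := intervalIntegral.integral_eq_sub_of_hasDerivAt (a := 0) (b := b)
      (fun s _ => (h.hasDerivAt_attenuation p s).neg) (by simpa using hc.intervalIntegrable 0 b)
    simpa [sub_eq_add_neg, add_comm] using this
  have h0 : ∀ s, 0 ≤ attenuation σ p s * σ (backPoint p s) := fun s =>
    mul_nonneg (attenuation_nonneg _ _) (h.nonneg _)
  rw [restrict_Ioo_eq_restrict_Ioc,
    ← ofReal_integral_eq_lintegral_ofReal (hc.integrableOn_Ioc) (ae_of_all _ h0),
    ← intervalIntegral.integral_of_le hb, hint]
  exact ENNReal.ofReal_le_ofReal (by linarith [h.attenuation_ge p hb hbD])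

lemma IsMedium.lineIntegral_le (h : IsMedium Ω σ M D) {F : Space n → ℝ≥0∞} {C : ℝ≥0∞}
    (hF : ∀ x, F x ≤ C) (p : Space n × Dir n) : lineIntegral Ω σ F p ≤ albedoBound M D * C := by
  calc lineIntegral Ω σ F p
      ≤ ∫⁻ s in Ioo 0 (backExit Ω p),
          ENNReal.ofReal (attenuation σ p s * σ (backPoint p s)) * C :=
        lintegral_mono fun s => by gcongr; exact hF _
    _ = (∫⁻ s in Ioo 0 (backExit Ω p),
          ENNReal.ofReal (attenuation σ p s * σ (backPoint p s))) * C := by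
        refine lintegral_mul_const _ ?_
        simpa only [mul_one] using
          measurable_lineIntegral_integrand_along h (measurable_const (a := (1 : ℝ≥0∞))) p
    _ ≤ albedoBound M D * C := by
        gcongr
        exact h.lintegral_kernel_le p (backExit_nonneg p) (h.backExit_le p)

lemma lavg_le [NeZero n] {g : Space n × Dir n → ℝ≥0∞} {C : ℝ≥0∞} {x : Space n}
    (hg : ∀ θ, g (x, θ) ≤ C) : lavg g x ≤ C := by
  calc lavg g x ≤ ∫⁻ _, C ∂(dirProb n) := lintegral_mono fun θ => hg θ
    _ = C := by simp

lemma IsMedium.scatter_iterate_le [NeZero n] (h : IsMedium Ω σ M D) {F : Space n → ℝ≥0∞} {C : ℝ≥0∞}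
    (hF : ∀ x, F x ≤ C) (k : ℕ) (x : Space n) :
    (scatter Ω σ)^[k] F x ≤ albedoBound M D ^ k * C := by
  induction k generalizing x with
  | zero => simpa using hF x
  | succ k ih =>
    rw [Function.iterate_succ_apply', pow_succ', mul_assoc]
    exact lavg_le fun θ => h.lineIntegral_le ih _

lemma IsMedium.tsum_scatter_iterate_le [NeZero n] (h : IsMedium Ω σ M D) {F : Space n → ℝ≥0∞}
    {C : ℝ≥0∞} (hF : ∀ x, F x ≤ C) (x : Space n) :
    ∑' k, (scatter Ω σ)^[k] F x ≤ (1 - albedoBound M D)⁻¹ * C := by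
  calc _ ≤ ∑' k, albedoBound M D ^ k * C := ENNReal.tsum_le_tsum fun k => h.scatter_iterate_le hF k x
    _ = _ := by rw [ENNReal.tsum_mul_right, ENNReal.tsum_geometric]

/-- Separating the unscattered term leaves the Neumann series of the once scattered source; beams
are estimated in this form. -/
lemma density_eq_add (f : Space n × Dir n → ℝ) (x : Space n) :
    density Ω σ f x = lavg (ballistic Ω σ f) x +
      ∑' k, (scatter Ω σ)^[k] (scatter Ω σ (lavg (ballistic Ω σ f))) x := by
  rw [density, tsum_eq_zero_add' ENNReal.summable]
  simp [Function.iterate_succ_apply]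

lemma IsMedium.scatter_tsum [NeZero n] (h : IsMedium Ω σ M D) {F : ℕ → Space n → ℝ≥0∞}
    (hF : ∀ k, Measurable (F k)) (x : Space n) :
    scatter Ω σ (fun y => ∑' k, F k y) x = ∑' k, scatter Ω σ (F k) x := by
  have h1 : ∀ p, lineIntegral Ω σ (fun y => ∑' k, F k y) p = ∑' k, lineIntegral Ω σ (F k) p := by
    intro p
    simp only [lineIntegral, ← ENNReal.tsum_mul_left]
    exact lintegral_tsum fun k => (measurable_lineIntegral_integrand_along h (hF k) p).aemeasurable
  simp only [scatter, lavg, h1]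
  exact lintegral_tsum fun k =>
    ((h.measurable_lineIntegral (hF k)).comp measurable_prodMk_left).aemeasurable

lemma IsMedium.density_eq [NeZero n] (h : IsMedium Ω σ M D) {f : Space n × Dir n → ℝ}
    (hf : Measurable f) (x : Space n) :
    density Ω σ f x = lavg (ballistic Ω σ f) x + scatter Ω σ (density Ω σ f) x := by
  conv_lhs => rw [density, tsum_eq_zero_add' ENNReal.summable]
  simp only [Function.iterate_zero, id_eq, Function.iterate_succ_apply']
  congr 1
  exact (h.scatter_tsum (fun k => h.measurable_scatter_iterate
    (measurable_lavg (h.measurable_ballistic hf)) k) x).symm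

lemma IsMedium.lavg_mild [NeZero n] (h : IsMedium Ω σ M D) {f : Space n × Dir n → ℝ}
    (hf : Measurable f) (x : Space n) : lavg (mild Ω σ f) x = density Ω σ f x := by
  rw [h.density_eq hf, scatter, lavg, lavg, lavg, ← lintegral_add_left]
  · rfl
  · exact (h.measurable_ballistic hf).comp measurable_prodMk_left

lemma IsMedium.ballistic_le (h : IsMedium Ω σ M D) {f : Space n × Dir n → ℝ} (hf0 : ∀ p, 0 ≤ f p)
    (p : Space n × Dir n) : ballistic Ω σ f p ≤ ENNReal.ofReal (f (entry Ω p)) :=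
  ENNReal.ofReal_le_ofReal
    (mul_le_of_le_one_right (hf0 _) (h.attenuation_le_one p (backExit_nonneg p)))

lemma IsMedium.lavg_ballistic_le_one [NeZero n] (h : IsMedium Ω σ M D) {f : Space n × Dir n → ℝ}
    (hf0 : ∀ p, 0 ≤ f p) (hf1 : ∀ p, f p ≤ 1) (x : Space n) : lavg (ballistic Ω σ f) x ≤ 1 :=
  lavg_le fun _ => (h.ballistic_le hf0 _).trans (ENNReal.ofReal_le_one.2 (hf1 _))

lemma IsMedium.density_le [NeZero n] (h : IsMedium Ω σ M D) {f : Space n × Dir n → ℝ}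
    (hf0 : ∀ p, 0 ≤ f p) (hf1 : ∀ p, f p ≤ 1) (x : Space n) :
    density Ω σ f x ≤ (1 - albedoBound M D)⁻¹ := by
  have := h.tsum_scatter_iterate_le (h.lavg_ballistic_le_one hf0 hf1) x
  rwa [mul_one] at this

lemma IsMedium.mild_le [NeZero n] (h : IsMedium Ω σ M D) {f : Space n × Dir n → ℝ}
    (hf0 : ∀ p, 0 ≤ f p) (hf1 : ∀ p, f p ≤ 1) (p : Space n × Dir n) :
    mild Ω σ f p ≤ 1 + (1 - albedoBound M D)⁻¹ := by
  refine add_le_add ((h.ballistic_le hf0 _).trans (ENNReal.ofReal_le_one.2 (hf1 _))) ?_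
  calc _ ≤ albedoBound M D * (1 - albedoBound M D)⁻¹ :=
        h.lineIntegral_le (h.density_le hf0 hf1) p
    _ ≤ 1 * _ := by gcongr; exact albedoBound_lt_one.le
    _ = _ := one_mul _

end Kernel

/-! ### Mild solutions: the transport equation and limits along lines. -/

/-- Integration by parts for a continuously differentiable function and a primitive of an
integrable function. -/
lemma integral_deriv_mul_primitive {F F' g : ℝ → ℝ} {c R : ℝ} (hF : ∀ r, HasDerivAt F (F' r) r)
    (hF' : Continuous F') (hg : IntervalIntegrable g volume 0 R) :
    ∫ r in (0 : ℝ)..R, (F' r * (c + ∫ s in (0 : ℝ)..r, g s) + F r * g r) =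
      F R * (c + ∫ s in (0 : ℝ)..R, g s) - F 0 * c := by
  have hd : deriv F = F' := funext fun r => (hF r).deriv
  have h1 : AbsolutelyContinuousOnInterval F 0 R := by
    refine ContDiffOn.absolutelyContinuousOnInterval (ContDiff.contDiffOn ?_)
    rw [contDiff_one_iff_deriv, hd]
    exact ⟨fun r => (hF r).differentiableAt, hF'⟩
  have h2 : AbsolutelyContinuousOnInterval (fun r => c + ∫ s in (0 : ℝ)..r, g s) 0 R := by
    have h3 := hg.absolutelyContinuousOnInterval_intervalIntegral (c := 0) (by simp)
    have h4 : AbsolutelyContinuousOnInterval (fun _ : ℝ => c) 0 R :=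
      ContDiffOn.absolutelyContinuousOnInterval contDiffOn_const
    exact h4.add h3
  have h3 := h1.integral_deriv_mul_eq_sub h2
  simp only [intervalIntegral.integral_same, add_zero] at h3
  rw [← h3]
  refine intervalIntegral.integral_congr_ae ?_
  -- As g is merely integrable, its primitive has derivative g only almost everywhere, and absolute
  -- continuity replaces the classical product rule.
  filter_upwards [hg.ae_hasDerivAt_integral] with x hx hxI
  rw [((hx (uIoc_subset_uIcc hxI) 0 (by simp)).const_add c).deriv, hd]

lemma intervalIntegrable_continuous_mul_bdd {f g : ℝ → ℝ} {C : ℝ} (hf : Continuous f)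
    (hg : Measurable g) (hC : ∀ x, |g x| ≤ C) (a b : ℝ) :
    IntervalIntegrable (fun s => f s * g s) volume a b :=
  have hb : ∀ μ : Measure ℝ, ∀ᵐ x ∂μ, ‖g x‖ ≤ C := fun _ => ae_of_all _ hC
  ⟨(hf.intervalIntegrable a b).1.mul_bdd hg.aestronglyMeasurable (hb _),
    (hf.intervalIntegrable a b).2.mul_bdd hg.aestronglyMeasurable (hb _)⟩

section Mild

variable {n : ℕ} {Ω : Set (Space n)} {σ : Space n → ℝ} {M D : ℝ}

lemma IsMedium.continuous_attenuation_along (h : IsMedium Ω σ M D) (p : Space n × Dir n) :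
    Continuous (attenuation σ p) :=
  continuous_iff_continuousAt.2 fun s => (h.hasDerivAt_attenuation p s).continuousAt

lemma IsMedium.attenuation_add (h : IsMedium Ω σ M D) (p : Space n × Dir n) (r s : ℝ) :
    attenuation σ p (r + s) = attenuation σ p r * attenuation σ (backPoint p r, p.2) s := by
  rw [attenuation, attenuation, attenuation, ← Real.exp_add, ← neg_add,
    ← intervalIntegral.integral_add_adjacent_intervals (b := r)
      ((h.continuous_along p).intervalIntegrable _ _)
      ((h.continuous_along p).intervalIntegrable _ _)]
  congr 3
  have : ∀ t, σ (backPoint (backPoint p r, p.2) t) = σ (backPoint p (r + t)) := fun t => by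
    rw [← backPoint_backPoint p.1 p.2]
  simp_rw [this]
  rw [intervalIntegral.integral_comp_add_left (fun t => σ (backPoint p t)), add_zero]

/-- Along a backward ray, the transport equation in integrated form determines `w` from its value
at the far end. -/
lemma IsMedium.eq_of_transport (h : IsMedium Ω σ M D) (p : Space n × Dir n) {w S : ℝ → ℝ} {R : ℝ}
    (hR : 0 ≤ R)
    (hint : IntervalIntegrable (fun s => σ (backPoint p s) * (S s - w s)) volume 0 R)
    (hw : ∀ r ∈ Icc 0 R, w 0 - w r = ∫ s in (0 : ℝ)..r, σ (backPoint p s) * (S s - w s)) :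
    w 0 = attenuation σ p R * w R +
      ∫ s in (0 : ℝ)..R, attenuation σ p s * σ (backPoint p s) * S s := by
  have hc : Continuous fun r => -(attenuation σ p r * σ (backPoint p r)) :=
    ((h.continuous_attenuation_along p).mul (h.continuous_along p)).neg
  -- The attenuation is the integrating factor: in the derivative of its product with w the terms in
  -- w cancel, and only the source S remains.
  have key := integral_deriv_mul_primitive (c := w 0) (h.hasDerivAt_attenuation p) hc hint.neg
  have hw' : ∀ r ∈ Icc 0 R, w 0 + ∫ s in (0 : ℝ)..r,
      (-fun s => σ (backPoint p s) * (S s - w s)) s = w r := by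
    intro r hr
    simp only [Pi.neg_apply, intervalIntegral.integral_neg, ← hw r hr]
    ring
  rw [hw' R ⟨hR, le_rfl⟩, attenuation_zero, one_mul] at key
  have : ∫ s in (0 : ℝ)..R, attenuation σ p s * σ (backPoint p s) * S s =
      -(attenuation σ p R * w R - w 0) := by
    rw [← key, ← intervalIntegral.integral_neg]
    refine intervalIntegral.integral_congr fun s hs => ?_
    rw [uIcc_of_le hR] at hs
    have hws := hw' s hs
    simp only [Pi.neg_apply] at hws ⊢
    rw [hws]; ring
  rw [this]; ring

/-- Conversely, the integrated form of the transport equation follows from the solution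
formula. -/
lemma IsMedium.transport_of_eq (h : IsMedium Ω σ M D) (p : Space n × Dir n) {w S : ℝ → ℝ} {R : ℝ}
    (hR : 0 ≤ R)
    (hint : IntervalIntegrable (fun s => attenuation σ p s * σ (backPoint p s) * S s) volume 0 R)
    (hw : ∀ r ∈ Icc 0 R, attenuation σ p r * w r =
      w 0 - ∫ s in (0 : ℝ)..r, attenuation σ p s * σ (backPoint p s) * S s) :
    w 0 - w R = ∫ s in (0 : ℝ)..R, σ (backPoint p s) * (S s - w s) := by
  have hne : ∀ s, attenuation σ p s ≠ 0 := fun s => (attenuation_pos p s).ne'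
  -- The attenuated values of w form a primitive by hypothesis, so the inverse attenuation is the
  -- integrating factor that recovers w.
  have hd : ∀ r, HasDerivAt (fun r => (attenuation σ p r)⁻¹)
      (σ (backPoint p r) * (attenuation σ p r)⁻¹) r := by
    intro r
    refine ((h.hasDerivAt_attenuation p r).inv (hne r)).congr_deriv ?_
    have := hne r
    field_simp
  have hc : Continuous fun r => σ (backPoint p r) * (attenuation σ p r)⁻¹ :=
    (h.continuous_along p).mul ((h.continuous_attenuation_along p).inv₀ hne)
  have key := integral_deriv_mul_primitive (c := w 0) hd hc hint.neg
  have hw' : ∀ r ∈ Icc 0 R, w 0 + ∫ s in (0 : ℝ)..r,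
      (-fun s => attenuation σ p s * σ (backPoint p s) * S s) s = attenuation σ p r * w r := by
    intro r hr
    simp only [Pi.neg_apply, intervalIntegral.integral_neg, hw r hr]
    ring
  rw [hw' R ⟨hR, le_rfl⟩, attenuation_zero, inv_one, one_mul, inv_mul_cancel_left₀ (hne R)] at key
  rw [← neg_sub, ← key, ← intervalIntegral.integral_neg]
  refine intervalIntegral.integral_congr fun s hs => ?_
  rw [uIcc_of_le hR] at hs
  have hws := hw' s hs
  simp only [Pi.neg_apply] at hws ⊢
  rw [hws]
  have := hne s
  field_simp
  ring

lemma IsMedium.toReal_lineIntegral (h : IsMedium Ω σ M D) {F : Space n → ℝ≥0∞} (hF : Measurable F)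
    (hF1 : ∀ x, F x ≠ ⊤) (p : Space n × Dir n) :
    (lineIntegral Ω σ F p).toReal = ∫ s in (0 : ℝ)..backExit Ω p,
      attenuation σ p s * σ (backPoint p s) * (F (backPoint p s)).toReal := by
  rw [intervalIntegral.integral_of_le (backExit_nonneg p), lineIntegral,
    restrict_Ioo_eq_restrict_Ioc, ← integral_toReal]
  · refine integral_congr_ae (ae_of_all _ fun s => ?_)
    simp only [ENNReal.toReal_mul]
    rw [ENNReal.toReal_ofReal (mul_nonneg (attenuation_nonneg _ _) (h.nonneg _))]
  · exact (measurable_lineIntegral_integrand_along h hF p).aemeasurable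
  · exact ae_of_all _ fun s => ENNReal.mul_lt_top ENNReal.ofReal_lt_top (hF1 _).lt_top

lemma IsMedium.intervalIntegrable_source (h : IsMedium Ω σ M D) {S : Space n → ℝ}
    (hS : Measurable S) {C : ℝ} (hC : ∀ x, |S x| ≤ C) (p : Space n × Dir n) (a b : ℝ) :
    IntervalIntegrable (fun s => attenuation σ p s * σ (backPoint p s) * S (backPoint p s))
      volume a b :=
  intervalIntegrable_continuous_mul_bdd
    ((h.continuous_attenuation_along p).mul (h.continuous_along p))
    (hS.comp (continuous_backPoint_right p).measurable) (fun _ => hC _) a b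

/-- The real-valued mild solution. -/
noncomputable def mildReal (Ω : Set (Space n)) (σ : Space n → ℝ) (f : Space n × Dir n → ℝ)
    (p : Space n × Dir n) : ℝ := (mild Ω σ f p).toReal

/-- The real-valued angular average of the mild solution. -/
noncomputable def densityReal (Ω : Set (Space n)) (σ : Space n → ℝ) (f : Space n × Dir n → ℝ)
    (x : Space n) : ℝ := (density Ω σ f x).toReal

/-- A bound for mild solutions with incoming flux in `[0, 1]`. -/
noncomputable def solBound (M D : ℝ) : ℝ := (1 + (1 - albedoBound M D)⁻¹).toReal

lemma solBound_ne_top : 1 + (1 - albedoBound M D)⁻¹ ≠ ⊤ :=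
  ENNReal.add_ne_top.2 ⟨ENNReal.one_ne_top, one_sub_albedoBound_inv_ne_top⟩

variable {f : Space n × Dir n → ℝ}

lemma mildReal_nonneg (p : Space n × Dir n) : 0 ≤ mildReal Ω σ f p := ENNReal.toReal_nonneg

lemma densityReal_nonneg (x : Space n) : 0 ≤ densityReal Ω σ f x := ENNReal.toReal_nonneg

lemma solBound_nonneg : 0 ≤ solBound M D := ENNReal.toReal_nonneg

variable [NeZero n]

lemma IsMedium.mildReal_le (h : IsMedium Ω σ M D) (hf0 : ∀ p, 0 ≤ f p) (hf1 : ∀ p, f p ≤ 1)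
    (p : Space n × Dir n) : mildReal Ω σ f p ≤ solBound M D :=
  ENNReal.toReal_mono solBound_ne_top (h.mild_le hf0 hf1 p)

lemma IsMedium.densityReal_le (h : IsMedium Ω σ M D) (hf0 : ∀ p, 0 ≤ f p) (hf1 : ∀ p, f p ≤ 1)
    (x : Space n) : densityReal Ω σ f x ≤ solBound M D :=
  ENNReal.toReal_mono solBound_ne_top ((h.density_le hf0 hf1 x).trans le_add_self)

lemma IsMedium.density_ne_top (h : IsMedium Ω σ M D) (hf0 : ∀ p, 0 ≤ f p) (hf1 : ∀ p, f p ≤ 1)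
    (x : Space n) : density Ω σ f x ≠ ⊤ :=
  ne_top_of_le_ne_top one_sub_albedoBound_inv_ne_top (h.density_le hf0 hf1 x)

lemma IsMedium.mild_ne_top (h : IsMedium Ω σ M D) (hf0 : ∀ p, 0 ≤ f p) (hf1 : ∀ p, f p ≤ 1)
    (p : Space n × Dir n) : mild Ω σ f p ≠ ⊤ :=
  ne_top_of_le_ne_top solBound_ne_top (h.mild_le hf0 hf1 p)

lemma IsMedium.measurable_mildReal (h : IsMedium Ω σ M D) (hf : Measurable f) :
    Measurable (mildReal Ω σ f) := (h.measurable_mild hf).ennreal_toReal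

lemma IsMedium.measurable_densityReal (h : IsMedium Ω σ M D) (hf : Measurable f) :
    Measurable (densityReal Ω σ f) := (h.measurable_density hf).ennreal_toReal

lemma IsMedium.angularAverage_mildReal (h : IsMedium Ω σ M D) (hf : Measurable f)
    (hf0 : ∀ p, 0 ≤ f p) (hf1 : ∀ p, f p ≤ 1) (x : Space n) :
    angularAverage (mildReal Ω σ f) x = densityReal Ω σ f x := by
  rw [angularAverage_eq, densityReal, ← h.lavg_mild hf, lavg]
  exact integral_toReal ((h.measurable_mild hf).comp measurable_prodMk_left).aemeasurable
    (ae_of_all _ fun θ => (h.mild_ne_top hf0 hf1 _).lt_top)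

lemma IsMedium.mildReal_eq (h : IsMedium Ω σ M D) (hf : Measurable f)
    (hf0 : ∀ p, 0 ≤ f p) (hf1 : ∀ p, f p ≤ 1) (p : Space n × Dir n) :
    mildReal Ω σ f p = f (entry Ω p) * attenuation σ p (backExit Ω p) +
      ∫ s in (0 : ℝ)..backExit Ω p,
        attenuation σ p s * σ (backPoint p s) * densityReal Ω σ f (backPoint p s) := by
  have hne := h.mild_ne_top hf0 hf1 p
  rw [mild, ENNReal.add_ne_top] at hne
  rw [mildReal, mild, ENNReal.toReal_add hne.1 hne.2,
    h.toReal_lineIntegral (h.measurable_density hf) (h.density_ne_top hf0 hf1), ballistic,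
    ENNReal.toReal_ofReal (mul_nonneg (hf0 _) (attenuation_nonneg _ _))]
  rfl

lemma IsMedium.abs_densityReal_le (h : IsMedium Ω σ M D) (hf0 : ∀ p, 0 ≤ f p) (hf1 : ∀ p, f p ≤ 1)
    (x : Space n) : |densityReal Ω σ f x| ≤ solBound M D := by
  rw [abs_of_nonneg (densityReal_nonneg x)]
  exact h.densityReal_le hf0 hf1 x

/-- All points of a ray inside Ω share one entry point and attenuation is multiplicative along it,
so moving back by r only removes the source on the first part of the ray. -/
lemma IsMedium.attenuation_mul_mildReal (h : IsMedium Ω σ M D) (hf : Measurable f)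
    (hf0 : ∀ p, 0 ≤ f p) (hf1 : ∀ p, f p ≤ 1) (p : Space n × Dir n) {r : ℝ} (hr0 : 0 ≤ r)
    (hr : r ≤ backExit Ω p) :
    attenuation σ p r * mildReal Ω σ f (backPoint p r, p.2) = mildReal Ω σ f p -
      ∫ s in (0 : ℝ)..r,
        attenuation σ p s * σ (backPoint p s) * densityReal Ω σ f (backPoint p s) := by
  have hbb : ∀ s, backPoint (backPoint p r, p.2) s = backPoint p (r + s) :=
    fun s => backPoint_backPoint p.1 p.2 r s
  have hex : backExit Ω (backPoint p r, p.2) = backExit Ω p - r :=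
    backExit_shift h.isOpen h.isBounded hr0 hr
  have hen : entry Ω (backPoint p r, p.2) = entry Ω p := by
    simp only [entry, hex, hbb, add_sub_cancel]
  have hii := h.intervalIntegrable_source (h.measurable_densityReal hf)
    (h.abs_densityReal_le hf0 hf1) p
  rw [h.mildReal_eq hf hf0 hf1, h.mildReal_eq hf hf0 hf1, hen, hex, mul_add, mul_left_comm,
    ← h.attenuation_add, add_sub_cancel, ← intervalIntegral.integral_const_mul, add_sub_assoc,
    intervalIntegral.integral_interval_sub_left (hii _ _) (hii _ _)]
  congr 1
  have : ∀ s, attenuation σ p r * (attenuation σ (backPoint p r, p.2) s *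
      σ (backPoint (backPoint p r, p.2) s) *
      densityReal Ω σ f (backPoint (backPoint p r, p.2) s)) =
      attenuation σ p (r + s) * σ (backPoint p (r + s)) *
        densityReal Ω σ f (backPoint p (r + s)) := by
    intro s
    rw [h.attenuation_add, hbb]; ring
  simp_rw [this]
  rw [intervalIntegral.integral_comp_add_left (fun s => attenuation σ p s * σ (backPoint p s) *
    densityReal Ω σ f (backPoint p s)), add_zero, add_sub_cancel]

lemma IsMedium.intervalIntegrable_collision (h : IsMedium Ω σ M D) (hf : Measurable f)
    (hf0 : ∀ p, 0 ≤ f p) (hf1 : ∀ p, f p ≤ 1) (p : Space n × Dir n) (a b : ℝ) :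
    IntervalIntegrable (fun s => σ (backPoint p s) * (densityReal Ω σ f (backPoint p s) -
      mildReal Ω σ f (backPoint p s, p.2))) volume a b := by
  have hc := (continuous_backPoint_right p).measurable
  exact intervalIntegrable_continuous_mul_bdd (h.continuous_along p)
    (((h.measurable_densityReal hf).comp hc).sub
      ((h.measurable_mildReal hf).comp (hc.prodMk measurable_const)))
    (fun s => abs_sub_le_of_nonneg_of_le (densityReal_nonneg _)
      (h.densityReal_le hf0 hf1 _) (mildReal_nonneg _) (h.mildReal_le hf0 hf1 _)) a b

/-- The mild solution satisfies the transport equation along every ray, up to the boundary. -/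
lemma IsMedium.mildReal_sub (h : IsMedium Ω σ M D) (hf : Measurable f)
    (hf0 : ∀ p, 0 ≤ f p) (hf1 : ∀ p, f p ≤ 1) (p : Space n × Dir n) {r : ℝ} (hr0 : 0 ≤ r)
    (hr : r ≤ backExit Ω p) :
    mildReal Ω σ f p - mildReal Ω σ f (backPoint p r, p.2) =
      ∫ s in (0 : ℝ)..r, σ (backPoint p s) * (densityReal Ω σ f (backPoint p s) -
        mildReal Ω σ f (backPoint p s, p.2)) := by
  have := h.transport_of_eq p (w := fun s => mildReal Ω σ f (backPoint p s, p.2))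
    (S := fun s => densityReal Ω σ f (backPoint p s)) hr0
    (h.intervalIntegrable_source (h.measurable_densityReal hf) (h.abs_densityReal_le hf0 hf1) p _ _)
    (fun s hs => by
      simpa using h.attenuation_mul_mildReal hf hf0 hf1 p hs.1 (hs.2.trans hr))
  simpa using this

/-- This Lipschitz bound along rays, uniform up to the boundary, is the source of all traces of mild
solutions. -/
lemma IsMedium.abs_mildReal_sub_le (h : IsMedium Ω σ M D) (hf : Measurable f)
    (hf0 : ∀ p, 0 ≤ f p) (hf1 : ∀ p, f p ≤ 1) (p : Space n × Dir n) {r : ℝ} (hr0 : 0 ≤ r)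
    (hr : r ≤ backExit Ω p) :
    |mildReal Ω σ f p - mildReal Ω σ f (backPoint p r, p.2)| ≤ M * solBound M D * r := by
  rw [h.mildReal_sub hf hf0 hf1 p hr0 hr, ← Real.norm_eq_abs]
  calc _ ≤ M * solBound M D * |r - 0| := by
        refine intervalIntegral.norm_integral_le_of_norm_le_const fun s _ => ?_
        rw [norm_mul, Real.norm_of_nonneg (h.nonneg _), Real.norm_eq_abs]
        exact mul_le_mul (h.le _) (abs_sub_le_of_nonneg_of_le (densityReal_nonneg _)
          (h.densityReal_le hf0 hf1 _) (mildReal_nonneg _) (h.mildReal_le hf0 hf1 _))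
          (abs_nonneg _) h.bound_nonneg
    _ = _ := by rw [sub_zero, abs_of_nonneg hr0]

/-- Outside Ω every point is its own entry, so a mild solution carries its data as actual values
there and the incoming trace becomes continuity along the line. -/
lemma mildReal_of_notMem (h : IsMedium Ω σ M D) (hf : Measurable f)
    (hf0 : ∀ p, 0 ≤ f p) (hf1 : ∀ p, f p ≤ 1) {p : Space n × Dir n} (hp : p.1 ∉ Ω) :
    mildReal Ω σ f p = f p := by
  rw [h.mildReal_eq hf hf0 hf1, entry, backExit_of_notMem hp]
  simp

lemma IsMedium.isSolution_mildReal (h : IsMedium Ω σ M D) (hf : Measurable f)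
    (hf0 : ∀ p, 0 ≤ f p) (hf1 : ∀ p, f p ≤ 1) : IsSolution Ω σ (mildReal Ω σ f) where
  integrable := by
    have : IsFiniteMeasure (volume.restrict Ω) :=
      ⟨by simpa using h.isBounded.measure_lt_top⟩
    refine Integrable.of_bound (h.measurable_mildReal hf).aestronglyMeasurable (solBound M D)
      (ae_of_all _ fun p => ?_)
    rw [Real.norm_of_nonneg (mildReal_nonneg p)]
    exact h.mildReal_le hf0 hf1 p
  transport := by
    refine ae_of_all _ fun p a b hab hΩ => ?_
    -- The segment is parametrized backwards from its forward end, so that the whole of it lies on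
    -- one backward ray.
    set q : Space n × Dir n := (p.1 + b • (p.2 : Space n), p.2) with hq
    have hpt : ∀ s, p.1 + s • (p.2 : Space n) = backPoint q (b - s) := by
      intro s
      simp only [hq, backPoint, sub_smul]; abel
    have hco : ∀ s, collision σ (mildReal Ω σ f) (p.1 + s • (p.2 : Space n), p.2) =
        (fun t => σ (backPoint q t) * (densityReal Ω σ f (backPoint q t) -
          mildReal Ω σ f (backPoint q t, q.2))) (b - s) := by
      intro s
      simp only [collision, h.angularAverage_mildReal hf hf0 hf1, hpt]
      rfl
    simp_rw [hco]
    constructor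
    · have := (h.intervalIntegrable_collision hf hf0 hf1 q (b - a) 0).comp_sub_left b
      simpa using this
    · rw [intervalIntegral.integral_comp_sub_left (fun t => σ (backPoint q t) *
        (densityReal Ω σ f (backPoint q t) - mildReal Ω σ f (backPoint q t, q.2))), sub_self,
        hpt a]
      refine h.mildReal_sub hf hf0 hf1 q (sub_nonneg.2 hab) (le_of_lt ?_)
      rw [lt_backExit_iff h.isOpen h.isBounded]
      intro r hr
      have := hΩ (b - r) ⟨by linarith [hr.2], by linarith [hr.1]⟩
      rwa [hpt, sub_sub_cancel] at this

/-- The mild solution assumes its incoming boundary value along every line that enters `Ω`. -/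
lemma IsMedium.tendsto_mildReal_incoming (h : IsMedium Ω σ M D) (hf : Measurable f)
    (hf0 : ∀ p, 0 ≤ f p) (hf1 : ∀ p, f p ≤ 1) {p : Space n × Dir n} (hp : p.1 ∉ Ω)
    (hin : ∀ᶠ t in 𝓝[>] (0 : ℝ), p.1 + t • (p.2 : Space n) ∈ Ω) :
    Tendsto (fun t : ℝ => mildReal Ω σ f (p.1 + t • (p.2 : Space n), p.2)) (𝓝[>] 0)
      (𝓝 (f p)) := by
  obtain ⟨ε, hε, hε'⟩ := mem_nhdsGT_iff_exists_Ioo_subset.1 hin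
  rw [tendsto_iff_dist_tendsto_zero]
  have hlim : Tendsto (fun t : ℝ => M * solBound M D * t) (𝓝[>] 0) (𝓝 0) := by
    have : Tendsto (fun t : ℝ => M * solBound M D * t) (𝓝 0) (𝓝 (M * solBound M D * 0)) :=
      (continuous_const.mul continuous_id).tendsto 0
    rw [mul_zero] at this
    exact this.mono_left nhdsWithin_le_nhds
  refine squeeze_zero' (Eventually.of_forall fun _ => dist_nonneg) ?_ hlim
  filter_upwards [Ioo_mem_nhdsGT hε] with t ht
  have hadv := backExit_advance h.isOpen h.isBounded (x := p.1) (θ := p.2) ht.1.le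
    fun r hr => hε' ⟨hr.1, hr.2.trans_lt ht.2⟩
  rw [backExit_of_notMem (p := (p.1, p.2)) hp, zero_add] at hadv
  have := h.abs_mildReal_sub_le hf hf0 hf1 (p.1 + t • (p.2 : Space n), p.2) ht.1.le hadv.ge
  have hb : (backPoint (p.1 + t • (p.2 : Space n), p.2) t, p.2) = p := by simp [backPoint]
  rw [hb, mildReal_of_notMem h hf hf0 hf1 hp] at this
  exact this

/-- The mild solution has limits along every line that leaves `Ω`. -/
lemma IsMedium.exists_tendsto_mildReal_outgoing (h : IsMedium Ω σ M D) (hf : Measurable f)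
    (hf0 : ∀ p, 0 ≤ f p) (hf1 : ∀ p, f p ≤ 1) {p : Space n × Dir n}
    (hin : ∀ᶠ t in 𝓝[>] (0 : ℝ), backPoint p t ∈ Ω) :
    ∃ l, Tendsto (fun t : ℝ => mildReal Ω σ f (backPoint p t, p.2)) (𝓝[>] 0) (𝓝 l) := by
  obtain ⟨ε, hε, hε'⟩ := mem_nhdsGT_iff_exists_Ioo_subset.1 hin
  have hK : 0 ≤ M * solBound M D := mul_nonneg h.bound_nonneg solBound_nonneg
  have hle : ∀ s ∈ Ioo 0 ε, ∀ t ∈ Ioo 0 ε, s ≤ t →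
      |mildReal Ω σ f (backPoint p s, p.2) - mildReal Ω σ f (backPoint p t, p.2)| ≤
        M * solBound M D * |s - t| := by
    intro s hs t ht hst
    have h1 : t - s < backExit Ω (backPoint p s, p.2) := by
      rw [lt_backExit_iff h.isOpen h.isBounded]
      intro r hr
      rw [show backPoint (backPoint p s, p.2) r = backPoint p (s + r) from
        backPoint_backPoint p.1 p.2 s r]
      exact hε' ⟨by linarith [hs.1, hr.1], by linarith [hr.2, ht.2]⟩
    have := h.abs_mildReal_sub_le hf hf0 hf1 (backPoint p s, p.2) (sub_nonneg.2 hst) h1.le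
    rw [show backPoint (backPoint p s, p.2) (t - s) = backPoint p (s + (t - s)) from
        backPoint_backPoint p.1 p.2 s _, add_sub_cancel] at this
    rwa [abs_sub_comm s t, abs_of_nonneg (sub_nonneg.2 hst)]
  have hlip : LipschitzOnWith ⟨M * solBound M D, hK⟩
      (fun t => mildReal Ω σ f (backPoint p t, p.2)) (Ioo 0 ε) := by
    refine LipschitzOnWith.of_dist_le_mul fun s hs t ht => ?_
    rw [Real.dist_eq, Real.dist_eq]
    rcases le_total s t with hst | hst
    · exact hle s hs t ht hst
    · rw [abs_sub_comm, abs_sub_comm s]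
      exact hle t ht s hs hst
  -- A Lipschitz function on an open interval extends to the end point, and the value of the
  -- extension there is the limit.
  obtain ⟨g, hg, hgeq⟩ := hlip.extend_real
  refine ⟨g 0, Tendsto.congr' ?_ ((hg.continuous.tendsto 0).mono_left nhdsWithin_le_nhds)⟩
  filter_upwards [Ioo_mem_nhdsGT hε] with t ht
  exact (hgeq ht).symm

end Mild

/-! ### The smooth boundary: normals, surface measure, transversal directions. -/

section Boundary

variable {n : ℕ} {Ω : Set (Space n)} {x : Space n} {ρ : Space n → ℝ}

lemma fderiv_apply_eq_inner_gradient (ρ : Space n → ℝ) (x v : Space n) :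
    fderiv ℝ ρ x v = inner ℝ (gradient ρ x) v := by
  rw [gradient, InnerProductSpace.toDual_symm_apply]

lemma continuous_gradient (hρ : ContDiff ℝ ∞ ρ) : Continuous (gradient ρ) := by
  unfold gradient
  exact (InnerProductSpace.toDual ℝ (Space n)).symm.continuous.comp
    (hρ.continuous_fderiv (by simp))

lemma tendsto_line (x v : Space n) : Tendsto (fun t : ℝ => x + t • v) (𝓝[>] 0) (𝓝 x) := by
  have hc : Continuous fun t : ℝ => x + t • v := by fun_prop
  simpa using (hc.tendsto 0).mono_left (nhdsWithin_le_nhds (s := Ioi 0))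

namespace IsLocalDefiningFunction

variable (h : IsLocalDefiningFunction Ω x ρ)

include h

lemma hasDerivAt_line (v : Space n) :
    HasDerivAt (fun t : ℝ => ρ (x + t • v)) (inner ℝ (gradient ρ x) v) 0 := by
  have h1 : HasFDerivAt ρ (fderiv ℝ ρ x) (x + (0 : ℝ) • v) := by
    simpa using (h.1.differentiable (by simp) x).hasFDerivAt
  have h2 : HasDerivAt (fun t : ℝ => x + t • v) v 0 := by
    simpa using ((hasDerivAt_id (0 : ℝ)).smul_const v).const_add x
  rw [← fderiv_apply_eq_inner_gradient]
  exact h1.comp_hasDerivAt 0 h2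

lemma eventually_mem_of_neg {v : Space n} (hv : inner ℝ (gradient ρ x) v < 0) :
    ∀ᶠ t in 𝓝[>] (0 : ℝ), x + t • v ∈ Ω := by
  have h2 := (h.hasDerivAt_line v).hasDerivWithinAt (s := Ioi 0)
  rw [hasDerivWithinAt_iff_tendsto_slope' (by simp)] at h2
  filter_upwards [h2.eventually_lt_const hv, (tendsto_line x v).eventually h.2.2.2,
    self_mem_nhdsWithin] with t ht1 ht2 ht3
  rw [ht2]
  simp only [slope, sub_zero, zero_smul, add_zero, h.2.1, vsub_eq_sub, smul_eq_mul] at ht1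
  have h0 : 0 < t := ht3
  by_contra hn
  exact absurd ht1 (not_lt.2 (mul_nonneg (inv_nonneg.2 h0.le) (not_lt.1 hn)))

lemma eventually_notMem_closure : ∀ᶠ y in 𝓝 x, 0 < ρ y → y ∉ closure Ω := by
  filter_upwards [eventually_eventually_nhds.2 h.2.2.2] with y hy hpos
  rw [mem_closure_iff_frequently, not_frequently]
  filter_upwards [hy, h.1.continuous.continuousAt.eventually_const_lt hpos] with z hz hz' hmem
  exact absurd (hz.1 hmem) (not_lt.2 hz'.le)

lemma eventually_notMem_of_pos {v : Space n} (hv : 0 < inner ℝ (gradient ρ x) v) :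
    ∀ᶠ t in 𝓝[>] (0 : ℝ), x + t • v ∉ closure Ω := by
  have h2 := (h.hasDerivAt_line v).hasDerivWithinAt (s := Ioi 0)
  rw [hasDerivWithinAt_iff_tendsto_slope' (by simp)] at h2
  filter_upwards [h2.eventually_const_lt hv,
    (tendsto_line x v).eventually h.eventually_notMem_closure, self_mem_nhdsWithin]
    with t ht1 ht2 ht3
  apply ht2
  simp only [slope, sub_zero, zero_smul, add_zero, h.2.1, vsub_eq_sub, smul_eq_mul] at ht1
  exact pos_of_mul_pos_right ht1 (inv_nonneg.2 (le_of_lt ht3))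

lemma eventually_eq_zero (ho : IsOpen Ω) : ∀ᶠ y in 𝓝 x, y ∈ frontier Ω → ρ y = 0 := by
  filter_upwards [h.eventually_notMem_closure, h.2.2.2] with y hy1 hy2 hyf
  rw [ho.frontier_eq] at hyf
  apply le_antisymm
  · by_contra hn
    exact hy1 (not_le.1 hn) hyf.1
  · by_contra hn
    exact hyf.2 (hy2.2 (not_le.1 hn))

lemma eventually_isLocalDefiningFunction (ho : IsOpen Ω) :
    ∀ᶠ y in 𝓝 x, y ∈ frontier Ω → IsLocalDefiningFunction Ω y ρ := by
  filter_upwards [h.eventually_eq_zero ho, eventually_eventually_nhds.2 h.2.2.2,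
    (continuous_gradient h.1).continuousAt.eventually_ne h.2.2.1] with y hy1 hy2 hy3 hyf
  exact ⟨h.1, hy1 hyf, hy3, hy2⟩

/-- The unit normal does not depend on the defining function. -/
lemma unitNormal_eq {ρ' : Space n → ℝ} (h' : IsLocalDefiningFunction Ω x ρ') :
    ‖gradient ρ x‖⁻¹ • gradient ρ x = ‖gradient ρ' x‖⁻¹ • gradient ρ' x := by
  set a := gradient ρ x
  set b := gradient ρ' x
  have ha : 0 < ‖a‖ := norm_pos_iff.2 h.2.2.1
  have hb : 0 < ‖b‖ := norm_pos_iff.2 h'.2.2.1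
  -- A direction in which ρ decreases enters Ω, while one in which ρ' increases leaves the closure;
  -- no direction can do both.
  have hle : ∀ v : Space n, inner ℝ a v < 0 → inner ℝ b v ≤ 0 := by
    intro v hv
    by_contra hn
    obtain ⟨t, h1, h2⟩ := ((h.eventually_mem_of_neg hv).and
      (h'.eventually_notMem_of_pos (not_le.1 hn))).exists
    exact h2 (subset_closure h1)
  by_contra hne
  have hlt : inner ℝ a b < ‖a‖ * ‖b‖ := by
    refine lt_of_le_of_ne (real_inner_le_norm a b) fun heq => hne ?_
    have := inner_eq_norm_mul_iff_real.1 heq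
    have h3 : a = (‖a‖ * ‖b‖⁻¹) • b := by
      rw [mul_comm, mul_smul, ← this, smul_smul, inv_mul_cancel₀ hb.ne', one_smul]
    rw [h3, smul_smul, norm_smul, norm_mul, norm_inv, norm_norm, norm_norm]
    congr 1
    field_simp
  -- If the unit gradients differ, their difference points strictly inward for ρ and strictly
  -- outward for ρ'.
  have h1 := hle (‖b‖⁻¹ • b - ‖a‖⁻¹ • a) (by
    rw [inner_sub_right, inner_smul_right, inner_smul_right, real_inner_self_eq_norm_sq]
    have : ‖b‖⁻¹ * inner ℝ a b < ‖b‖⁻¹ * (‖a‖ * ‖b‖) := by gcongr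
    have e : ‖b‖⁻¹ * (‖a‖ * ‖b‖) = ‖a‖⁻¹ * ‖a‖ ^ 2 := by field_simp
    linarith)
  rw [inner_sub_right, inner_smul_right, inner_smul_right, real_inner_self_eq_norm_sq,
    real_inner_comm] at h1
  have h2 : ‖a‖⁻¹ * inner ℝ a b < ‖a‖⁻¹ * (‖a‖ * ‖b‖) := by gcongr
  have e : ‖a‖⁻¹ * (‖a‖ * ‖b‖) = ‖b‖⁻¹ * ‖b‖ ^ 2 := by field_simp
  linarith

lemma outwardNormal_eq : outwardNormal Ω x = ‖gradient ρ x‖⁻¹ • gradient ρ x := by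
  have hex : ∃ ρ, IsLocalDefiningFunction Ω x ρ := ⟨ρ, h⟩
  rw [outwardNormal, dif_pos hex]
  exact hex.choose_spec.unitNormal_eq h

lemma inner_outwardNormal (v : Space n) :
    inner ℝ (outwardNormal Ω x) v = ‖gradient ρ x‖⁻¹ * inner ℝ (gradient ρ x) v := by
  rw [h.outwardNormal_eq, real_inner_smul_left]

lemma norm_gradient_pos : 0 < ‖gradient ρ x‖ := norm_pos_iff.2 h.2.2.1

/-- The orthogonal projection along the normal is bi-Lipschitz on the boundary near `x`. -/
lemma eventually_norm_sub_le (ho : IsOpen Ω) :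
    ∃ U ∈ 𝓝[frontier Ω] x, ∀ y ∈ U, ∀ z ∈ U, ‖y - z‖ ≤
      2 * ‖(ℝ ∙ gradient ρ x)ᗮ.orthogonalProjectionOnto (y - z)‖ := by
  set g := gradient ρ x with hg
  have hgpos : 0 < ‖g‖ := h.norm_gradient_pos
  have hs := (h.1.contDiffAt (x := x)).hasStrictFDerivAt (by simp)
  -- For two nearby boundary points y, z both values of ρ vanish, so |⟨g, y - z⟩| ≤ (‖g‖/2)‖y - z‖.
  -- The normal part is thus at most half of y - z, which leaves the factor 2 for the tangential
  -- part.
  have h1 := hs.isLittleO.def (half_pos hgpos)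
  rw [nhds_prod_eq] at h1
  obtain ⟨V, hV, hV'⟩ := mem_prod_same_iff.1 h1
  obtain ⟨W, hW, hW'⟩ := eventually_iff_exists_mem.1 (h.eventually_eq_zero ho)
  refine ⟨frontier Ω ∩ (V ∩ W), inter_mem_nhdsWithin _ (inter_mem hV hW), ?_⟩
  rintro y ⟨hyf, hyV, hyW⟩ z ⟨hzf, hzV, hzW⟩
  have h2 := hV' (mk_mem_prod hyV hzV)
  simp only [mem_ofPred_eq, hW' y hyW hyf, hW' z hzW hzf, sub_zero, zero_sub, norm_neg,
    fderiv_apply_eq_inner_gradient, ← hg] at h2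
  set v := y - z
  have h3 : ‖(ℝ ∙ g).starProjection v‖ ≤ ‖v‖ / 2 := by
    rw [Submodule.starProjection_singleton, norm_smul, norm_div]
    simp only [RCLike.ofReal_real_eq_id, id_eq, norm_pow, norm_norm]
    rw [div_mul_eq_mul_div, div_le_iff₀ (by positivity)]
    nlinarith [norm_nonneg v]
  have h4 := (ℝ ∙ g).starProjection_add_starProjection_orthogonal v
  have h5 : ‖v‖ ≤ ‖(ℝ ∙ g).starProjection v‖ + ‖(ℝ ∙ g)ᗮ.starProjection v‖ := by
    conv_lhs => rw [← h4]
    exact norm_add_le _ _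
  rw [Submodule.starProjection_apply (ℝ ∙ g)ᗮ, Submodule.norm_coe] at h5
  linarith

end IsLocalDefiningFunction

lemma finrank_orthogonal_span_singleton_space {g : Space n} (hg : g ≠ 0) :
    Module.finrank ℝ (ℝ ∙ g)ᗮ = n - 1 := by
  have h1 := (ℝ ∙ g).finrank_add_finrank_orthogonal
  rw [finrank_span_singleton hg, finrank_euclideanSpace_fin] at h1
  omega

/-- On the hyperplane orthogonal to g the (n-1)-dimensional Hausdorff measure is a Haar measure,
hence finite on bounded sets; the antilipschitz bound transports this back to U. -/
lemma hausdorffMeasure_lt_top_of_antilipschitz {g : Space n} (hg : g ≠ 0) {U : Set (Space n)}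
    (hb : Bornology.IsBounded U) {K : ℝ≥0} (hU : ∀ y ∈ U, ∀ z ∈ U, ‖y - z‖ ≤
      K * ‖(ℝ ∙ g)ᗮ.orthogonalProjectionOnto (y - z)‖) :
    Measure.euclideanHausdorffMeasure (n - 1) U < ⊤ := by
  set π := (ℝ ∙ g)ᗮ.orthogonalProjectionOnto
  have hanti : AntilipschitzWith K fun y : U => π y := by
    refine AntilipschitzWith.of_le_mul_dist fun y z => ?_
    rw [Subtype.dist_eq, dist_eq_norm, dist_eq_norm, ← map_sub]
    exact hU y y.2 z z.2
  have h1 := hanti.le_hausdorffMeasure_image (d := (n - 1 : ℕ)) (Nat.cast_nonneg _) univ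
  have h2 := isometry_subtype_coe (s := U).hausdorffMeasure_image (d := (n - 1 : ℕ))
    (Or.inl (Nat.cast_nonneg _)) univ
  rw [image_univ, Subtype.range_coe] at h2
  rw [← h2] at h1
  have hbd : Bornology.IsBounded ((fun y : U => π y) '' univ) := by
    have : (fun y : U => π y) '' univ = π '' U := by
      ext; simp
    rw [this]
    exact π.lipschitz.isBounded_image hb
  have hfin : Measure.hausdorffMeasure ((n - 1 : ℕ) : ℝ) ((fun y : U => π y) '' univ) < ⊤ := by
    have hH : (Measure.hausdorffMeasure ((n - 1 : ℕ) : ℝ) : Measure (ℝ ∙ g)ᗮ).IsAddHaarMeasure := by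
      rw [← finrank_orthogonal_span_singleton_space hg]
      exact isAddHaarMeasure_hausdorffMeasure
    exact hbd.measure_lt_top
  rw [Measure.euclideanHausdorffMeasure_def, Measure.smul_apply, ENNReal.smul_def, smul_eq_mul]
  refine ENNReal.mul_lt_top ENNReal.coe_lt_top (h1.trans_lt (ENNReal.mul_lt_top ?_ hfin))
  exact ENNReal.rpow_lt_top_of_nonneg (Nat.cast_nonneg _) ENNReal.coe_ne_top

namespace IsSmoothBoundedDomain

variable (hΩ : IsSmoothBoundedDomain Ω)

include hΩ

lemma isCompact_frontier : IsCompact (frontier Ω) :=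
  Metric.isCompact_of_isClosed_isBounded isClosed_frontier
    (hΩ.isBounded.closure.subset frontier_subset_closure)

lemma isFiniteMeasure_surfaceMeasure : IsFiniteMeasure (surfaceMeasure Ω) := by
  refine ⟨?_⟩
  rw [surfaceMeasure, Measure.restrict_apply_univ]
  refine hΩ.isCompact_frontier.measure_lt_top_of_nhdsWithin fun x hx => ?_
  obtain ⟨ρ, hρ⟩ := hΩ.smooth x hx
  obtain ⟨U, hU, hU'⟩ := hρ.eventually_norm_sub_le hΩ.isOpen
  refine ⟨U ∩ frontier Ω, inter_mem hU self_mem_nhdsWithin, ?_⟩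
  exact hausdorffMeasure_lt_top_of_antilipschitz hρ.2.2.1 (K := 2)
    (hΩ.isCompact_frontier.isBounded.subset inter_subset_right)
    fun y hy z hz => by simpa using hU' y hy.1 z hz.1

lemma eventually_mem_of_inner_neg (hx : x ∈ frontier Ω) {v : Space n}
    (hv : inner ℝ (outwardNormal Ω x) v < 0) : ∀ᶠ t in 𝓝[>] (0 : ℝ), x + t • v ∈ Ω := by
  obtain ⟨ρ, hρ⟩ := hΩ.smooth x hx
  rw [hρ.inner_outwardNormal] at hv
  exact hρ.eventually_mem_of_neg
    (neg_of_mul_neg_right hv (inv_nonneg.2 (norm_nonneg _)))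

lemma eventually_notMem_of_inner_pos (hx : x ∈ frontier Ω) {v : Space n}
    (hv : 0 < inner ℝ (outwardNormal Ω x) v) :
    ∀ᶠ t in 𝓝[>] (0 : ℝ), x + t • v ∉ closure Ω := by
  obtain ⟨ρ, hρ⟩ := hΩ.smooth x hx
  rw [hρ.inner_outwardNormal] at hv
  exact hρ.eventually_notMem_of_pos (pos_of_mul_pos_right hv (inv_nonneg.2 (norm_nonneg _)))

lemma norm_outwardNormal (hx : x ∈ frontier Ω) : ‖outwardNormal Ω x‖ = 1 := by
  obtain ⟨ρ, hρ⟩ := hΩ.smooth x hx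
  rw [hρ.outwardNormal_eq, norm_smul, norm_inv, norm_norm,
    inv_mul_cancel₀ hρ.norm_gradient_pos.ne']

lemma continuousOn_outwardNormal : ContinuousOn (outwardNormal Ω) (frontier Ω) := by
  intro x hx
  obtain ⟨ρ, hρ⟩ := hΩ.smooth x hx
  have hg := continuous_gradient hρ.1
  have hc : ContinuousAt (fun y => ‖gradient ρ y‖⁻¹ • gradient ρ y) x :=
    (hg.continuousAt.norm.inv₀ hρ.norm_gradient_pos.ne').smul hg.continuousAt
  refine hc.continuousWithinAt.congr_of_eventuallyEq ?_ hρ.outwardNormal_eq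
  filter_upwards [mem_nhdsWithin_of_mem_nhds (hρ.eventually_isLocalDefiningFunction hΩ.isOpen),
    self_mem_nhdsWithin] with y hy hyf
  exact (hy hyf).outwardNormal_eq

/-- Boundary points are limits of exterior points. -/
lemma exists_notMem_closure (hx : x ∈ frontier Ω) {ε : ℝ} (hε : 0 < ε) :
    ∃ y, dist y x < ε ∧ y ∉ closure Ω := by
  obtain ⟨ρ, hρ⟩ := hΩ.smooth x hx
  have h1 := hρ.eventually_notMem_of_pos (v := gradient ρ x)
    (by rw [real_inner_self_eq_norm_sq]; exact pow_pos hρ.norm_gradient_pos 2)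
  obtain ⟨t, ht1, ht2⟩ := (h1.and ((tendsto_line x (gradient ρ x)).eventually
    (Metric.ball_mem_nhds x hε))).exists
  exact ⟨_, ht2, ht1⟩

end IsSmoothBoundedDomain

/-- A measurable version of the outward normal. -/
noncomputable def normalField (Ω : Set (Space n)) : Space n → Space n :=
  (frontier Ω).indicator (outwardNormal Ω)

lemma IsSmoothBoundedDomain.measurable_normalField (hΩ : IsSmoothBoundedDomain Ω) :
    Measurable (normalField Ω) := by
  classical
  rw [normalField, ← piecewise_eq_indicator]
  exact hΩ.continuousOn_outwardNormal.measurable_piecewise continuousOn_const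
    isClosed_frontier.measurableSet

lemma ae_mem_frontier : ∀ᵐ p ∂(boundaryMeasure Ω), p.1 ∈ frontier Ω := by
  have : ∀ᵐ x ∂(surfaceMeasure Ω), x ∈ frontier Ω :=
    ae_restrict_mem isClosed_frontier.measurableSet
  exact Measure.quasiMeasurePreserving_fst.ae this

lemma ae_normalField_eq :
    ∀ᵐ p ∂(boundaryMeasure Ω), normalField Ω p.1 = outwardNormal Ω p.1 := by
  filter_upwards [ae_mem_frontier] with p hp
  exact indicator_of_mem hp _

/-- The sphere measure of a set is a multiple of the volume of the cone over it, and here the cone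
lies in a hyperplane. -/
lemma dirMeasure_inner_eq_zero {a : Space n} (ha : a ≠ 0) :
    dirMeasure n {θ | inner ℝ a (θ : Space n) = 0} = 0 := by
  have hm : MeasurableSet {θ : Dir n | inner ℝ a (θ : Space n) = 0} :=
    (isClosed_eq (by fun_prop) continuous_const).measurableSet
  rw [dirMeasure, Measure.toSphere_apply' _ hm]
  have : volume ((ℝ ∙ a)ᗮ : Set (Space n)) = 0 := by
    refine Measure.addHaar_submodule _ _ fun htop => ha ?_
    have : a ∈ (ℝ ∙ a)ᗮ := htop ▸ Submodule.mem_top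
    rw [Submodule.mem_orthogonal_singleton_iff_inner_right] at this
    exact inner_self_eq_zero.1 this
  rw [mul_eq_zero]
  right
  refine measure_mono_null ?_ this
  rintro _ ⟨r, -, _, ⟨θ, hθ, rfl⟩, rfl⟩
  rw [SetLike.mem_coe, Submodule.mem_orthogonal_singleton_iff_inner_right]
  simp only [inner_smul_right]
  rw [show inner ℝ a (θ : Space n) = 0 from hθ, mul_zero]

/-- Almost every boundary pair is transversal. -/
lemma IsSmoothBoundedDomain.ae_inner_ne_zero (hΩ : IsSmoothBoundedDomain Ω) :
    ∀ᵐ p ∂(boundaryMeasure Ω), inner ℝ (outwardNormal Ω p.1) (p.2 : Space n) ≠ 0 := by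
  have hν := hΩ.measurable_normalField
  have hm : Measurable fun p : Space n × Dir n => inner ℝ (normalField Ω p.1) (p.2 : Space n) :=
    (hν.comp measurable_fst).inner (measurable_subtype_coe.comp measurable_snd)
  have : ∀ᵐ p ∂(boundaryMeasure Ω), inner ℝ (normalField Ω p.1) (p.2 : Space n) ≠ 0 := by
    rw [boundaryMeasure, Measure.ae_prod_iff_ae_ae]
    · have hae : ∀ᵐ x ∂(surfaceMeasure Ω), x ∈ frontier Ω :=
        ae_restrict_mem isClosed_frontier.measurableSet
      filter_upwards [hae] with x hx
      have hne : normalField Ω x ≠ 0 := by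
        rw [normalField, indicator_of_mem hx, ← norm_pos_iff, hΩ.norm_outwardNormal hx]
        exact one_pos
      have := dirMeasure_inner_eq_zero hne
      rw [ae_iff]
      simpa using this
    · exact (hm (measurableSet_singleton 0)).compl
  filter_upwards [this, ae_normalField_eq] with p hp hp'
  rwa [← hp']

end Boundary

/-! ### Boundary data in L¹ and the use of the albedo map. -/

section BoundaryData

variable {n : ℕ} {Ω E : Set (Space n)} {σ σ₁ σ₂ : Space n → ℝ} {M D : ℝ}

lemma norm_outwardNormal_le_one (Ω : Set (Space n)) (x : Space n) : ‖outwardNormal Ω x‖ ≤ 1 := by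
  classical
  rw [outwardNormal]
  split_ifs with h
  · rw [norm_smul, norm_inv, norm_norm]
    exact inv_mul_le_one
  · simp

lemma abs_inner_outwardNormal_le_one (p : Space n × Dir n) :
    |inner ℝ (outwardNormal Ω p.1) (p.2 : Space n)| ≤ 1 := by
  refine (abs_real_inner_le_norm _ _).trans ?_
  rw [norm_dir, mul_one]
  exact norm_outwardNormal_le_one Ω p.1

namespace IsSmoothBoundedDomain

variable (hΩ : IsSmoothBoundedDomain Ω)

include hΩ

lemma isFiniteMeasure_boundaryMeasure : IsFiniteMeasure (boundaryMeasure Ω) := by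
  have := hΩ.isFiniteMeasure_surfaceMeasure
  unfold boundaryMeasure
  infer_instance

lemma isFiniteMeasure_fluxMeasure : IsFiniteMeasure (fluxMeasure Ω) := by
  have := hΩ.isFiniteMeasure_boundaryMeasure
  refine isFiniteMeasure_withDensity (ne_top_of_le_ne_top (measure_ne_top (boundaryMeasure Ω) univ) ?_)
  calc _ ≤ ∫⁻ _, 1 ∂(boundaryMeasure Ω) := lintegral_mono fun p =>
        ENNReal.ofReal_le_one.2 (abs_inner_outwardNormal_le_one p)
    _ = _ := by simp

lemma measurable_inner_normalField :
    Measurable fun p : Space n × Dir n => inner ℝ (normalField Ω p.1) (p.2 : Space n) :=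
  (hΩ.measurable_normalField.comp measurable_fst).inner
    (measurable_subtype_coe.comp measurable_snd)

/-- The flux density vanishes only at tangential pairs. `normalField` serves as a measurable version
of the density. -/
lemma ae_boundary_of_ae_flux {P : Space n × Dir n → Prop} (hP : ∀ᵐ p ∂(fluxMeasure Ω), P p) :
    ∀ᵐ p ∂(boundaryMeasure Ω), inner ℝ (outwardNormal Ω p.1) (p.2 : Space n) ≠ 0 → P p := by
  rw [fluxMeasure, ae_withDensity_iff'] at hP
  · filter_upwards [hP] with p hp hne
    exact hp (by simpa using hne)
  · refine ⟨fun p => ENNReal.ofReal |inner ℝ (normalField Ω p.1) (p.2 : Space n)|, ?_, ?_⟩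
    · have := hΩ.measurable_inner_normalField.norm.ennreal_ofReal
      simpa only [Real.norm_eq_abs] using this
    · filter_upwards [ae_normalField_eq] with p hp
      rw [hp]

/-- A bounded measurable function represents an element of `L¹` of the flux measure. -/
lemma exists_lp_eq {f : Space n × Dir n → ℝ} (hf : Measurable f) {C : ℝ} (hC : ∀ p, |f p| ≤ C)
    {A : Set (Space n × Dir n)} (hA : MeasurableSet A) :
    ∃ F : Lp ℝ 1 ((fluxMeasure Ω).restrict A), ∀ᵐ p ∂(boundaryMeasure Ω), p ∈ A →
      inner ℝ (outwardNormal Ω p.1) (p.2 : Space n) ≠ 0 → F p = f p := by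
  have := hΩ.isFiniteMeasure_fluxMeasure
  have hmem : MemLp f 1 ((fluxMeasure Ω).restrict A) :=
    MemLp.of_bound hf.aestronglyMeasurable C (ae_of_all _ hC)
  refine ⟨hmem.toLp f, ?_⟩
  have h1 := (ae_restrict_iff' hA).1 hmem.coeFn_toLp
  filter_upwards [hΩ.ae_boundary_of_ae_flux h1] with p hp hpA hne
  exact hp hne hpA

lemma measurableSet_incoming (hE : MeasurableSet E) (hEΩ : E ⊆ frontier Ω) :
    MeasurableSet (incoming Ω E) := by
  have : incoming Ω E = {p | p.1 ∈ E} ∩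
      {p | inner ℝ (normalField Ω p.1) (p.2 : Space n) ≤ 0} := by
    ext p
    refine and_congr_right fun hp => ?_
    have : normalField Ω p.1 = outwardNormal Ω p.1 := indicator_of_mem (hEΩ hp) _
    simp [this]
  rw [this]
  exact (measurable_fst hE).inter
    (measurableSet_le hΩ.measurable_inner_normalField measurable_const)

lemma measurableSet_outgoing (hE : MeasurableSet E) (hEΩ : E ⊆ frontier Ω) :
    MeasurableSet (outgoing Ω E) := by
  have : outgoing Ω E = {p | p.1 ∈ E} ∩
      {p | 0 ≤ inner ℝ (normalField Ω p.1) (p.2 : Space n)} := by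
    ext p
    refine and_congr_right fun hp => ?_
    have : normalField Ω p.1 = outwardNormal Ω p.1 := indicator_of_mem (hEΩ hp) _
    simp [this]
  rw [this]
  exact (measurable_fst hE).inter
    (measurableSet_le measurable_const hΩ.measurable_inner_normalField)

lemma hasIncomingTrace_mildReal [NeZero n] (h : IsMedium Ω σ M D) {f : Space n × Dir n → ℝ}
    (hf : Measurable f) (hf0 : ∀ p, 0 ≤ f p) (hf1 : ∀ p, f p ≤ 1) :
    HasIncomingTrace Ω (mildReal Ω σ f) f := by
  filter_upwards [ae_mem_frontier] with p hp hneg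
  exact h.tendsto_mildReal_incoming hf hf0 hf1 (by rw [h.isOpen.frontier_eq] at hp; exact hp.2)
    (hΩ.eventually_mem_of_inner_neg hp hneg)

/-- The mild solution has a bounded measurable outgoing trace. -/
lemma exists_outgoingTrace_mildReal [NeZero n] (h : IsMedium Ω σ M D) {f : Space n × Dir n → ℝ}
    (hf : Measurable f) (hf0 : ∀ p, 0 ≤ f p) (hf1 : ∀ p, f p ≤ 1) :
    ∃ g : Space n × Dir n → ℝ, Measurable g ∧ (∀ p, |g p| ≤ solBound M D) ∧
      HasOutgoingTraceOn Ω (frontier Ω) (mildReal Ω σ f) g := by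
  have hC : 0 ≤ solBound M D := solBound_nonneg
  let t : ℕ → ℝ := fun k => 1 / ((k : ℝ) + 1)
  have ht : Tendsto t atTop (𝓝[>] 0) := by
    rw [tendsto_nhdsWithin_iff]
    exact ⟨tendsto_one_div_add_atTop_nhds_zero_nat, Eventually.of_forall fun k =>
      mem_Ioi.2 (by positivity)⟩
  -- The limit inferior along a fixed sequence of times is measurable and equals the trace wherever
  -- the latter exists; truncation makes it bounded elsewhere too.
  let l : Space n × Dir n → ℝ :=
    fun p => liminf (fun k => mildReal Ω σ f (backPoint p (t k), p.2)) atTop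
  have hl : Measurable l := by
    refine Measurable.liminf fun k => (h.measurable_mildReal hf).comp ?_
    refine Measurable.prodMk ?_ measurable_snd
    exact continuous_backPoint.measurable.comp (measurable_id.prodMk measurable_const)
  refine ⟨fun p => max 0 (min (solBound M D) (l p)),
    measurable_const.max (measurable_const.min hl), fun p => ?_, ?_⟩
  · rw [abs_of_nonneg (le_max_left _ _)]
    exact max_le hC (min_le_left _ _)
  · filter_upwards [ae_mem_frontier] with p hp _ hpos
    have hin : ∀ᶠ t in 𝓝[>] (0 : ℝ), backPoint p t ∈ Ω := by
      have := hΩ.eventually_mem_of_inner_neg hp (v := -(p.2 : Space n))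
        (by rw [inner_neg_right]; linarith)
      filter_upwards [this] with t ht
      simpa [backPoint, sub_eq_add_neg] using ht
    obtain ⟨a, ha⟩ := h.exists_tendsto_mildReal_outgoing hf hf0 hf1 hin
    have hla : l p = a := (ha.comp ht).liminf_eq
    have ha0 : 0 ≤ a := ge_of_tendsto' ha fun t => mildReal_nonneg _
    have ha1 : a ≤ solBound M D := le_of_tendsto' ha fun t => h.mildReal_le hf0 hf1 _
    simp only [hla, min_eq_right ha1, max_eq_right ha0]
    exact ha

/-- If the local albedo maps of two media agree, then the mild solution for the first medium and
some solution for the second one have the same traces. -/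
lemma exists_common_trace [NeZero n] (hE : MeasurableSet E) (hEΩ : E ⊆ frontier Ω)
    (hA : localAlbedo Ω E σ₁ = localAlbedo Ω E σ₂) (h₁ : IsMedium Ω σ₁ M D)
    {f : Space n × Dir n → ℝ} (hf : Measurable f) (hf0 : ∀ p, 0 ≤ f p) (hf1 : ∀ p, f p ≤ 1)
    (hfE : ∀ p, p.1 ∉ E → f p = 0) :
    ∃ u g, IsSolution Ω σ₂ u ∧ HasIncomingTrace Ω u f ∧ HasOutgoingTraceOn Ω E u g ∧
      HasOutgoingTraceOn Ω E (mildReal Ω σ₁ f) g := by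
  obtain ⟨g, hg, hgC, hgt⟩ := hΩ.exists_outgoingTrace_mildReal h₁ hf hf0 hf1
  obtain ⟨F, hF⟩ := hΩ.exists_lp_eq hf (C := 1)
    (fun p => by rw [abs_of_nonneg (hf0 p)]; exact hf1 p) (hΩ.measurableSet_incoming hE hEΩ)
  obtain ⟨G, hG⟩ := hΩ.exists_lp_eq hg hgC (hΩ.measurableSet_outgoing hE hEΩ)
  have hFf : ∀ᵐ p ∂(boundaryMeasure Ω), inner ℝ (outwardNormal Ω p.1) (p.2 : Space n) < 0 →
      (incoming Ω E).indicator F p = f p := by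
    filter_upwards [hF] with p hp hneg
    by_cases hpE : p.1 ∈ E
    · have hpi : p ∈ incoming Ω E := ⟨hpE, hneg.le⟩
      rw [indicator_of_mem hpi, hp hpi hneg.ne]
    · rw [indicator_of_notMem (fun hpi : p ∈ incoming Ω E => hpE hpi.1), hfE p hpE]
  have hout : HasOutgoingTraceOn Ω E (mildReal Ω σ₁ f) G := by
    filter_upwards [hG, hgt] with p hp hp' hpE hpos
    rw [hp ⟨hpE, hpos.le⟩ hpos.ne']
    exact hp' (hEΩ hpE) hpos
  have hmem : ((F, G) : L1Incoming Ω E × L1Outgoing Ω E) ∈ localAlbedo Ω E σ₁ := by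
    refine ⟨mildReal Ω σ₁ f, h₁.isSolution_mildReal hf hf0 hf1, ?_, hout⟩
    filter_upwards [hΩ.hasIncomingTrace_mildReal h₁ hf hf0 hf1, hFf] with p hp hp' hneg
    rw [hp' hneg]
    exact hp hneg
  -- The albedo map is given as a graph, so equality provides only some solution u for the second
  -- medium; the uniqueness theorem identifies it later.
  rw [hA] at hmem
  obtain ⟨u, hu, hui, huo⟩ := hmem
  refine ⟨u, G, hu, ?_, huo, hout⟩
  filter_upwards [hui, hFf] with p hp hp' hneg
  rw [← hp' hneg]
  exact hp hneg

end IsSmoothBoundedDomain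

/-- Only the values in Ω matter, so each coefficient may be replaced by a bounded continuous
extension to the whole space. -/
lemma IsSolution.congr {u : Space n × Dir n → ℝ} (hu : IsSolution Ω σ₁ u)
    (h : ∀ x ∈ Ω, σ₁ x = σ₂ x) : IsSolution Ω σ₂ u := by
  refine ⟨hu.integrable, ?_⟩
  filter_upwards [hu.transport] with p hp a b hab hseg
  have heq : ∀ s ∈ uIcc a b, collision σ₁ u (p.1 + s • (p.2 : Space n), p.2) =
      collision σ₂ u (p.1 + s • (p.2 : Space n), p.2) := by
    intro s hs
    rw [uIcc_of_le hab] at hs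
    simp only [collision, h _ (hseg s hs)]
  obtain ⟨h1, h2⟩ := hp a b hab hseg
  refine ⟨h1.congr fun s hs => heq s (uIoc_subset_uIcc hs), ?_⟩
  rw [h2, intervalIntegral.integral_congr heq]

lemma localAlbedo_congr (h : ∀ x ∈ Ω, σ₁ x = σ₂ x) : localAlbedo Ω E σ₁ = localAlbedo Ω E σ₂ := by
  ext fg
  constructor
  · rintro ⟨u, hu, hu'⟩
    exact ⟨u, hu.congr h, hu'⟩
  · rintro ⟨u, hu, hu'⟩
    exact ⟨u, hu.congr fun x hx => (h x hx).symm, hu'⟩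

end BoundaryData

/-! ### Null sets on the boundary and in phase space, seen along lines. -/

section Lines

variable {n : ℕ} {Ω E : Set (Space n)} {σ σ₁ σ₂ : Space n → ℝ} {M D : ℝ}

/-- The union of the lines in direction `θ` through a set of vanishing `(n-1)`-dimensional measure
is a null set. -/
lemma volume_cylinder_eq_zero {N : Set (Space n)}
    (hN : Measure.euclideanHausdorffMeasure (n - 1) N = 0) (θ : Dir n) :
    volume {x : Space n | ∃ t : ℝ, x + t • (θ : Space n) ∈ N} = 0 := by
  set s : Submodule ℝ (Space n) := (ℝ ∙ (θ : Space n))ᗮ with hs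
  have hθ : (θ : Space n) ≠ 0 := by
    rw [← norm_pos_iff, norm_dir]; exact one_pos
  have hr : Module.finrank ℝ s = n - 1 := finrank_orthogonal_span_singleton_space hθ
  -- Orthogonal projection does not increase Hausdorff measure, and the set in question is a product
  -- of the projection of N with a line.
  have h1 : volume (s.orthogonalProjectionOnto '' N) = 0 := by
    rw [← InnerProductSpace.euclideanHausdorffMeasure_eq_volume, hr]
    rw [Measure.euclideanHausdorffMeasure_def, Measure.smul_apply, ENNReal.smul_def, smul_eq_mul,
      mul_eq_zero] at hN ⊢
    right
    have hN' := hN.resolve_left (by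
      simpa using Measure.addHaarScalarFactor_volume_hausdorffMeasure_ne_zero (n - 1))
    exact le_antisymm
      ((hausdorffMeasure_orthogonalProjectionOnto_le s _ N (Nat.cast_nonneg _)).trans hN'.le)
      zero_le
  have h2 : (volume : Measure (s × sᗮ)) ((s.orthogonalProjectionOnto '' N) ×ˢ univ) = 0 := by
    rw [Measure.volume_eq_prod, Measure.prod_prod, h1, zero_mul]
  have hmp := s.measurePreserving_measurableEquivProd (0 : Space n)
  rw [InnerProductSpace.euclideanHausdorffMeasure_eq_volume] at hmp
  refine measure_mono_null ?_ (hmp.quasiMeasurePreserving.preimage_null h2)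
  rintro x ⟨t, ht⟩
  rw [mem_preimage, Submodule.measurableEquivProd_apply]
  refine ⟨⟨_, ht, ?_⟩, mem_univ _⟩
  have h0 : s.orthogonalProjectionOnto (t • (θ : Space n)) = 0 := by
    rw [Submodule.orthogonalProjectionOnto_eq_zero_iff, hs, Submodule.orthogonal_orthogonal]
    exact Submodule.smul_mem _ _ (Submodule.mem_span_singleton_self _)
  simp [h0]

/-- A property of almost all boundary pairs holds at the boundary pairs of almost every line. -/
lemma IsSmoothBoundedDomain.ae_of_ae_boundary (hΩ : IsSmoothBoundedDomain Ω)
    {P : Space n × Dir n → Prop} (hP : ∀ᵐ p ∂(boundaryMeasure Ω), P p) {c : Space n × Dir n → ℝ}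
    (hc : Measurable c) (hcf : ∀ p : Space n × Dir n, p.1 ∈ Ω →
      p.1 + c p • (p.2 : Space n) ∈ frontier Ω) :
    ∀ᵐ p ∂((volume.restrict Ω).prod (dirMeasure n)), P (p.1 + c p • (p.2 : Space n), p.2) := by
  have := hΩ.isFiniteMeasure_surfaceMeasure
  set N := toMeasurable (boundaryMeasure Ω) {p | ¬ P p} with hNdef
  have hNm : MeasurableSet N := measurableSet_toMeasurable _ _
  have hN0 : boundaryMeasure Ω N = 0 := by
    rw [hNdef, measure_toMeasurable]; exact hP
  have hsec : ∀ᵐ θ ∂(dirMeasure n), ∀ᵐ x ∂(surfaceMeasure Ω), (x, θ) ∉ N := by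
    rw [← Measure.ae_ae_comm hNm.compl]
    have : ∀ᵐ p ∂(boundaryMeasure Ω), p ∉ N := by rw [ae_iff]; simpa using hN0
    exact Measure.ae_ae_of_ae_prod this
  have hem : Measurable fun p : Space n × Dir n => (p.1 + c p • (p.2 : Space n), p.2) :=
    (measurable_fst.add (hc.smul (measurable_subtype_coe.comp measurable_snd))).prodMk
      measurable_snd
  have key : ∀ᵐ p ∂((volume.restrict Ω).prod (dirMeasure n)),
      (p.1 + c p • (p.2 : Space n), p.2) ∉ N := by
    have hm : MeasurableSet {p : Space n × Dir n | (p.1 + c p • (p.2 : Space n), p.2) ∉ N} :=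
      (hem hNm).compl
    -- With θ fixed first, the form of c is irrelevant: an exceptional x lies on a line in direction
    -- θ through an exceptional boundary point, and those lines fill a null set.
    rw [Measure.ae_prod_iff_ae_ae hm, Measure.ae_ae_comm hm]
    filter_upwards [hsec] with θ hθ
    rw [surfaceMeasure, ae_restrict_iff' isClosed_frontier.measurableSet] at hθ
    rw [ae_restrict_iff' hΩ.isOpen.measurableSet]
    have hz := volume_cylinder_eq_zero (N := {x | ¬ (x ∈ frontier Ω → (x, θ) ∉ N)}) hθ θ
    rw [ae_iff]
    refine measure_mono_null ?_ hz
    intro x hx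
    have hx' : ¬ (x ∈ Ω → (x + c (x, θ) • (θ : Space n), θ) ∉ N) := hx
    rw [Classical.not_imp] at hx'
    exact ⟨c (x, θ), by
      simp only [mem_ofPred_eq, Classical.not_imp]
      exact ⟨hcf (x, θ) hx'.1, hx'.2⟩⟩
  filter_upwards [key] with p hp
  by_contra hn
  exact hp (subset_toMeasurable _ _ hn)

/-- The point and direction of exit from `Ω` of the line through `p`. -/
noncomputable def exitPair (Ω : Set (Space n)) (p : Space n × Dir n) : Space n × Dir n :=
  (p.1 + backExit Ω (p.1, -p.2) • (p.2 : Space n), p.2)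

lemma measurable_neg_dir : Measurable fun p : Space n × Dir n => ((p.1, -p.2) : Space n × Dir n) :=
  (continuous_fst.prodMk (continuous_neg.comp continuous_snd)).measurable

lemma exitPair_mem_frontier (ho : IsOpen Ω) (hb : Bornology.IsBounded Ω) {p : Space n × Dir n}
    (hp : p.1 ∈ Ω) : (exitPair Ω p).1 ∈ frontier Ω := by
  have := entry_mem_frontier ho hb (p := (p.1, -p.2)) hp
  rwa [entry, backPoint_neg_dir] at this

lemma entry_eq (Ω : Set (Space n)) (p : Space n × Dir n) :
    entry Ω p = (p.1 + (-backExit Ω p) • (p.2 : Space n), p.2) := by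
  simp [entry, backPoint, sub_eq_add_neg]

namespace IsSmoothBoundedDomain

variable (hΩ : IsSmoothBoundedDomain Ω)

include hΩ

lemma ae_entry {P : Space n × Dir n → Prop} (hP : ∀ᵐ p ∂(boundaryMeasure Ω), P p) :
    ∀ᵐ p ∂((volume.restrict Ω).prod (dirMeasure n)), P (entry Ω p) := by
  have := hΩ.ae_of_ae_boundary hP (measurable_backExit hΩ.isOpen hΩ.isBounded).neg fun p hp => by
    have := entry_mem_frontier hΩ.isOpen hΩ.isBounded hp
    rwa [entry_eq] at this
  filter_upwards [this] with p hp
  rw [entry_eq]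
  exact hp

lemma ae_exitPair {P : Space n × Dir n → Prop} (hP : ∀ᵐ p ∂(boundaryMeasure Ω), P p) :
    ∀ᵐ p ∂((volume.restrict Ω).prod (dirMeasure n)), P (exitPair Ω p) :=
  hΩ.ae_of_ae_boundary hP
    ((measurable_backExit hΩ.isOpen hΩ.isBounded).comp measurable_neg_dir)
    fun _ hp => exitPair_mem_frontier hΩ.isOpen hΩ.isBounded hp

lemma ae_mem : ∀ᵐ p ∂((volume.restrict Ω).prod (dirMeasure n)), p.1 ∈ Ω :=
  Measure.quasiMeasurePreserving_fst.ae (ae_restrict_mem hΩ.isOpen.measurableSet)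

/-- A strictly outward direction at the entry would leave the closure at once, whereas the line runs
inside Ω right after its entry. -/
lemma inner_entry_nonpos {p : Space n × Dir n} (hp : p.1 ∈ Ω) :
    inner ℝ (outwardNormal Ω (entry Ω p).1) (p.2 : Space n) ≤ 0 := by
  by_contra hn
  have h1 := hΩ.eventually_notMem_of_inner_pos
    (entry_mem_frontier hΩ.isOpen hΩ.isBounded hp) (not_le.1 hn)
  obtain ⟨t, ht, ht'⟩ := (h1.and (Ioo_mem_nhdsGT (backExit_pos hΩ.isOpen hΩ.isBounded hp))).exists
  refine ht (subset_closure ?_)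
  have : (entry Ω p).1 + t • (p.2 : Space n) = backPoint p (backExit Ω p - t) := by
    simp only [entry, backPoint, sub_smul]; abel
  rw [this]
  exact backPoint_mem_of_lt (by linarith [ht'.2]) (by linarith [ht'.1])

lemma ae_inner_entry_neg : ∀ᵐ p ∂((volume.restrict Ω).prod (dirMeasure n)),
    inner ℝ (outwardNormal Ω (entry Ω p).1) (p.2 : Space n) < 0 := by
  filter_upwards [hΩ.ae_entry hΩ.ae_inner_ne_zero, hΩ.ae_mem] with p hp hpΩ
  exact lt_of_le_of_ne (hΩ.inner_entry_nonpos hpΩ) hp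

lemma inner_exitPair_nonneg {p : Space n × Dir n} (hp : p.1 ∈ Ω) :
    0 ≤ inner ℝ (outwardNormal Ω (exitPair Ω p).1) (p.2 : Space n) := by
  have := hΩ.inner_entry_nonpos (p := (p.1, -p.2)) hp
  rw [entry, backPoint_neg_dir] at this
  simp only [coe_neg_sphere, inner_neg_right] at this
  exact neg_nonpos.1 this

lemma ae_inner_exitPair_pos : ∀ᵐ p ∂((volume.restrict Ω).prod (dirMeasure n)),
    0 < inner ℝ (outwardNormal Ω (exitPair Ω p).1) (p.2 : Space n) := by
  filter_upwards [hΩ.ae_exitPair hΩ.ae_inner_ne_zero, hΩ.ae_mem] with p hp hpΩ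
  exact lt_of_le_of_ne (hΩ.inner_exitPair_nonneg hpΩ) (Ne.symm hp)

end IsSmoothBoundedDomain

/-- Free transport is a shear of phase space: for each fixed direction it is a translation in x. -/
lemma measurePreserving_backPoint (μ : Measure (Dir n)) [SFinite μ] (s : ℝ) :
    MeasurePreserving (fun p : Space n × Dir n => (backPoint p s, p.2))
      (volume.prod μ) (volume.prod μ) := by
  have h1 : MeasurePreserving (fun q : Dir n × Space n => (q.1, q.2 - s • (q.1 : Space n)))
      (μ.prod volume) (μ.prod volume) := by
    refine (MeasurePreserving.id μ).skew_product
      (g := fun θ x => x - s • (θ : Space n)) ?_ ?_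
    · exact measurable_snd.sub ((measurable_subtype_coe.comp measurable_fst).const_smul s)
    · exact ae_of_all _ fun θ => (measurePreserving_sub_right volume (s • (θ : Space n))).map_eq
  exact (Measure.measurePreserving_swap.comp h1).comp Measure.measurePreserving_swap

/-- A property of almost all points of the phase space holds almost everywhere along almost every
line. -/
lemma ae_ae_backPoint {Q : Space n × Dir n → Prop} (hQ : ∀ᵐ p ∂(volume.prod (dirMeasure n)), Q p) :
    ∀ᵐ p ∂((volume : Measure (Space n)).prod (dirMeasure n)), ∀ᵐ s : ℝ, Q (backPoint p s, p.2) := by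
  set N := toMeasurable (volume.prod (dirMeasure n)) {p : Space n × Dir n | ¬ Q p} with hNdef
  have hNm : MeasurableSet N := measurableSet_toMeasurable _ _
  have hN0 : ∀ᵐ p ∂(volume.prod (dirMeasure n)), p ∉ N := by
    rw [ae_iff]; simp only [not_not, hNdef]
    exact (measure_toMeasurable _).trans hQ
  have hm : MeasurableSet {q : (Space n × Dir n) × ℝ | (backPoint q.1 q.2, q.1.2) ∉ N} := by
    have hc : Continuous fun q : (Space n × Dir n) × ℝ => (backPoint q.1 q.2, q.1.2) :=
      continuous_backPoint.prodMk (continuous_snd.comp continuous_fst)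
    exact (hc.measurable hNm).compl
  have key : ∀ᵐ p ∂((volume : Measure (Space n)).prod (dirMeasure n)), ∀ᵐ s : ℝ,
      (backPoint p s, p.2) ∉ N := by
    rw [Measure.ae_ae_comm hm]
    exact ae_of_all _ fun s => (measurePreserving_backPoint _ s).quasiMeasurePreserving.ae hN0
  filter_upwards [key] with p hp
  filter_upwards [hp] with s hs
  by_contra hn
  exact hs (subset_toMeasurable _ _ hn)

lemma ae_prod_restrict_iff (hΩ : MeasurableSet Ω) {Q : Space n × Dir n → Prop} :
    (∀ᵐ p ∂((volume.restrict Ω).prod (dirMeasure n)), Q p) ↔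
      ∀ᵐ p ∂((volume : Measure (Space n)).prod (dirMeasure n)), p.1 ∈ Ω → Q p := by
  have : (volume.restrict Ω).prod (dirMeasure n) =
      (volume.prod (dirMeasure n)).restrict (Ω ×ˢ univ) := by
    rw [← Measure.prod_restrict, Measure.restrict_univ]
  rw [this, ae_restrict_iff' (hΩ.prod MeasurableSet.univ)]
  simp

lemma ae_ae_ray (hΩ : MeasurableSet Ω) {Q : Space n × Dir n → Prop}
    (hQ : ∀ᵐ p ∂((volume.restrict Ω).prod (dirMeasure n)), Q p) :
    ∀ᵐ p ∂((volume.restrict Ω).prod (dirMeasure n)), ∀ᵐ s : ℝ, backPoint p s ∈ Ω →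
      Q (backPoint p s, p.2) := by
  rw [ae_prod_restrict_iff hΩ] at hQ ⊢
  filter_upwards [ae_ae_backPoint hQ] with p hp _
  exact hp

end Lines

/-! ### Reciprocity and the L¹ contraction. -/

section Contraction

variable {n : ℕ} {Ω E : Set (Space n)} {σ σ₁ σ₂ : Space n → ℝ} {M D : ℝ}

lemma backPoint_advance (y : Space n) (θ : Dir n) (s r : ℝ) :
    backPoint (backPoint (y, θ) (-s), θ) r = backPoint (y, -θ) (s - r) := by
  rw [backPoint_backPoint, backPoint_neg_dir, ← backPoint_neg]
  congr 1; ring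

/-- Both sides say that the closed segment of length s from y in direction θ lies in Ω, read from
its two ends. -/
lemma lt_backExit_reverse (ho : IsOpen Ω) (hb : Bornology.IsBounded Ω) (y : Space n) (θ : Dir n)
    {s : ℝ} :
    s < backExit Ω (backPoint (y, θ) (-s), θ) ↔ s < backExit Ω (y, -θ) := by
  rw [lt_backExit_iff ho hb, lt_backExit_iff ho hb]
  constructor
  · intro h r hr
    have := h (s - r) ⟨by linarith [hr.2], by linarith [hr.1]⟩
    rwa [backPoint_advance, sub_sub_cancel] at this
  · intro h r hr
    rw [backPoint_advance]
    exact h (s - r) ⟨by linarith [hr.2], by linarith [hr.1]⟩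

/-- Attenuation does not depend on the sense in which a segment is traversed. This gives the adjoint
operator here and the equal losses of the beam on its way in and back later. -/
lemma attenuation_reverse (σ : Space n → ℝ) (y : Space n) (θ : Dir n) (s : ℝ) :
    attenuation σ (backPoint (y, θ) (-s), θ) s = attenuation σ (y, -θ) s := by
  simp only [attenuation, backPoint_advance]
  rw [intervalIntegral.integral_comp_sub_left (fun r => σ (backPoint (y, -θ) r)), sub_self,
    sub_zero]

/-- The adjoint of the scattering operator. -/
lemma IsMedium.lintegral_mul_scatter [NeZero n] (h : IsMedium Ω σ M D) {F g : Space n → ℝ≥0∞}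
    (hF : Measurable F) (hg : Measurable g) :
    ∫⁻ x, g x * scatter Ω σ F x = ∫⁻ y, ENNReal.ofReal (σ y) * F y *
      lavg (fun p => ∫⁻ s in Ioo 0 (backExit Ω (p.1, -p.2)),
        ENNReal.ofReal (attenuation σ (p.1, -p.2) s) * g (backPoint (p.1, -p.2) s)) y := by
  set H : (Space n × Dir n) → ℝ → ℝ≥0∞ := fun p s => (Ioo 0 (backExit Ω p)).indicator
    (fun s => g p.1 * (ENNReal.ofReal (attenuation σ p s * σ (backPoint p s)) *
      F (backPoint p s))) s with hH
  have hHm : Measurable (Function.uncurry H) := by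
    have h1 : Measurable fun q : (Space n × Dir n) × ℝ => g q.1.1 *
        (ENNReal.ofReal (attenuation σ q.1 q.2 * σ (backPoint q.1 q.2)) * F (backPoint q.1 q.2)) :=
      (hg.comp (measurable_fst.comp measurable_fst)).mul (measurable_lineIntegral_integrand h hF)
    exact h1.indicator (measurableSet_ray h.isOpen h.isBounded)
  set H' : (Space n × Dir n) → ℝ → ℝ≥0∞ := fun p s => (Ioo 0 (backExit Ω (p.1, -p.2))).indicator
    (fun s => ENNReal.ofReal (σ p.1) * F p.1 * (ENNReal.ofReal (attenuation σ (p.1, -p.2) s) *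
      g (backPoint (p.1, -p.2) s))) s with hH'
  have hneg : Measurable fun q : (Space n × Dir n) × ℝ => ((q.1.1, -q.1.2), q.2) :=
    (measurable_neg_dir.comp measurable_fst).prodMk measurable_snd
  have hA : Measurable fun q : (Space n × Dir n) × ℝ =>
      ENNReal.ofReal (attenuation σ (q.1.1, -q.1.2) q.2) * g (backPoint (q.1.1, -q.1.2) q.2) :=
    ((continuous_attenuation h.continuous).measurable.comp hneg).ennreal_ofReal.mul
      (hg.comp (continuous_backPoint.measurable.comp hneg))
  have hH'm : Measurable (Function.uncurry H') := by
    have h1 : Measurable fun q : (Space n × Dir n) × ℝ => ENNReal.ofReal (σ q.1.1) * F q.1.1 *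
        (ENNReal.ofReal (attenuation σ (q.1.1, -q.1.2) q.2) *
          g (backPoint (q.1.1, -q.1.2) q.2)) :=
      ((h.continuous.measurable.ennreal_ofReal.mul hF).comp
        (measurable_fst.comp measurable_fst)).mul hA
    exact h1.indicator (hneg (measurableSet_ray h.isOpen h.isBounded))
  -- A scattering path from y to x is now described from its start y instead of its end x; `H` and
  -- `H'` are the two descriptions of its weight.
  have hHH : ∀ s p, H (backPoint p (-s), p.2) s = H' p s := by
    rintro s ⟨y, θ⟩
    have hbb : backPoint (backPoint (y, θ) (-s), θ) s = y := by
      rw [backPoint_backPoint, neg_add_cancel, backPoint_zero]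
    by_cases hs : s ∈ Ioo 0 (backExit Ω (y, -θ))
    · have hs' : s ∈ Ioo 0 (backExit Ω (backPoint (y, θ) (-s), θ)) :=
        ⟨hs.1, (lt_backExit_reverse h.isOpen h.isBounded y θ).2 hs.2⟩
      simp only [hH, hH', indicator_of_mem hs, indicator_of_mem hs', hbb, attenuation_reverse]
      rw [ENNReal.ofReal_mul (attenuation_nonneg _ _), backPoint_neg, backPoint_neg_dir]
      ring
    · have hs' : s ∉ Ioo 0 (backExit Ω (backPoint (y, θ) (-s), θ)) := fun hs' =>
        hs ⟨hs'.1, (lt_backExit_reverse h.isOpen h.isBounded y θ).1 hs'.2⟩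
      simp only [hH, hH', indicator_of_notMem hs, indicator_of_notMem hs']
  clear_value H H'
  have hHi : Measurable fun p => ∫⁻ s, H p s := hHm.lintegral_prod_right'
  have hHi' : Measurable fun p => ∫⁻ s, H' p s := hH'm.lintegral_prod_right'
  have e1 : ∫⁻ x, g x * scatter Ω σ F x = ∫⁻ p, (∫⁻ s, H p s) ∂(volume.prod (dirProb n)) := by
    rw [lintegral_prod _ hHi.aemeasurable]
    refine lintegral_congr fun x => ?_
    rw [scatter, lavg, ← lintegral_const_mul]
    · refine lintegral_congr fun θ => ?_
      simp only [hH]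
      rw [lintegral_indicator measurableSet_Ioo, lintegral_const_mul, lineIntegral]
      exact measurable_lineIntegral_integrand_along h hF (x, θ)
    · exact (h.measurable_lineIntegral hF).comp measurable_prodMk_left
  have e2 : ∫⁻ p, (∫⁻ s, H p s) ∂(volume.prod (dirProb n)) =
      ∫⁻ p, (∫⁻ s, H' p s) ∂(volume.prod (dirProb n)) := by
    rw [lintegral_lintegral_swap hHm.aemeasurable, lintegral_lintegral_swap hH'm.aemeasurable]
    -- For fixed length s the change from x to y is a measure preserving shear.
    refine lintegral_congr fun s => ?_
    rw [← (measurePreserving_backPoint (dirProb n) (-s)).lintegral_comp]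
    · simp only [hHH]
    · exact hHm.of_uncurry_right
  rw [e1, e2, lintegral_prod _ hHi'.aemeasurable]
  refine lintegral_congr fun y => ?_
  rw [lavg, ← lintegral_const_mul]
  · refine lintegral_congr fun θ => ?_
    simp only [hH']
    rw [lintegral_indicator measurableSet_Ioo, lintegral_const_mul]
    exact (h.continuous_attenuation_along _).measurable.ennreal_ofReal.mul
      (hg.comp (continuous_backPoint_right _).measurable)
  · have := (measurable_lintegral_ray h.isOpen h.isBounded (g := fun q =>
      ENNReal.ofReal (attenuation σ q.1 q.2) * g (backPoint q.1 q.2))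
      ((continuous_attenuation h.continuous).measurable.ennreal_ofReal.mul
        (hg.comp continuous_backPoint.measurable))).comp measurable_neg_dir
    exact Measurable.of_uncurry_left (f := fun (x : Space n) (θ : Dir n) =>
      ∫⁻ s in Ioo 0 (backExit Ω (x, -θ)), ENNReal.ofReal (attenuation σ (x, -θ) s) *
        g (backPoint (x, -θ) s)) this

/-- With the weight g = 1 this bounds scattering from L¹(σ dx) to L¹(dx), and with g = σ it gives
the contraction. -/
lemma IsMedium.lintegral_mul_scatter_le [NeZero n] (h : IsMedium Ω σ M D) {F g : Space n → ℝ≥0∞}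
    (hF : Measurable F) (hg : Measurable g) {C : ℝ≥0∞}
    (hC : ∀ p : Space n × Dir n, ∫⁻ s in Ioo 0 (backExit Ω p),
      ENNReal.ofReal (attenuation σ p s) * g (backPoint p s) ≤ C) :
    ∫⁻ x, g x * scatter Ω σ F x ≤ (∫⁻ y in Ω, ENNReal.ofReal (σ y) * F y) * C := by
  have hm : Measurable fun y => ENNReal.ofReal (σ y) * F y :=
    h.continuous.measurable.ennreal_ofReal.mul hF
  rw [h.lintegral_mul_scatter hF hg, ← lintegral_indicator h.isOpen.measurableSet,
    ← lintegral_mul_const _ (hm.indicator h.isOpen.measurableSet)]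
  refine lintegral_mono fun y => ?_
  by_cases hy : y ∈ Ω
  · rw [indicator_of_mem hy]
    gcongr
    exact lavg_le fun θ => hC _
  · rw [indicator_of_notMem hy, zero_mul, lavg]
    simp [backExit_of_notMem (p := (y, _)) hy]

lemma IsMedium.lintegral_scatter_le [NeZero n] (h : IsMedium Ω σ M D) {F : Space n → ℝ≥0∞}
    (hF : Measurable F) : ∫⁻ x, scatter Ω σ F x ≤
      (∫⁻ y in Ω, ENNReal.ofReal (σ y) * F y) * ENNReal.ofReal D := by
  have := h.lintegral_mul_scatter_le hF (measurable_const (a := (1 : ℝ≥0∞)))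
    (C := ENNReal.ofReal D) fun p => ?_
  · simpa using this
  calc _ ≤ ∫⁻ s in Ioo 0 (backExit Ω p), 1 := by
        refine setLIntegral_mono measurable_const fun s hs => ?_
        rw [mul_one]
        exact ENNReal.ofReal_le_one.2 (h.attenuation_le_one p hs.1.le)
    _ ≤ _ := by
        simp only [lintegral_one, Measure.restrict_apply_univ, Real.volume_Ioo, sub_zero]
        exact ENNReal.ofReal_le_ofReal (h.backExit_le p)

/-- The scattering operator is a contraction in `L¹(σ dx)`, so it has no nontrivial
subsolutions. -/
lemma IsMedium.ae_eq_zero_of_le_scatter [NeZero n] (h : IsMedium Ω σ M D) {F : Space n → ℝ≥0∞}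
    (hF : Measurable F) (hfin : ∫⁻ y in Ω, ENNReal.ofReal (σ y) * F y ≠ ⊤)
    (hle : ∀ᵐ x ∂(volume.restrict Ω), F x ≤ scatter Ω σ F x) :
    ∀ᵐ x ∂(volume.restrict Ω), F x = 0 := by
  set I := ∫⁻ y in Ω, ENNReal.ofReal (σ y) * F y
  have h1 : I ≤ I * albedoBound M D := by
    calc I ≤ ∫⁻ x in Ω, ENNReal.ofReal (σ x) * scatter Ω σ F x := by
          refine lintegral_mono_ae ?_
          filter_upwards [hle] with x hx
          gcongr
      _ ≤ ∫⁻ x, ENNReal.ofReal (σ x) * scatter Ω σ F x := setLIntegral_le_lintegral _ _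
      _ ≤ I * albedoBound M D := by
          -- With g = σ the adjoint kernel is again attenuation times σ, whose mass on a ray is
          -- strictly below 1.
          refine h.lintegral_mul_scatter_le hF h.continuous.measurable.ennreal_ofReal fun p => ?_
          simp_rw [← ENNReal.ofReal_mul (attenuation_nonneg p _)]
          exact h.lintegral_kernel_le p (backExit_nonneg p) (h.backExit_le p)
  have h2 : I = 0 := by
    by_contra hne
    have : I * albedoBound M D < I * 1 := ENNReal.mul_lt_mul_right hne hfin albedoBound_lt_one
    rw [mul_one] at this
    exact absurd h1 (not_le.2 this)
  -- The vanishing of I shows only σF = 0, and a medium may have σ = 0 somewhere; the bound by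
  -- `scatter` then forces F = 0 there as well.
  have h3 : ∫⁻ x, scatter Ω σ F x = 0 := by
    have := h.lintegral_scatter_le hF
    rw [show ∫⁻ y in Ω, ENNReal.ofReal (σ y) * F y = 0 from h2, zero_mul] at this
    exact le_antisymm this zero_le
  rw [lintegral_eq_zero_iff (h.measurable_scatter hF)] at h3
  filter_upwards [hle, ae_restrict_of_ae h3] with x hx hx'
  rw [hx'] at hx
  exact le_antisymm hx zero_le

end Contraction

/-! ### Uniqueness of solutions and comparison of the two media. -/

section Uniqueness

variable {n : ℕ} {Ω E : Set (Space n)} {σ σ₁ σ₂ : Space n → ℝ} {M D : ℝ}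

/-- The solution formula along a single line, given the transport equation on it and the limit at
the point of entry. -/
lemma IsMedium.eq_of_transport_of_tendsto (h : IsMedium Ω σ M D) {u : Space n × Dir n → ℝ}
    {p : Space n × Dir n} (hp : p.1 ∈ Ω) {S : Space n → ℝ} {l : ℝ}
    (htr : ∀ a b : ℝ, a ≤ b → (∀ s ∈ Icc a b, p.1 + s • (p.2 : Space n) ∈ Ω) →
      IntervalIntegrable (fun s => collision σ u (p.1 + s • (p.2 : Space n), p.2)) volume a b ∧
      u (p.1 + b • (p.2 : Space n), p.2) - u (p.1 + a • (p.2 : Space n), p.2) =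
        ∫ s in a..b, collision σ u (p.1 + s • (p.2 : Space n), p.2))
    (hl : Tendsto (fun t : ℝ => u ((entry Ω p).1 + t • (p.2 : Space n), p.2)) (𝓝[>] 0) (𝓝 l))
    (hS : ∀ᵐ s : ℝ, backPoint p s ∈ Ω → angularAverage u (backPoint p s) = S (backPoint p s))
    (hint : IntervalIntegrable
      (fun s => attenuation σ p s * σ (backPoint p s) * S (backPoint p s)) volume 0
      (backExit Ω p)) :
    u p = l * attenuation σ p (backExit Ω p) + ∫ s in (0 : ℝ)..backExit Ω p,
      attenuation σ p s * σ (backPoint p s) * S (backPoint p s) := by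
  set τ := backExit Ω p with hτ
  have hτ0 : 0 < τ := backExit_pos h.isOpen h.isBounded hp
  have hpt : ∀ s : ℝ, p.1 + s • (p.2 : Space n) = backPoint p (-s) := fun s =>
    (backPoint_neg p.1 p.2 s).symm
  have hco : ∀ s, collision σ u (p.1 + s • (p.2 : Space n), p.2) =
      (fun r => σ (backPoint p r) * (angularAverage u (backPoint p r) - u (backPoint p r, p.2)))
        (-s) := by
    intro s
    simp only [hpt]
    rfl
  -- The equation holds on segments inside Ω only, so the formula is derived up to R < τ and
  -- continued to the entry by a limit.
  have key : ∀ R ∈ Ioo 0 τ, u p = attenuation σ p R * u (backPoint p R, p.2) +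
      ∫ s in (0 : ℝ)..R, attenuation σ p s * σ (backPoint p s) * S (backPoint p s) := by
    intro R hR
    have hseg : ∀ r ∈ Icc 0 R, ∀ s ∈ Icc (-r) 0, p.1 + s • (p.2 : Space n) ∈ Ω := by
      intro r hr s hs
      rw [hpt]
      exact backPoint_mem_of_lt (by linarith [hs.2]) (by linarith [hs.1, hr.2, hR.2])
    have h1 := h.eq_of_transport p (w := fun r => u (backPoint p r, p.2))
      (S := fun r => angularAverage u (backPoint p r)) hR.1.le ?_ ?_
    · simp only [backPoint_zero] at h1
      rw [show u p = u (p.1, p.2) from rfl, h1]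
      congr 1
      refine intervalIntegral.integral_congr_ae ?_
      filter_upwards [hS] with s hs hsI
      rw [uIoc_of_le hR.1.le] at hsI
      rw [hs (backPoint_mem_of_lt hsI.1.le (hsI.2.trans_lt hR.2))]
    · have := (htr (-R) 0 (by linarith [hR.1]) (hseg R ⟨hR.1.le, le_rfl⟩)).1
      simp_rw [hco] at this
      have h2 := (this.comp_sub_left 0).symm
      simpa using h2
    · intro r hr
      have := (htr (-r) 0 (by linarith [hr.1]) (hseg r hr)).2
      simp_rw [hco] at this
      rw [intervalIntegral.integral_comp_neg (fun r => σ (backPoint p r) *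
        (angularAverage u (backPoint p r) - u (backPoint p r, p.2))), hpt, hpt] at this
      simpa using this
  have hlim1 : Tendsto (fun R => u (backPoint p R, p.2)) (𝓝[<] τ) (𝓝 l) := by
    have hsub : Tendsto (fun R => τ - R) (𝓝[<] τ) (𝓝[>] 0) := by
      rw [tendsto_nhdsWithin_iff]
      constructor
      · have : Tendsto (fun R => τ - R) (𝓝 τ) (𝓝 (τ - τ)) :=
          (continuous_const.sub continuous_id).tendsto τ
        rw [sub_self] at this
        exact this.mono_left nhdsWithin_le_nhds
      · filter_upwards [self_mem_nhdsWithin] with R hR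
        exact mem_Ioi.2 (sub_pos.2 (mem_Iio.1 hR))
    refine (hl.comp hsub).congr fun R => ?_
    have : (entry Ω p).1 + (τ - R) • (p.2 : Space n) = backPoint p R := by
      simp only [entry, backPoint, sub_smul, ← hτ]; abel
    simp only [Function.comp, this]
  have hlim2 : Tendsto (attenuation σ p) (𝓝[<] τ) (𝓝 (attenuation σ p τ)) :=
    ((h.continuous_attenuation_along p).tendsto τ).mono_left nhdsWithin_le_nhds
  have hlim3 : Tendsto (fun R => ∫ s in (0 : ℝ)..R,
      attenuation σ p s * σ (backPoint p s) * S (backPoint p s)) (𝓝[<] τ)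
      (𝓝 (∫ s in (0 : ℝ)..τ, attenuation σ p s * σ (backPoint p s) * S (backPoint p s))) := by
    have hc := intervalIntegral.continuousOn_primitive_interval
      ((intervalIntegrable_iff' enorm_ne_top).1 hint)
    rw [uIcc_of_le hτ0.le] at hc
    refine (hc τ ⟨hτ0.le, le_rfl⟩).mono_left ?_
    rw [← nhdsWithin_Ioo_eq_nhdsLT hτ0]
    exact nhdsWithin_mono _ Ioo_subset_Icc_self
  have hlim := (hlim2.mul hlim1).add hlim3
  have hconst : Tendsto (fun R => attenuation σ p R * u (backPoint p R, p.2) +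
      ∫ s in (0 : ℝ)..R, attenuation σ p s * σ (backPoint p s) * S (backPoint p s)) (𝓝[<] τ)
      (𝓝 (u p)) := by
    refine tendsto_const_nhds.congr' ?_
    filter_upwards [Ioo_mem_nhdsLT hτ0] with R hR
    exact key R hR
  rw [tendsto_nhds_unique hconst hlim, mul_comm l]

/-- Solutions with prescribed incoming flux are unique. -/
theorem IsSmoothBoundedDomain.ae_eq_mildReal [NeZero n] (hΩ : IsSmoothBoundedDomain Ω)
    (h : IsMedium Ω σ M D) {f : Space n × Dir n → ℝ} (hf : Measurable f) (hf0 : ∀ p, 0 ≤ f p)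
    (hf1 : ∀ p, f p ≤ 1) {u : Space n × Dir n → ℝ} (hu : IsSolution Ω σ u)
    (hin : HasIncomingTrace Ω u f) :
    ∀ᵐ p ∂((volume.restrict Ω).prod (dirMeasure n)), u p = mildReal Ω σ f p := by
  have : IsFiniteMeasure (volume.restrict Ω) := ⟨by simpa using h.isBounded.measure_lt_top⟩
  have hae : ∀ {P : Space n → Prop}, (∀ᵐ x ∂(volume.restrict Ω), P x) →
      ∀ᵐ p ∂((volume.restrict Ω).prod (dirMeasure n)), P p.1 := fun hP =>
    Measure.quasiMeasurePreserving_fst.ae hP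
  have hSint : Integrable (angularAverage u) (volume.restrict Ω) := by
    have : angularAverage u = fun x =>
        ((dirMeasure n).real univ)⁻¹ * ∫ θ, u (x, θ) ∂(dirMeasure n) := by
      funext x
      rw [angularAverage, average_eq, smul_eq_mul]
    rw [this]
    exact hu.integrable.integral_prod_left.const_mul _
  -- The average of u need not be measurable as a function; S is a measurable version, which agrees
  -- with it along almost every line.
  obtain ⟨S, hSm, hSeq⟩ := hSint.aestronglyMeasurable.aemeasurable
  have hSint' : Integrable S (volume.restrict Ω) := hSint.congr hSeq
  have hσS : ∀ {G : Space n → ℝ}, Measurable G → Integrable G (volume.restrict Ω) →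
      ∫⁻ y in Ω, ENNReal.ofReal (σ y) * ‖G y‖ₑ ≠ ⊤ := by
    intro G hGm hG
    refine ne_top_of_le_ne_top ?_ (lintegral_mono fun y =>
      mul_le_mul_left (ENNReal.ofReal_le_ofReal (h.le y)) (‖G y‖ₑ))
    rw [lintegral_const_mul _ hGm.enorm]
    exact ENNReal.mul_ne_top ENNReal.ofReal_ne_top hG.2.ne
  -- S is merely integrable, so convergence of its source integral up to the boundary has to be
  -- proved; the L¹ bound for scattering gives it on almost every line.
  have hline : ∀ᵐ p ∂((volume.restrict Ω).prod (dirMeasure n)),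
      lineIntegral Ω σ (fun x => ‖S x‖ₑ) p < ⊤ := by
    have hm := h.measurable_lineIntegral (F := fun x => ‖S x‖ₑ) hSm.enorm
    have hfin : ∫⁻ x, scatter Ω σ (fun x => ‖S x‖ₑ) x ≠ ⊤ :=
      ne_top_of_le_ne_top (ENNReal.mul_ne_top (hσS hSm hSint') ENNReal.ofReal_ne_top)
        (h.lintegral_scatter_le hSm.enorm)
    have hfin' : ∫⁻ p, lineIntegral Ω σ (fun x => ‖S x‖ₑ) p ∂(volume.prod (dirProb n)) ≠ ⊤ := by
      rw [lintegral_prod _ hm.aemeasurable]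
      exact hfin
    have hlt : ∀ᵐ p ∂((volume : Measure (Space n)).prod (dirMeasure n)),
        lineIntegral Ω σ (fun x => ‖S x‖ₑ) p < ⊤ :=
      (Measure.AbsolutelyContinuous.rfl.prod dirMeasure_ac).ae_le (ae_lt_top hm hfin')
    exact (ae_prod_restrict_iff h.isOpen.measurableSet).2 (hlt.mono fun _ hp _ => hp)
  have hformula : ∀ᵐ p ∂((volume.restrict Ω).prod (dirMeasure n)),
      u p = f (entry Ω p) * attenuation σ p (backExit Ω p) + ∫ s in (0 : ℝ)..backExit Ω p,
        attenuation σ p s * σ (backPoint p s) * S (backPoint p s) ∧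
      IntervalIntegrable (fun s => attenuation σ p s * σ (backPoint p s) * S (backPoint p s))
        volume 0 (backExit Ω p) := by
    filter_upwards [hu.transport, hΩ.ae_mem, hline, hΩ.ae_entry hin, hΩ.ae_inner_entry_neg,
      ae_ae_ray h.isOpen.measurableSet (hae hSeq)] with p hp1 hp2 hp3 hp4 hp5 hp6
    have hint : IntervalIntegrable
        (fun s => attenuation σ p s * σ (backPoint p s) * S (backPoint p s)) volume 0
        (backExit Ω p) := by
      rw [intervalIntegrable_iff_integrableOn_Ioo_of_le (backExit_nonneg p) enorm_ne_top]
      refine ⟨?_, ?_⟩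
      · exact (((h.continuous_attenuation_along p).mul (h.continuous_along p)).measurable.mul
          (hSm.comp (continuous_backPoint_right p).measurable)).aestronglyMeasurable
      · rw [HasFiniteIntegral]
        refine lt_of_le_of_lt (lintegral_mono fun s => ?_) hp3
        rw [enorm_mul, Real.enorm_of_nonneg (mul_nonneg (attenuation_nonneg _ _) (h.nonneg _))]
    exact ⟨h.eq_of_transport_of_tendsto hp2 hp1 (hp4 hp5) hp6 hint, hint⟩
  -- Both solution formulas have the same ballistic term, so the difference is controlled by the
  -- difference of the densities.
  have hdiff : ∀ᵐ p ∂((volume.restrict Ω).prod (dirMeasure n)),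
      ‖u p - mildReal Ω σ f p‖ₑ ≤
        lineIntegral Ω σ (fun x => ‖S x - densityReal Ω σ f x‖ₑ) p := by
    filter_upwards [hformula] with p hp
    rw [hp.1, h.mildReal_eq hf hf0 hf1, add_sub_add_left_eq_sub,
      ← intervalIntegral.integral_sub hp.2 (h.intervalIntegrable_source
        (h.measurable_densityReal hf) (h.abs_densityReal_le hf0 hf1) p _ _),
      intervalIntegral.integral_of_le (backExit_nonneg p)]
    refine (enorm_integral_le_lintegral_enorm _).trans (le_of_eq ?_)
    rw [lineIntegral, restrict_Ioo_eq_restrict_Ioc]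
    refine lintegral_congr fun s => ?_
    rw [← mul_sub, enorm_mul,
      Real.enorm_of_nonneg (mul_nonneg (attenuation_nonneg _ _) (h.nonneg _))]
  set F : Space n → ℝ≥0∞ := fun x => ‖S x - densityReal Ω σ f x‖ₑ with hF
  have hFm : Measurable F := (hSm.sub (h.measurable_densityReal hf)).enorm
  have hSd : Integrable (densityReal Ω σ f) (volume.restrict Ω) :=
    Integrable.of_bound (h.measurable_densityReal hf).aestronglyMeasurable (solBound M D)
      (ae_of_all _ (h.abs_densityReal_le hf0 hf1))
  -- Averaging the previous bound over directions makes F a subsolution of the scattering operator.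
  have hFle : ∀ᵐ x ∂(volume.restrict Ω), F x ≤ scatter Ω σ F x := by
    filter_upwards [hSeq, Measure.ae_ae_of_ae_prod hdiff, hu.integrable.prod_right_ae]
      with x hx1 hx2 hx3
    have hx3' : Integrable (fun θ => u (x, θ)) (dirProb n) :=
      hx3.smul_measure (by simpa using dirMeasure_univ_ne_zero)
    have hmi : Integrable (fun θ => mildReal Ω σ f (x, θ)) (dirProb n) :=
      Integrable.of_bound
        ((h.measurable_mildReal hf).comp measurable_prodMk_left).aestronglyMeasurable
        (solBound M D) (ae_of_all _ fun θ => by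
          rw [Real.norm_of_nonneg (mildReal_nonneg _)]
          exact h.mildReal_le hf0 hf1 _)
    simp only [hF]
    rw [← hx1, ← h.angularAverage_mildReal hf hf0 hf1, angularAverage_eq, angularAverage_eq,
      ← integral_sub hx3' hmi]
    exact (enorm_integral_le_lintegral_enorm _).trans (lintegral_mono_ae (dirProb_ac.ae_le hx2))
  have hF0 := h.ae_eq_zero_of_le_scatter hFm
    (hσS (hSm.sub (h.measurable_densityReal hf)) (hSint'.sub hSd)) hFle
  filter_upwards [hdiff, ae_ae_ray h.isOpen.measurableSet (hae hF0)] with p hp hp'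
  have hz : lineIntegral Ω σ F p = 0 := by
    rw [lineIntegral]
    refine (setLIntegral_congr_fun_ae measurableSet_Ioo ?_).trans lintegral_zero
    filter_upwards [hp'] with s hs hsI
    rw [hs (backPoint_mem_of_lt hsI.1.le hsI.2), mul_zero]
  rw [hz] at hp
  have := le_antisymm hp zero_le
  rwa [enorm_eq_zero, sub_eq_zero] at this

/-- If the local albedo maps agree then the mild solutions with the same incoming flux
asymptotically agree at the exit points in `E` of almost all lines. -/
theorem IsSmoothBoundedDomain.ae_mildReal_asymptotic [NeZero n] (hΩ : IsSmoothBoundedDomain Ω)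
    (hE : MeasurableSet E) (hEΩ : E ⊆ frontier Ω)
    (hA : localAlbedo Ω E σ₁ = localAlbedo Ω E σ₂) (h₁ : IsMedium Ω σ₁ M D)
    (h₂ : IsMedium Ω σ₂ M D) {f : Space n × Dir n → ℝ} (hf : Measurable f) (hf0 : ∀ p, 0 ≤ f p)
    (hf1 : ∀ p, f p ≤ 1) (hfE : ∀ p, p.1 ∉ E → f p = 0) :
    ∀ᵐ p ∂((volume.restrict Ω).prod (dirMeasure n)), (exitPair Ω p).1 ∈ E → ∀ ε > 0,
      ∃ t ∈ Ioo 0 (backExit Ω (p.1, -p.2)), backExit Ω (p.1, -p.2) - t < ε ∧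
        |mildReal Ω σ₁ f (p.1 + t • (p.2 : Space n), p.2) -
          mildReal Ω σ₂ f (p.1 + t • (p.2 : Space n), p.2)| < ε := by
  obtain ⟨u, g, hu, hui, huo, hmo⟩ := hΩ.exists_common_trace hE hEΩ hA h₁ hf hf0 hf1 hfE
  filter_upwards [hΩ.ae_mem, hΩ.ae_exitPair huo, hΩ.ae_exitPair hmo, hΩ.ae_inner_exitPair_pos,
    ae_ae_ray hΩ.isOpen.measurableSet (hΩ.ae_eq_mildReal h₂ hf hf0 hf1 hu hui)]
    with p hpΩ hp1 hp2 hp3 hp4 hpE ε hε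
  set T := backExit Ω (p.1, -p.2) with hT
  have hT0 : 0 < T := backExit_pos hΩ.isOpen hΩ.isBounded (p := (p.1, -p.2)) hpΩ
  have hlim := (hp2 hpE hp3).sub (hp1 hpE hp3)
  rw [sub_self] at hlim
  have hev : ∀ᶠ t in 𝓝[>] (0 : ℝ), |mildReal Ω σ₁ f ((exitPair Ω p).1 - t • (p.2 : Space n), p.2) -
      u ((exitPair Ω p).1 - t • (p.2 : Space n), p.2)| < ε := by
    have := hlim.eventually (Metric.ball_mem_nhds (0 : ℝ) hε)
    filter_upwards [this] with t ht
    rwa [Real.dist_eq, sub_zero] at ht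
  obtain ⟨δ, hδ, hδ'⟩ := mem_nhdsGT_iff_exists_Ioo_subset.1 hev
  have hδ0 : (0 : ℝ) < δ := hδ
  set η := min δ (min ε T) with hη
  have hη0 : 0 < η := lt_min hδ0 (lt_min hε hT0)
  -- On the line, u equals the mild solution for almost every parameter only, so the time is chosen
  -- from an interval of positive length just before the exit. The parameter is negative because
  -- `backPoint` runs backwards.
  have hpos : volume (Ioo (-T) (-(T - η))) ≠ 0 := by
    rw [Real.volume_Ioo]
    simp [hη0]
  obtain ⟨s, hs, hsI⟩ := (hp4.and_frequently
    (frequently_ae_mem_iff.2 hpos)).exists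
  have h1 : η ≤ δ := min_le_left _ _
  have h2 : η ≤ ε := (min_le_right _ _).trans (min_le_left _ _)
  have h3 : η ≤ T := (min_le_right _ _).trans (min_le_right _ _)
  have hpt : backPoint p s = p.1 + (-s) • (p.2 : Space n) := by
    simp [backPoint, sub_eq_add_neg]
  have hmem : p.1 + (-s) • (p.2 : Space n) ∈ Ω := by
    rw [← backPoint_neg_dir p.1 p.2]
    exact backPoint_mem_of_lt (by linarith [hsI.2]) (by linarith [hsI.1])
  refine ⟨-s, ⟨by linarith [hsI.2], by linarith [hsI.1]⟩, by linarith [hsI.2], ?_⟩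
  rw [hpt] at hs
  rw [← hs hmem]
  have := hδ' (show T + s ∈ Ioo 0 δ from ⟨by linarith [hsI.1], by linarith [hsI.2]⟩)
  have hex : (exitPair Ω p).1 - (T + s) • (p.2 : Space n) = p.1 + (-s) • (p.2 : Space n) := by
    simp only [exitPair, add_smul, neg_smul, ← hT]; abel
  simp only [mem_ofPred_eq, hex] at this
  exact this

end Uniqueness

/-! ### Scattering of a source supported in a thin tube. -/

section Beam

variable {n : ℕ} {Ω E : Set (Space n)} {σ : Space n → ℝ} {M D : ℝ}

/-- The projection to the orthogonal complement of a direction. -/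
noncomputable def perp (θ : Dir n) : Space n →L[ℝ] Space n := (ℝ ∙ (θ : Space n))ᗮ.starProjection

lemma norm_perp_le (θ : Dir n) (v : Space n) : ‖perp θ v‖ ≤ ‖v‖ :=
  Submodule.norm_starProjection_apply_le _ v

@[simp] lemma perp_self (θ : Dir n) : perp θ (θ : Space n) = 0 := by
  rw [perp, Submodule.starProjection_apply, Submodule.coe_eq_zero,
    Submodule.orthogonalProjectionOnto_eq_zero_iff, Submodule.orthogonal_orthogonal]
  exact Submodule.mem_span_singleton_self _

lemma norm_perp_dir_le (θ₀ θ : Dir n) : ‖perp θ₀ (θ : Space n)‖ ≤ ‖(θ : Space n) - θ₀‖ := by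
  have : perp θ₀ (θ : Space n) = perp θ₀ ((θ : Space n) - θ₀) := by simp
  rw [this]; exact norm_perp_le _ _

lemma norm_perp_dir_le_add (θ₀ θ : Dir n) : ‖perp θ₀ (θ : Space n)‖ ≤ ‖(θ : Space n) + θ₀‖ := by
  have : perp θ₀ (θ : Space n) = perp θ₀ ((θ : Space n) + θ₀) := by simp
  rw [this]; exact norm_perp_le _ _

/-- For n ≥ 2 there is a nonzero vector a orthogonal to θ₀; directions parallel to θ₀ are orthogonal
to a, and these form a null set. -/
lemma ae_perp_ne_zero (hn : 2 ≤ n) (θ₀ : Dir n) :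
    ∀ᵐ θ : Dir n ∂(dirProb n), perp θ₀ (θ : Space n) ≠ 0 := by
  have hr : Module.finrank ℝ (ℝ ∙ (θ₀ : Space n))ᗮ = n - 1 :=
    finrank_orthogonal_span_singleton_space (by rw [← norm_pos_iff, norm_dir]; exact one_pos)
  have : Nontrivial (ℝ ∙ (θ₀ : Space n))ᗮ := Module.nontrivial_of_finrank_pos (R := ℝ) (by omega)
  obtain ⟨⟨a, ha⟩, ha0⟩ := exists_ne (0 : (ℝ ∙ (θ₀ : Space n))ᗮ)
  have ha0' : a ≠ 0 := fun h => ha0 (by simpa using h)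
  refine dirProb_ac.ae_le (ae_iff.2 (measure_mono_null ?_ (dirMeasure_inner_eq_zero ha0')))
  intro θ hθ
  have hθ' : perp θ₀ (θ : Space n) = 0 := by simpa using hθ
  rw [perp, Submodule.starProjection_apply, Submodule.coe_eq_zero,
    Submodule.orthogonalProjectionOnto_eq_zero_iff, Submodule.orthogonal_orthogonal] at hθ'
  exact Submodule.inner_left_of_mem_orthogonal hθ' ha

/-- A bound for the mean length of the intersection of a line through a given point with a tube of
radius `R` about a line in direction `θ₀`. -/
noncomputable def tubeBound (θ₀ : Dir n) (D R : ℝ) : ℝ≥0∞ :=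
  ∫⁻ θ, min (ENNReal.ofReal D) (ENNReal.ofReal (2 * R) / ENNReal.ofReal ‖perp θ₀ (θ : Space n)‖)
    ∂(dirProb n)

lemma measurable_norm_perp (θ₀ : Dir n) :
    Measurable fun θ : Dir n => ‖perp θ₀ (θ : Space n)‖ :=
  ((perp θ₀).continuous.comp continuous_subtype_val).norm.measurable

/-- Dominated convergence, with the length bound D as majorant: the quotient alone need not be
integrable in the direction when n = 2. No rate is needed. -/
lemma tendsto_tubeBound [NeZero n] (hn : 2 ≤ n) (θ₀ : Dir n) (D : ℝ) {R : ℕ → ℝ}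
    (hR : Tendsto R atTop (𝓝 0)) : Tendsto (fun k => tubeBound θ₀ D (R k)) atTop (𝓝 0) := by
  have h0 : (0 : ℝ≥0∞) = ∫⁻ _, 0 ∂(dirProb n) := by simp
  rw [h0]
  refine tendsto_lintegral_of_dominated_convergence (fun _ => ENNReal.ofReal D) (fun k => ?_)
    (fun k => ae_of_all _ fun θ => min_le_left _ _) (by simp) ?_
  · exact measurable_const.min (measurable_const.div (measurable_norm_perp θ₀).ennreal_ofReal)
  · filter_upwards [ae_perp_ne_zero hn θ₀] with θ hθ
    have h1 : Tendsto (fun k => ENNReal.ofReal (2 * R k)) atTop (𝓝 0) := by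
      have := ENNReal.tendsto_ofReal (hR.const_mul 2)
      rwa [mul_zero, ENNReal.ofReal_zero] at this
    have hne : ENNReal.ofReal ‖perp θ₀ (θ : Space n)‖ ≠ 0 := by
      simpa using hθ
    have h2 := ENNReal.Tendsto.div_const h1 (Or.inr hne)
    rw [ENNReal.zero_div] at h2
    have h3 := (tendsto_const_nhds (x := ENNReal.ofReal D)).min h2
    rwa [min_eq_right zero_le] at h3

/-- The component of the ray orthogonal to θ₀ moves at constant speed ‖perp θ₀ θ‖, so it stays in a
ball of radius R for at most 2R divided by that speed. At speed 0 the quotient is ∞, as R > 0, and D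
takes over. -/
lemma volume_tube_le (θ₀ : Dir n) {D R b : ℝ} (hR : 0 < R) (hb : b ≤ D) (x₀ : Space n)
    (p : Space n × Dir n) :
    volume (Ioo 0 b ∩ {s | ‖perp θ₀ (backPoint p s - x₀)‖ ≤ R}) ≤
      min (ENNReal.ofReal D)
        (ENNReal.ofReal (2 * R) / ENNReal.ofReal ‖perp θ₀ (p.2 : Space n)‖) := by
  refine le_min ?_ ?_
  · refine (measure_mono inter_subset_left).trans ?_
    rw [Real.volume_Ioo, sub_zero]
    exact ENNReal.ofReal_le_ofReal hb
  · refine (Real.volume_le_diam _).trans (Metric.ediam_le fun s hs t ht => ?_)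
    have h1 : perp θ₀ (backPoint p t - x₀) - perp θ₀ (backPoint p s - x₀) =
        (s - t) • perp θ₀ (p.2 : Space n) := by
      rw [← map_sub, ← map_smul]
      congr 1
      simp only [backPoint, sub_smul]; abel
    have h2 : |s - t| * ‖perp θ₀ (p.2 : Space n)‖ ≤ 2 * R := by
      rw [← Real.norm_eq_abs, ← norm_smul, ← h1]
      have hs2 : ‖perp θ₀ (backPoint p s - x₀)‖ ≤ R := hs.2
      have ht2 : ‖perp θ₀ (backPoint p t - x₀)‖ ≤ R := ht.2
      linarith [norm_sub_le (perp θ₀ (backPoint p t - x₀)) (perp θ₀ (backPoint p s - x₀))]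
    rw [edist_dist, Real.dist_eq]
    refine ENNReal.le_div_iff_mul_le (Or.inr ?_) (Or.inl ENNReal.ofReal_ne_top) |>.2 ?_
    · simpa using hR
    · rw [← ENNReal.ofReal_mul (abs_nonneg _)]
      exact ENNReal.ofReal_le_ofReal h2

/-- Along each ray the source contributes at most mM per unit length, and only while the ray is in
the tube. -/
lemma IsMedium.scatter_tube_le [NeZero n] (h : IsMedium Ω σ M D) (θ₀ : Dir n) (x₀ : Space n)
    {F : Space n → ℝ≥0∞} {m : ℝ≥0∞} {R : ℝ} (hR : 0 < R) (hF : ∀ x, F x ≤ m)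
    (hF0 : ∀ x, R < ‖perp θ₀ (x - x₀)‖ → F x = 0) (x : Space n) :
    scatter Ω σ F x ≤ m * (ENNReal.ofReal M * tubeBound θ₀ D R) := by
  rw [tubeBound, ← mul_assoc, ← lintegral_const_mul]
  · refine lintegral_mono fun θ => ?_
    have hms : MeasurableSet {s | ‖perp θ₀ (backPoint (x, θ) s - x₀)‖ ≤ R} :=
      (isClosed_le (((perp θ₀).continuous.comp ((continuous_backPoint_right _).sub
        continuous_const)).norm) continuous_const).measurableSet
    calc lineIntegral Ω σ F (x, θ)
        ≤ ∫⁻ s in Ioo 0 (backExit Ω (x, θ)),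
            {s | ‖perp θ₀ (backPoint (x, θ) s - x₀)‖ ≤ R}.indicator
              (fun _ => m * ENNReal.ofReal M) s := by
          refine setLIntegral_mono (measurable_const.indicator hms) fun s hs => ?_
          by_cases hsR : s ∈ {s | ‖perp θ₀ (backPoint (x, θ) s - x₀)‖ ≤ R}
          · rw [indicator_of_mem hsR, mul_comm]
            gcongr
            · exact hF _
            · exact (mul_le_of_le_one_left (h.nonneg _) (h.attenuation_le_one _ hs.1.le)).trans
                (h.le _)
          · rw [hF0 _ (not_le.1 hsR), mul_zero]
            exact zero_le
      _ = m * ENNReal.ofReal M * volume (Ioo 0 (backExit Ω (x, θ)) ∩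
            {s | ‖perp θ₀ (backPoint (x, θ) s - x₀)‖ ≤ R}) := by
          rw [lintegral_indicator hms, setLIntegral_const, Measure.restrict_apply hms, inter_comm]
      _ ≤ _ := by
          gcongr
          exact volume_tube_le θ₀ hR (h.backExit_le _) x₀ (x, θ)
  · exact measurable_const.min (measurable_const.div (measurable_norm_perp θ₀).ennreal_ofReal)

end Beam

/-! ### The density produced by a narrow beam. -/

section BeamSource

variable {n : ℕ} {Ω E : Set (Space n)} {σ : Space n → ℝ} {M D δ : ℝ} {x₀ : Space n} {θ₀ : Dir n}

/-- The directions at distance at most `δ` from `θ₀`. -/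
def dirCap (θ₀ : Dir n) (δ : ℝ) : Set (Dir n) := {θ | ‖(θ : Space n) - θ₀‖ ≤ δ}

lemma measurableSet_dirCap (θ₀ : Dir n) (δ : ℝ) : MeasurableSet (dirCap θ₀ δ) :=
  (isClosed_le (by fun_prop) continuous_const).measurableSet

lemma dirProb_dirCap_pos [NeZero n] (θ₀ : Dir n) (hδ : 0 < δ) : dirProb n (dirCap θ₀ δ) ≠ 0 := by
  intro h0
  have h1 := dirMeasure_ac h0
  refine (Metric.measure_ball_pos (dirMeasure n) θ₀ hδ).ne' (measure_mono_null ?_ h1)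
  intro θ hθ
  rw [Metric.mem_ball, Subtype.dist_eq, dist_eq_norm] at hθ
  exact hθ.le

/-- The indicator function of a narrow beam of incoming lines about the line through `x₀` in
direction `θ₀`. -/
noncomputable def beam (E : Set (Space n)) (x₀ : Space n) (θ₀ : Dir n) (D δ : ℝ) :
    Space n × Dir n → ℝ :=
  {p | p.1 ∈ E ∧ ‖perp θ₀ (p.1 - x₀)‖ ≤ (D + 1) * δ ∧ p.2 ∈ dirCap θ₀ δ}.indicator 1

lemma measurable_beam (hE : MeasurableSet E) : Measurable (beam E x₀ θ₀ D δ) := by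
  refine measurable_one.indicator ((measurable_fst hE).inter (MeasurableSet.inter ?_
    (measurable_snd (measurableSet_dirCap θ₀ δ))))
  exact (isClosed_le (((perp θ₀).continuous.comp (continuous_fst.sub continuous_const)).norm)
    continuous_const).measurableSet

lemma beam_nonneg (p : Space n × Dir n) : 0 ≤ beam E x₀ θ₀ D δ p :=
  indicator_nonneg (fun _ _ => zero_le_one) p

lemma beam_le_one (p : Space n × Dir n) : beam E x₀ θ₀ D δ p ≤ 1 :=
  indicator_le_self' (fun _ _ => zero_le_one) p

lemma beam_of_notMem {p : Space n × Dir n} (hp : p.1 ∉ E) : beam E x₀ θ₀ D δ p = 0 :=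
  indicator_of_notMem (fun h => hp h.1) _

lemma beam_of_notMem_dirCap {p : Space n × Dir n} (hp : p.2 ∉ dirCap θ₀ δ) :
    beam E x₀ θ₀ D δ p = 0 := indicator_of_notMem (fun h => hp h.2.2) _

lemma lavg_indicator_dirCap [NeZero n] {g : Space n × Dir n → ℝ≥0∞} {C : ℝ≥0∞} {x : Space n}
    (h1 : ∀ θ ∈ dirCap θ₀ δ, g (x, θ) ≤ C) (h0 : ∀ θ ∉ dirCap θ₀ δ, g (x, θ) = 0) :
    lavg g x ≤ dirProb n (dirCap θ₀ δ) * C := by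
  calc lavg g x ≤ ∫⁻ θ, (dirCap θ₀ δ).indicator (fun _ => C) θ ∂(dirProb n) := by
        refine lintegral_mono fun θ => ?_
        by_cases hθ : θ ∈ dirCap θ₀ δ
        · rw [indicator_of_mem hθ]; exact h1 θ hθ
        · rw [h0 θ hθ]; exact zero_le
    _ = _ := by
        rw [lintegral_indicator (measurableSet_dirCap _ _), setLIntegral_const, mul_comm]

lemma ballistic_beam_of_notMem_dirCap {p : Space n × Dir n} (hp : p.2 ∉ dirCap θ₀ δ) :
    ballistic Ω σ (beam E x₀ θ₀ D δ) p = 0 := by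
  rw [ballistic, beam_of_notMem_dirCap (p := entry Ω p) hp, zero_mul, ENNReal.ofReal_zero]

lemma IsMedium.lavg_ballistic_beam_le [NeZero n] (h : IsMedium Ω σ M D) (x : Space n) :
    lavg (ballistic Ω σ (beam E x₀ θ₀ D δ)) x ≤ dirProb n (dirCap θ₀ δ) := by
  have := lavg_indicator_dirCap (θ₀ := θ₀) (δ := δ) (x := x) (C := 1)
    (g := ballistic Ω σ (beam E x₀ θ₀ D δ))
    (fun θ _ => (h.ballistic_le beam_nonneg _).trans (ENNReal.ofReal_le_one.2 (beam_le_one _)))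
    (fun θ hθ => ballistic_beam_of_notMem_dirCap hθ)
  rwa [mul_one] at this

/-- A direction of the cap drifts away from the axis at rate at most δ, hence by at most Dδ inside
Ω. -/
lemma norm_perp_backPoint_le (hD : 0 ≤ D) {w : Space n} {θ : Dir n} {t : ℝ} (ht0 : 0 ≤ t)
    (htD : t ≤ D) (hθ : θ ∈ dirCap θ₀ δ) :
    ‖perp θ₀ (backPoint (w, θ) t - x₀)‖ ≤ ‖perp θ₀ (w - x₀)‖ + D * δ ∧
    ‖perp θ₀ (w - x₀)‖ ≤ ‖perp θ₀ (backPoint (w, θ) t - x₀)‖ + D * δ := by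
  have h1 : ‖t • perp θ₀ (θ : Space n)‖ ≤ D * δ := by
    rw [norm_smul, Real.norm_of_nonneg ht0]
    exact mul_le_mul htD ((norm_perp_dir_le θ₀ θ).trans hθ) (norm_nonneg _) hD
  have h2 : perp θ₀ (backPoint (w, θ) t - x₀) =
      perp θ₀ (w - x₀) - t • perp θ₀ (θ : Space n) := by
    rw [← map_smul, ← map_sub]; congr 1; simp only [backPoint]; abel
  constructor
  · rw [h2]; exact (norm_sub_le _ _).trans (by linarith)
  · have h3 : perp θ₀ (w - x₀) =
        perp θ₀ (backPoint (w, θ) t - x₀) + t • perp θ₀ (θ : Space n) := by rw [h2]; abel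
    rw [h3]; exact (norm_add_le _ _).trans (by linarith)

/-- The beam has radius (D+1)δ where it enters, and drift adds at most Dδ. -/
lemma IsMedium.lavg_ballistic_beam_eq_zero [NeZero n] (h : IsMedium Ω σ M D) {x : Space n}
    (hx : (2 * D + 1) * δ < ‖perp θ₀ (x - x₀)‖) :
    lavg (ballistic Ω σ (beam E x₀ θ₀ D δ)) x = 0 := by
  have := lavg_indicator_dirCap (θ₀ := θ₀) (δ := δ) (x := x) (C := 0)
    (g := ballistic Ω σ (beam E x₀ θ₀ D δ)) (fun θ hθ => ?_)
    (fun θ hθ => ballistic_beam_of_notMem_dirCap hθ)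
  · rw [mul_zero] at this
    exact le_antisymm this zero_le
  · have h2 := (norm_perp_backPoint_le (x₀ := x₀) (w := x) h.diam_pos.le
      (backExit_nonneg (Ω := Ω) (x, θ)) (h.backExit_le _) hθ).2
    have h3 : beam E x₀ θ₀ D δ (entry Ω (x, θ)) = 0 := by
      refine indicator_of_notMem (fun hm => ?_) _
      have h4 : ‖perp θ₀ (backPoint (x, θ) (backExit Ω (x, θ)) - x₀)‖ ≤ (D + 1) * δ := hm.2.1
      linarith
    rw [ballistic, h3, zero_mul, ENNReal.ofReal_zero]

/-- Being proportional to the strength of the beam, this bound provides the majorant for the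
normalized densities. -/
lemma IsMedium.density_beam_le [NeZero n] (h : IsMedium Ω σ M D) (x : Space n) :
    density Ω σ (beam E x₀ θ₀ D δ) x ≤ (1 - albedoBound M D)⁻¹ * dirProb n (dirCap θ₀ δ) :=
  h.tsum_scatter_iterate_le h.lavg_ballistic_beam_le x

/-- The once scattered source is already smaller than the strength of the beam by the factor
`tubeBound`, and the rest of the Neumann series costs only a constant. -/
lemma IsMedium.density_beam_le_add [NeZero n] (h : IsMedium Ω σ M D) (hδ : 0 < δ) (x : Space n) :
    density Ω σ (beam E x₀ θ₀ D δ) x ≤ lavg (ballistic Ω σ (beam E x₀ θ₀ D δ)) x +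
      dirProb n (dirCap θ₀ δ) * ((1 - albedoBound M D)⁻¹ *
        (ENNReal.ofReal M * tubeBound θ₀ D ((2 * D + 1) * δ))) := by
  rw [density_eq_add, mul_left_comm]
  gcongr
  refine h.tsum_scatter_iterate_le (fun y => ?_) x
  exact h.scatter_tube_le θ₀ x₀ (mul_pos (by linarith [h.diam_pos]) hδ)
    h.lavg_ballistic_beam_le (fun z hz => h.lavg_ballistic_beam_eq_zero hz) y

lemma dirProb_ne_top [NeZero n] (s : Set (Dir n)) : dirProb n s ≠ ⊤ := measure_ne_top _ _

/-- In the limit of a narrow beam, the normalized density on the axis of the beam is the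
attenuation. -/
lemma IsMedium.tendsto_densityReal_beam [NeZero n] (h : IsMedium Ω σ M D) (hn : 2 ≤ n)
    {δ : ℕ → ℝ} (hδ0 : ∀ k, 0 < δ k) (hδ : Tendsto δ atTop (𝓝 0)) {w : ℕ → Space n}
    {w₀ : Space n} (hw : Tendsto w atTop (𝓝 w₀))
    (hwp : ∀ᶠ k in atTop, ‖perp θ₀ (w k - x₀)‖ ≤ δ k)
    (hc : ContinuousAt (backExit Ω) (w₀, θ₀)) (hE : ∀ᶠ q in 𝓝 (w₀, θ₀), (entry Ω q).1 ∈ E) :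
    Tendsto (fun k => densityReal Ω σ (beam E x₀ θ₀ D (δ k)) (w k) /
      (dirProb n (dirCap θ₀ (δ k))).toReal) atTop
      (𝓝 (attenuation σ (w₀, θ₀) (backExit Ω (w₀, θ₀)))) := by
  set l := attenuation σ (w₀, θ₀) (backExit Ω (w₀, θ₀)) with hl
  have hatt : ContinuousAt (fun q => attenuation σ q (backExit Ω q)) (w₀, θ₀) :=
    ((continuous_attenuation h.continuous).continuousAt (x := ((w₀, θ₀), backExit Ω (w₀, θ₀)))
      ).comp (f := fun q => (q, backExit Ω q)) (continuousAt_id.prodMk hc)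
  -- Properties near (w₀, θ₀) hold simultaneously for all directions of the cap, since the cap
  -- shrinks to θ₀.
  have hnear : ∀ {P : Space n × Dir n → Prop}, (∀ᶠ q in 𝓝 (w₀, θ₀), P q) →
      ∀ᶠ k in atTop, ∀ θ ∈ dirCap θ₀ (δ k), P (w k, θ) := by
    intro P hP
    rw [nhds_prod_eq] at hP
    obtain ⟨A, hA, B, hB, hAB⟩ := eventually_prod_iff.1 hP
    obtain ⟨r, hr, hrB⟩ := Metric.eventually_nhds_iff.1 hB
    filter_upwards [hw.eventually hA, hδ.eventually_lt_const hr] with k hk1 hk2 θ hθ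
    refine hAB hk1 (hrB ?_)
    rw [Subtype.dist_eq, dist_eq_norm]
    exact lt_of_le_of_lt hθ hk2
  have hmpos : ∀ k, 0 < (dirProb n (dirCap θ₀ (δ k))).toReal := fun k =>
    ENNReal.toReal_pos (dirProb_dirCap_pos θ₀ (hδ0 k)) (dirProb_ne_top _)
  have htop : ∀ k, density Ω σ (beam E x₀ θ₀ D (δ k)) (w k) ≠ ⊤ := fun k =>
    h.density_ne_top beam_nonneg beam_le_one _
  rw [tendsto_order]
  constructor
  · intro a ha
    filter_upwards [hnear hE, hwp, hnear (hatt.eventually_const_lt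
      (show (a + l) / 2 < l by linarith))] with k hk1 hk2 hk3
    rw [lt_div_iff₀ (hmpos k)]
    have h1 : dirProb n (dirCap θ₀ (δ k)) * ENNReal.ofReal ((a + l) / 2) ≤
        density Ω σ (beam E x₀ θ₀ D (δ k)) (w k) := by
      rw [density_eq_add]
      refine le_add_right ?_
      calc dirProb n (dirCap θ₀ (δ k)) * ENNReal.ofReal ((a + l) / 2)
          = ∫⁻ _ in dirCap θ₀ (δ k), ENNReal.ofReal ((a + l) / 2) ∂(dirProb n) := by
            rw [setLIntegral_const, mul_comm]
        _ ≤ ∫⁻ θ in dirCap θ₀ (δ k), ballistic Ω σ (beam E x₀ θ₀ D (δ k)) (w k, θ)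
              ∂(dirProb n) := by
            refine setLIntegral_mono' (measurableSet_dirCap _ _) fun θ hθ => ?_
            -- The radius (D+1)δ in `beam` is made for this: a point within δ of the axis, traced
            -- back with drift at most Dδ, enters inside the beam for every direction of the cap.
            -- For the lower bound this unscattered part suffices.
            have hp : ‖perp θ₀ ((entry Ω (w k, θ)).1 - x₀)‖ ≤ (D + 1) * δ k := by
              have := (norm_perp_backPoint_le (x₀ := x₀) (w := w k) h.diam_pos.le
                (backExit_nonneg (Ω := Ω) (w k, θ)) (h.backExit_le _) hθ).1
              calc _ ≤ _ := this
                _ ≤ (D + 1) * δ k := by linarith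
            have hb : beam E x₀ θ₀ D (δ k) (entry Ω (w k, θ)) = 1 := by
              have hm : entry Ω (w k, θ) ∈ {p : Space n × Dir n | p.1 ∈ E ∧
                  ‖perp θ₀ (p.1 - x₀)‖ ≤ (D + 1) * δ k ∧ p.2 ∈ dirCap θ₀ (δ k)} :=
                ⟨hk1 θ hθ, hp, hθ⟩
              rw [beam, indicator_of_mem hm, Pi.one_apply]
            rw [ballistic, hb, one_mul]
            exact ENNReal.ofReal_le_ofReal (hk3 θ hθ).le
        _ ≤ lavg (ballistic Ω σ (beam E x₀ θ₀ D (δ k))) (w k) := setLIntegral_le_lintegral _ _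
    have h2 := ENNReal.toReal_mono (htop k) h1
    rw [ENNReal.toReal_mul, ENNReal.toReal_ofReal'] at h2
    calc a * (dirProb n (dirCap θ₀ (δ k))).toReal
        < (a + l) / 2 * (dirProb n (dirCap θ₀ (δ k))).toReal := by
          have := hmpos k
          gcongr
          linarith
      _ ≤ (dirProb n (dirCap θ₀ (δ k))).toReal * max ((a + l) / 2) 0 := by
          rw [mul_comm]
          exact mul_le_mul_of_nonneg_left (le_max_left _ _) (hmpos k).le
      _ ≤ _ := h2
  · intro a ha
    have hl0 : 0 ≤ l := attenuation_nonneg _ _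
    -- All scattered contributions are at most c k times the strength of the beam. Half of the gap a
    -- - l absorbs the variation of the attenuation over the cap, the other half absorbs c k.
    set c : ℕ → ℝ≥0∞ := fun k => (1 - albedoBound M D)⁻¹ *
      (ENNReal.ofReal M * tubeBound θ₀ D ((2 * D + 1) * δ k)) with hcdef
    have hc0 : Tendsto c atTop (𝓝 0) := by
      have h1 : Tendsto (fun k => (2 * D + 1) * δ k) atTop (𝓝 0) := by
        simpa using hδ.const_mul (2 * D + 1)
      have h2 := ENNReal.Tendsto.const_mul (tendsto_tubeBound hn θ₀ D h1)
        (Or.inr (ENNReal.ofReal_ne_top (r := M)))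
      have h3 := ENNReal.Tendsto.const_mul h2
        (Or.inr (one_sub_albedoBound_inv_ne_top (M := M) (D := D)))
      simpa using h3
    have hpos : (0 : ℝ≥0∞) < ENNReal.ofReal ((a - l) / 2) := ENNReal.ofReal_pos.2 (by linarith)
    filter_upwards [hnear (hatt.eventually_lt_const (show l < (a + l) / 2 by linarith)),
      hc0.eventually_lt_const hpos] with k hk1 hk2
    rw [div_lt_iff₀ (hmpos k)]
    have h1 : density Ω σ (beam E x₀ θ₀ D (δ k)) (w k) <
        ENNReal.ofReal a * dirProb n (dirCap θ₀ (δ k)) := by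
      calc density Ω σ (beam E x₀ θ₀ D (δ k)) (w k)
          ≤ lavg (ballistic Ω σ (beam E x₀ θ₀ D (δ k))) (w k) +
            dirProb n (dirCap θ₀ (δ k)) * c k := h.density_beam_le_add (hδ0 k) (w k)
        _ ≤ dirProb n (dirCap θ₀ (δ k)) * ENNReal.ofReal ((a + l) / 2) +
            dirProb n (dirCap θ₀ (δ k)) * c k := by
            gcongr
            refine lavg_indicator_dirCap (fun θ hθ => ?_)
              (fun θ hθ => ballistic_beam_of_notMem_dirCap hθ)
            refine ENNReal.ofReal_le_ofReal ?_
            exact (mul_le_of_le_one_left (attenuation_nonneg _ _) (beam_le_one _)).trans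
              (hk1 θ hθ).le
        _ = (ENNReal.ofReal ((a + l) / 2) + c k) * dirProb n (dirCap θ₀ (δ k)) := by ring
        _ < (ENNReal.ofReal ((a + l) / 2) + ENNReal.ofReal ((a - l) / 2)) *
            dirProb n (dirCap θ₀ (δ k)) := by
            refine ENNReal.mul_lt_mul_left (dirProb_dirCap_pos θ₀ (hδ0 k)) (dirProb_ne_top _) ?_
            exact ENNReal.add_lt_add_left ENNReal.ofReal_ne_top hk2
        _ = _ := by
            rw [← ENNReal.ofReal_add (by linarith) (by linarith)]
            congr 2; ring
    have h2 := ENNReal.toReal_strict_mono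
      (ENNReal.mul_ne_top ENNReal.ofReal_ne_top (dirProb_ne_top _)) h1
    rwa [ENNReal.toReal_mul, ENNReal.toReal_ofReal (by linarith)] at h2

end BeamSource

/-! ### The backscattered flux of a narrow beam. -/

section Backscatter

variable {n : ℕ} {Ω E U : Set (Space n)} {σ σ₁ σ₂ : Space n → ℝ} {M D L : ℝ} {x₀ : Space n}
  {θ₀ : Dir n}

/-- The backward ray from a point of the chord ends exactly at x₀ because x₀ ∉ Ω. It meets the
exterior arbitrarily soon after x₀, which makes the exit time continuous. -/
lemma exit_of_chord (ho : IsOpen Ω) (hb : Bornology.IsBounded Ω) (hx₀ : x₀ ∉ Ω)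
    (hseg : ∀ s ∈ Ioo 0 L, x₀ + s • (θ₀ : Space n) ∈ Ω)
    (hx : ∃ᶠ t in 𝓝[>] (0 : ℝ), backPoint (x₀, θ₀) t ∉ closure Ω) {s : ℝ} (hs : s ∈ Ioo 0 L) :
    backExit Ω (x₀ + s • (θ₀ : Space n), θ₀) = s ∧
      ContinuousAt (backExit Ω) (x₀ + s • (θ₀ : Space n), θ₀) := by
  have h1 : backExit Ω (x₀ + s • (θ₀ : Space n), θ₀) = s := by
    rw [backExit_advance ho hb hs.1.le fun r hr => hseg r ⟨hr.1, hr.2.trans_lt hs.2⟩,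
      backExit_of_notMem (p := (x₀, θ₀)) hx₀, zero_add]
  refine ⟨h1, continuousAt_backExit ho hb ?_⟩
  rw [h1]
  have ht : Tendsto (fun t => s + t) (𝓝[>] (0 : ℝ)) (𝓝[>] s) := by
    rw [tendsto_nhdsWithin_iff]
    constructor
    · have : Tendsto (fun t => s + t) (𝓝 0) (𝓝 (s + 0)) :=
        (continuous_const.add continuous_id).tendsto 0
      rw [add_zero] at this
      exact this.mono_left nhdsWithin_le_nhds
    · filter_upwards [self_mem_nhdsWithin] with t ht
      exact mem_Ioi.2 (lt_add_of_pos_right s (mem_Ioi.1 ht))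
  refine ht.frequently (hx.mono fun t ht => ?_)
  rwa [← backPoint_backPoint, show backPoint (x₀ + s • (θ₀ : Space n), θ₀) s = x₀ by
    simp [backPoint]]

lemma continuousAt_entry {p : Space n × Dir n} (hc : ContinuousAt (backExit Ω) p) :
    ContinuousAt (fun q => (entry Ω q).1) p :=
  (continuous_backPoint.continuousAt (x := (p, backExit Ω p))).comp
    (f := fun q => (q, backExit Ω q)) (continuousAt_id.prodMk hc)

/-- One factor is the loss on the way in, the other the loss on the way back; the integrand is the
derivative of minus half the squared attenuation. -/
lemma IsMedium.integral_attenuation_sq (h : IsMedium Ω σ M D) (p : Space n × Dir n) (L : ℝ) :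
    ∫ s in (0 : ℝ)..L, attenuation σ p s * σ (backPoint p s) * attenuation σ p s =
      (1 - attenuation σ p L ^ 2) / 2 := by
  have hd : ∀ s ∈ uIcc 0 L, HasDerivAt (fun s => -(attenuation σ p s ^ 2) / 2)
      (attenuation σ p s * σ (backPoint p s) * attenuation σ p s) s := by
    intro s _
    refine ((((h.hasDerivAt_attenuation p s).pow 2).neg).div_const 2).congr_deriv ?_
    simp only [Nat.cast_ofNat, Nat.add_one_sub_one, pow_one]
    ring
  have hc : Continuous fun s => attenuation σ p s * σ (backPoint p s) * attenuation σ p s :=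
    ((h.continuous_attenuation_along p).mul (h.continuous_along p)).mul
      (h.continuous_attenuation_along p)
  rw [intervalIntegral.integral_eq_sub_of_hasDerivAt hd (hc.intervalIntegrable _ _)]
  simp only [attenuation_zero]
  ring

lemma continuous_backPoint_left (s : ℝ) : Continuous fun p : Space n × Dir n => backPoint p s :=
  continuous_backPoint.comp (f := fun p : Space n × Dir n => (p, s)) (by fun_prop)

lemma continuous_attenuation_left (hσ : Continuous σ) (s : ℝ) :
    Continuous fun p : Space n × Dir n => attenuation σ p s :=
  (continuous_attenuation hσ).comp (f := fun p : Space n × Dir n => (p, s)) (by fun_prop)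

/-- Pointwise limit of the integrand of the returning flux. The density limit yields the attenuation
from x₀ to depth s, which by reversal is the one already present for the way back. -/
lemma IsMedium.tendsto_source_beam [NeZero n] (h : IsMedium Ω σ M D) (hn : 2 ≤ n)
    (hU : IsOpen U) (hEU : E = frontier Ω ∩ U) (hxE : x₀ ∈ E)
    (hseg : ∀ s ∈ Ioo 0 L, x₀ + s • (θ₀ : Space n) ∈ Ω)
    (hx : ∃ᶠ t in 𝓝[>] (0 : ℝ), backPoint (x₀, θ₀) t ∉ closure Ω)
    {δ : ℕ → ℝ} (hδ0 : ∀ k, 0 < δ k) (hδ : Tendsto δ atTop (𝓝 0)) (hD : 0 ≤ D) (hLD : L ≤ D)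
    {q : ℕ → Space n × Dir n}
    (hq : ∀ k, ‖(q k).1 - x₀‖ + D * ‖((q k).2 : Space n) + θ₀‖ ≤ δ k)
    (hqlim : Tendsto q atTop (𝓝 (x₀, -θ₀))) {s : ℝ} (hs : s ∈ Ioo 0 L) :
    Tendsto (fun k => attenuation σ (q k) s * σ (backPoint (q k) s) *
      (densityReal Ω σ (beam E x₀ θ₀ D (δ k)) (backPoint (q k) s) /
        (dirProb n (dirCap θ₀ (δ k))).toReal)) atTop
      (𝓝 (attenuation σ (x₀, -θ₀) s * σ (backPoint (x₀, -θ₀) s) *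
        attenuation σ (x₀, -θ₀) s)) := by
  have hx₀ : x₀ ∉ Ω := by
    rw [hEU, h.isOpen.frontier_eq] at hxE
    exact hxE.1.2
  have hw : Tendsto (fun k => backPoint (q k) s) atTop (𝓝 (backPoint (x₀, -θ₀) s)) :=
    ((continuous_backPoint_left s).tendsto _).comp hqlim
  have h1 : Tendsto (fun k => attenuation σ (q k) s) atTop
      (𝓝 (attenuation σ (x₀, -θ₀) s)) :=
    ((continuous_attenuation_left h.continuous s).tendsto _).comp hqlim
  have h2 : Tendsto (fun k => σ (backPoint (q k) s)) atTop
      (𝓝 (σ (backPoint (x₀, -θ₀) s))) := (h.continuous.tendsto _).comp hw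
  obtain ⟨he1, he2⟩ := exit_of_chord h.isOpen h.isBounded hx₀ hseg hx hs
  have hw' : Tendsto (fun k => backPoint (q k) s) atTop (𝓝 (x₀ + s • (θ₀ : Space n))) := by
    rwa [backPoint_neg_dir] at hw
  -- The backward ray from `q k` stays within δ k of the axis: `hq` bounds its initial offset plus
  -- its drift over the length D.
  have hperp : ∀ᶠ k in atTop, ‖perp θ₀ (backPoint (q k) s - x₀)‖ ≤ δ k := by
    refine Eventually.of_forall fun k => ?_
    have e : perp θ₀ (backPoint (q k) s - x₀) =
        perp θ₀ ((q k).1 - x₀) - s • perp θ₀ ((q k).2 : Space n) := by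
      rw [← map_smul, ← map_sub]; congr 1; simp only [backPoint]; abel
    rw [e]
    refine (norm_sub_le _ _).trans ((add_le_add (norm_perp_le _ _) ?_).trans (hq k))
    rw [norm_smul, Real.norm_of_nonneg hs.1.le]
    exact mul_le_mul (hs.2.le.trans hLD) (norm_perp_dir_le_add _ _) (norm_nonneg _) hD
  have hen : (entry Ω (x₀ + s • (θ₀ : Space n), θ₀)).1 = x₀ := by
    rw [entry, he1]; simp [backPoint]
  have hent : ∀ᶠ r in 𝓝 (x₀ + s • (θ₀ : Space n), θ₀), (entry Ω r).1 ∈ E := by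
    have hΩn : ∀ᶠ r in 𝓝 (x₀ + s • (θ₀ : Space n), θ₀), r.1 ∈ Ω :=
      continuous_fst.continuousAt.eventually (h.isOpen.mem_nhds (hseg s hs))
    have hUn : ∀ᶠ r in 𝓝 (x₀ + s • (θ₀ : Space n), θ₀), (entry Ω r).1 ∈ U :=
      (continuousAt_entry he2).eventually (hU.mem_nhds (by
        simpa only [hen] using (hEU ▸ hxE : x₀ ∈ frontier Ω ∩ U).2))
    filter_upwards [hΩn, hUn] with r hr1 hr2
    rw [hEU]
    exact ⟨entry_mem_frontier h.isOpen h.isBounded hr1, hr2⟩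
  have h3 := h.tendsto_densityReal_beam hn hδ0 hδ (E := E) (x₀ := x₀) (θ₀ := θ₀)
    (w := fun k => backPoint (q k) s) hw' hperp he2 hent
  rw [he1, ← backPoint_neg, attenuation_reverse] at h3
  exact (h1.mul h2).mul h3

/-- The backscattered flux of a narrow beam, normalized by its strength, tends to the backscattered
flux of the unscattered beam. -/
lemma IsMedium.tendsto_mildReal_beam [NeZero n] (h : IsMedium Ω σ M D) (hn : 2 ≤ n)
    (hU : IsOpen U) (hEU : E = frontier Ω ∩ U) (hxE : x₀ ∈ E)
    (hL : 0 < L) (hseg : ∀ s ∈ Ioo 0 L, x₀ + s • (θ₀ : Space n) ∈ Ω)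
    (hx : ∃ᶠ t in 𝓝[>] (0 : ℝ), backPoint (x₀, θ₀) t ∉ closure Ω)
    {δ : ℕ → ℝ} (hδ0 : ∀ k, 0 < δ k) (hδ : Tendsto δ atTop (𝓝 0))
    {q : ℕ → Space n × Dir n}
    (hq : ∀ k, ‖(q k).1 - x₀‖ + D * ‖((q k).2 : Space n) + θ₀‖ ≤ δ k)
    (hqL : Tendsto (fun k => backExit Ω (q k)) atTop (𝓝 L)) :
    Tendsto (fun k => mildReal Ω σ (beam E x₀ θ₀ D (δ k)) (q k) /
      (dirProb n (dirCap θ₀ (δ k))).toReal) atTop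
      (𝓝 ((1 - attenuation σ (x₀, -θ₀) L ^ 2) / 2)) := by
  have hE : MeasurableSet E := by
    rw [hEU]; exact isClosed_frontier.measurableSet.inter hU.measurableSet
  have hx₀ : x₀ ∉ Ω := by
    rw [hEU, h.isOpen.frontier_eq] at hxE
    exact hxE.1.2
  have hD := h.diam_pos
  have hq1 : ∀ k, ‖(q k).1 - x₀‖ ≤ δ k := fun k =>
    (le_add_of_nonneg_right (by positivity)).trans (hq k)
  have hq2 : ∀ k, D * ‖((q k).2 : Space n) + θ₀‖ ≤ δ k := fun k =>
    (le_add_of_nonneg_left (by positivity)).trans (hq k)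
  have hqx : Tendsto (fun k => (q k).1) atTop (𝓝 x₀) := by
    rw [tendsto_iff_norm_sub_tendsto_zero]
    exact squeeze_zero (fun _ => norm_nonneg _) hq1 hδ
  have hω0 : Tendsto (fun k => ‖((q k).2 : Space n) + θ₀‖) atTop (𝓝 0) := by
    refine squeeze_zero (fun _ => norm_nonneg _) (fun k => ?_)
      (by simpa using hδ.div_const D : Tendsto (fun k => δ k / D) atTop (𝓝 0))
    rw [le_div_iff₀ hD, mul_comm]
    exact hq2 k
  have hω : Tendsto (fun k => (q k).2) atTop (𝓝 (-θ₀)) := by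
    rw [tendsto_iff_dist_tendsto_zero]
    refine hω0.congr fun k => ?_
    rw [Subtype.dist_eq, dist_eq_norm, coe_neg_sphere, sub_neg_eq_add]
  have hqlim : Tendsto q atTop (𝓝 (x₀, -θ₀)) := hqx.prodMk_nhds hω
  have hLD : L ≤ D := le_of_tendsto' hqL fun k => h.backExit_le _
  -- The observed direction is close to -θ₀, at distance 2 from θ₀, so it is eventually outside the
  -- cap and no unscattered flux is observed.
  have hcap : ∀ᶠ k in atTop, (q k).2 ∉ dirCap θ₀ (δ k) := by
    filter_upwards [hω0.eventually_lt_const one_pos, hδ.eventually_lt_const one_pos]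
      with k hk1 hk2 hmem
    have hmem' : ‖((q k).2 : Space n) - θ₀‖ ≤ δ k := hmem
    have h1 : (2 : ℝ) = ‖(((q k).2 : Space n) + θ₀) - (((q k).2 : Space n) - θ₀)‖ := by
      rw [show (((q k).2 : Space n) + θ₀) - (((q k).2 : Space n) - θ₀) = (2 : ℝ) • (θ₀ : Space n) by
        rw [two_smul]; abel, norm_smul, norm_dir]
      norm_num
    linarith [norm_sub_le (((q k).2 : Space n) + θ₀) (((q k).2 : Space n) - θ₀)]
  set m : ℕ → ℝ := fun k => (dirProb n (dirCap θ₀ (δ k))).toReal with hm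
  have hmpos : ∀ k, 0 < m k := fun k =>
    ENNReal.toReal_pos (dirProb_dirCap_pos θ₀ (hδ0 k)) (dirProb_ne_top _)
  set C : ℝ := ((1 - albedoBound M D)⁻¹).toReal with hC
  set G : ℕ → ℝ → ℝ := fun k => (Ioc 0 (backExit Ω (q k))).indicator fun s =>
    attenuation σ (q k) s * σ (backPoint (q k) s) *
      (densityReal Ω σ (beam E x₀ θ₀ D (δ k)) (backPoint (q k) s) / m k) with hG
  have hratio : ∀ k x, 0 ≤ densityReal Ω σ (beam E x₀ θ₀ D (δ k)) x / m k ∧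
      densityReal Ω σ (beam E x₀ θ₀ D (δ k)) x / m k ≤ C := by
    intro k x
    refine ⟨div_nonneg (densityReal_nonneg _) (hmpos k).le, ?_⟩
    rw [div_le_iff₀ (hmpos k), hC, hm, ← ENNReal.toReal_mul]
    exact ENNReal.toReal_mono
      (ENNReal.mul_ne_top one_sub_albedoBound_inv_ne_top (dirProb_ne_top _)) (h.density_beam_le x)
  have hlim : Tendsto (fun k => ∫ s, G k s) atTop (𝓝 (∫ s, (Ioc 0 L).indicator (fun s =>
      attenuation σ (x₀, -θ₀) s * σ (backPoint (x₀, -θ₀) s) * attenuation σ (x₀, -θ₀) s) s)) := by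
    refine tendsto_integral_of_dominated_convergence ((Ioc 0 D).indicator fun _ => M * C)
      (fun k => ?_) ?_ (fun k => ae_of_all _ fun s => ?_) ?_
    · refine (Measurable.indicator ?_ measurableSet_Ioc).aestronglyMeasurable
      exact ((h.continuous_attenuation_along _).mul (h.continuous_along _)).measurable.mul
        (((h.measurable_densityReal (measurable_beam hE)).comp
          (continuous_backPoint_right _).measurable).div_const _)
    · exact (integrable_indicator_iff measurableSet_Ioc).2
        (integrableOn_const (by simp) enorm_ne_top)
    · by_cases hs : s ∈ Ioc 0 (backExit Ω (q k))
      · have hs' : s ∈ Ioc 0 D := ⟨hs.1, hs.2.trans (h.backExit_le _)⟩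
        simp only [hG]
        rw [indicator_of_mem hs, indicator_of_mem hs', norm_mul, norm_mul,
          Real.norm_of_nonneg (attenuation_nonneg _ _), Real.norm_of_nonneg (h.nonneg _),
          Real.norm_of_nonneg (hratio k _).1]
        refine mul_le_mul ?_ (hratio k _).2 (hratio k _).1 h.bound_nonneg
        exact (mul_le_of_le_one_left (h.nonneg _) (h.attenuation_le_one _ hs.1.le)).trans (h.le _)
      · simp only [hG]
        rw [indicator_of_notMem hs, norm_zero]
        exact indicator_nonneg (fun _ _ =>
          mul_nonneg h.bound_nonneg ENNReal.toReal_nonneg) _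
    -- The limit s = L of the lengths of the rays is excluded, since the indicator functions need
    -- not converge there.
    · filter_upwards [Measure.ae_ne volume L] with s hsL
      rcases le_or_gt s 0 with hs0 | hs0
      · have : ∀ b : ℝ, s ∉ Ioc 0 b := fun b hb => absurd hb.1 (not_lt.2 hs0)
        simp only [hG, indicator_of_notMem (this _)]
        exact tendsto_const_nhds
      rcases lt_or_gt_of_ne hsL with hlt | hgt
      · rw [indicator_of_mem (show s ∈ Ioc 0 L from ⟨hs0, hlt.le⟩)]
        refine (h.tendsto_source_beam hn hU hEU hxE hseg hx hδ0 hδ hD.le hLD hq hqlim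
          ⟨hs0, hlt⟩).congr' ?_
        filter_upwards [hqL.eventually_const_lt hlt] with k hk
        simp only [hG]
        rw [indicator_of_mem (show s ∈ Ioc 0 (backExit Ω (q k)) from ⟨hs0, hk.le⟩)]
      · rw [indicator_of_notMem (show s ∉ Ioc 0 L from fun hs => absurd hs.2 (not_le.2 hgt))]
        refine tendsto_const_nhds.congr' ?_
        filter_upwards [hqL.eventually_lt_const hgt] with k hk
        simp only [hG]
        rw [indicator_of_notMem fun hs => absurd hs.2 (not_le.2 hk)]
  rw [integral_indicator measurableSet_Ioc, ← intervalIntegral.integral_of_le hL.le,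
    h.integral_attenuation_sq] at hlim
  refine hlim.congr' ?_
  filter_upwards [hcap] with k hk
  rw [h.mildReal_eq (measurable_beam hE) beam_nonneg beam_le_one,
    beam_of_notMem_dirCap (p := entry Ω (q k)) hk, zero_mul, zero_add,
    ← intervalIntegral.integral_div, intervalIntegral.integral_of_le (backExit_nonneg _),
    ← integral_indicator measurableSet_Ioc]
  simp only [hG, mul_div_assoc]
  rfl

end Backscatter

/-! ### Equal attenuation over chords with transversal ends. -/

section Chord

variable {n : ℕ} {Ω E U : Set (Space n)} {σ₁ σ₂ : Space n → ℝ} {M D L : ℝ} {x₀ : Space n}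
  {θ₀ : Dir n}

lemma continuousAt_exitPair {p : Space n × Dir n}
    (hc : ContinuousAt (fun q : Space n × Dir n => backExit Ω (q.1, -q.2)) p) :
    ContinuousAt (fun q => (exitPair Ω q).1) p :=
  continuousAt_fst.add (hc.smul (continuous_subtype_val.continuousAt.comp continuousAt_snd))

lemma backExit_advance_of_lt (ho : IsOpen Ω) (hb : Bornology.IsBounded Ω) {p : Space n × Dir n}
    {t : ℝ} (ht : t ∈ Ioo 0 (backExit Ω (p.1, -p.2))) :
    backExit Ω (p.1 + t • (p.2 : Space n), p.2) = backExit Ω p + t := by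
  refine backExit_advance ho hb ht.1.le fun r hr => ?_
  rw [← backPoint_neg_dir]
  exact backPoint_mem_of_lt hr.1.le (hr.2.trans_lt ht.2)

/-- Near a chord there is a line on which the two outgoing values of the solutions with a narrow
beam as data agree up to a small error. -/
lemma IsSmoothBoundedDomain.exists_near_chord [NeZero n] (hΩ : IsSmoothBoundedDomain Ω)
    (hU : IsOpen U) (hEU : E = frontier Ω ∩ U)
    (hA : localAlbedo Ω E σ₁ = localAlbedo Ω E σ₂) (h₁ : IsMedium Ω σ₁ M D)
    (h₂ : IsMedium Ω σ₂ M D) (hxE : x₀ ∈ E) (hL : 0 < L)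
    (hseg : ∀ s ∈ Ioo 0 L, x₀ + s • (θ₀ : Space n) ∈ Ω)
    (hx : ∃ᶠ t in 𝓝[>] (0 : ℝ), backPoint (x₀, θ₀) t ∉ closure Ω)
    (hyΩ : x₀ + L • (θ₀ : Space n) ∉ Ω)
    (hy : ∃ᶠ t in 𝓝[>] (0 : ℝ), backPoint (x₀ + L • (θ₀ : Space n), -θ₀) t ∉ closure Ω)
    {f : Space n × Dir n → ℝ} (hf : Measurable f) (hf0 : ∀ p, 0 ≤ f p) (hf1 : ∀ p, f p ≤ 1)
    (hfE : ∀ p, p.1 ∉ E → f p = 0) {δ ε : ℝ} (hδ : 0 < δ) (hε : 0 < ε) :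
    ∃ q : Space n × Dir n, ‖q.1 - x₀‖ + D * ‖(q.2 : Space n) + θ₀‖ ≤ δ ∧
      |backExit Ω q - L| ≤ 3 * δ ∧ |mildReal Ω σ₁ f q - mildReal Ω σ₂ f q| ≤ ε := by
  have hEm : MeasurableSet E := by
    rw [hEU]; exact isClosed_frontier.measurableSet.inter hU.measurableSet
  have hx₀ : x₀ ∉ Ω := by
    rw [hEU, hΩ.isOpen.frontier_eq] at hxE
    exact hxE.1.2
  have hL2 : L / 2 ∈ Ioo 0 L := ⟨half_pos hL, half_lt_self hL⟩
  set z : Space n := x₀ + (L / 2) • (θ₀ : Space n) with hz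
  have hzΩ : z ∈ Ω := hseg _ hL2
  obtain ⟨he1, he2⟩ := exit_of_chord hΩ.isOpen hΩ.isBounded hx₀ hseg hx hL2
  replace he1 : backExit Ω (z, θ₀) = L / 2 := he1
  obtain ⟨hb1, hb2⟩ := exit_of_chord (θ₀ := -θ₀) hΩ.isOpen hΩ.isBounded hyΩ
    (fun s hs => by
      rw [coe_neg_sphere, smul_neg, add_assoc, ← sub_eq_add_neg, ← sub_smul]
      exact hseg _ ⟨by linarith [hs.2], by linarith [hs.1]⟩) hy hL2
  have hzy : x₀ + L • (θ₀ : Space n) + (L / 2) • ((-θ₀ : Dir n) : Space n) = z := by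
    rw [coe_neg_sphere, smul_neg, add_assoc, ← sub_eq_add_neg, ← sub_smul, sub_half]
  rw [hzy] at hb1 hb2
  -- Observed lines run in directions near -θ₀ through points near the midpoint z. They exit near
  -- x₀, and their exit data are continuous because the chord is transversal at x₀.
  have hc : ContinuousAt (fun q : Space n × Dir n => backExit Ω (q.1, -q.2)) (z, -θ₀) := by
    refine ContinuousAt.comp (g := backExit Ω) (f := fun q : Space n × Dir n => (q.1, -q.2)) ?_
      (by fun_prop)
    simpa only [neg_neg] using he2
  have hexit : (exitPair Ω (z, -θ₀)).1 = x₀ := by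
    simp only [exitPair, neg_neg, he1, coe_neg_sphere, smul_neg]
    rw [hz, add_neg_cancel_right]
  have hnear : ∀ᶠ p : Space n × Dir n in 𝓝 (z, -θ₀), p.1 ∈ Ω ∧ (exitPair Ω p).1 ∈ U ∧
      ‖(exitPair Ω p).1 - x₀‖ + D * ‖(p.2 : Space n) + θ₀‖ < δ / 2 ∧
      |backExit Ω p - L / 2| < δ ∧ |backExit Ω (p.1, -p.2) - L / 2| < δ := by
    refine (continuousAt_fst.eventually (hΩ.isOpen.mem_nhds hzΩ)).and
      (((continuousAt_exitPair hc).eventually (hU.mem_nhds ?_)).and (Eventually.and ?_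
        (Eventually.and ?_ ?_)))
    · simpa only [hexit] using (hEU ▸ hxE : x₀ ∈ frontier Ω ∩ U).2
    · have hcont : ContinuousAt (fun p : Space n × Dir n =>
          ‖(exitPair Ω p).1 - x₀‖ + D * ‖(p.2 : Space n) + θ₀‖) (z, -θ₀) :=
        ((continuousAt_exitPair hc).sub continuousAt_const).norm.add
          (by fun_prop)
      refine hcont.eventually_lt_const ?_
      simp only [hexit, sub_self, norm_zero, coe_neg_sphere, neg_add_cancel, mul_zero, add_zero]
      exact half_pos hδ
    · refine (hb2.sub continuousAt_const).abs.eventually_lt_const ?_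
      simpa only [Pi.sub_apply, hb1, sub_self, abs_zero] using hδ
    · refine (hc.sub continuousAt_const).abs.eventually_lt_const ?_
      simpa only [Pi.sub_apply, neg_neg, he1, sub_self, abs_zero] using hδ
  have hgood := (ae_prod_restrict_iff hΩ.isOpen.measurableSet).1
    (hΩ.ae_mildReal_asymptotic hEm (hEU ▸ inter_subset_left) hA h₁ h₂ hf hf0 hf1 hfE)
  -- The good lines have full measure, hence are dense, so one of them lies in the prescribed
  -- neighbourhood.
  obtain ⟨p, hp, hpg⟩ := (Measure.dense_of_ae hgood).inter_nhds_nonempty hnear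
  obtain ⟨hpΩ, hpU, hpx, hpb, hpe⟩ := hpg
  obtain ⟨t, ht, htε, htu⟩ := hp hpΩ
    (by rw [hEU]; exact ⟨exitPair_mem_frontier hΩ.isOpen hΩ.isBounded hpΩ, hpU⟩)
    (min (δ / 2) ε) (lt_min (half_pos hδ) hε)
  have htδ := htε.trans_le (min_le_left _ _)
  refine ⟨(p.1 + t • (p.2 : Space n), p.2), ?_, ?_, htu.le.trans (min_le_right _ _)⟩
  · have e : p.1 + t • (p.2 : Space n) - x₀ = ((exitPair Ω p).1 - x₀) -
        (backExit Ω (p.1, -p.2) - t) • (p.2 : Space n) := by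
      simp only [exitPair, sub_smul]; abel
    have h3 : ‖p.1 + t • (p.2 : Space n) - x₀‖ ≤ ‖(exitPair Ω p).1 - x₀‖ + δ / 2 := by
      rw [e]
      refine (norm_sub_le _ _).trans (add_le_add_right ?_ _)
      rw [norm_smul, norm_dir, mul_one, Real.norm_of_nonneg (by linarith [ht.2])]
      exact htδ.le
    simp only
    linarith
  · rw [backExit_advance_of_lt hΩ.isOpen hΩ.isBounded ht]
    rw [abs_lt] at hpb hpe
    rw [abs_le]
    constructor <;> linarith [ht.2]

/-- The attenuations of the two media over a chord with transversal ends agree. -/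
theorem IsSmoothBoundedDomain.attenuation_chord_eq [NeZero n] (hΩ : IsSmoothBoundedDomain Ω)
    (hn : 2 ≤ n) (hU : IsOpen U) (hEU : E = frontier Ω ∩ U)
    (hA : localAlbedo Ω E σ₁ = localAlbedo Ω E σ₂) (h₁ : IsMedium Ω σ₁ M D)
    (h₂ : IsMedium Ω σ₂ M D) (hxE : x₀ ∈ E) (hL : 0 < L)
    (hseg : ∀ s ∈ Ioo 0 L, x₀ + s • (θ₀ : Space n) ∈ Ω)
    (hx : ∃ᶠ t in 𝓝[>] (0 : ℝ), backPoint (x₀, θ₀) t ∉ closure Ω)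
    (hyΩ : x₀ + L • (θ₀ : Space n) ∉ Ω)
    (hy : ∃ᶠ t in 𝓝[>] (0 : ℝ), backPoint (x₀ + L • (θ₀ : Space n), -θ₀) t ∉ closure Ω) :
    attenuation σ₁ (x₀, -θ₀) L = attenuation σ₂ (x₀, -θ₀) L := by
  have hEm : MeasurableSet E := by
    rw [hEU]; exact isClosed_frontier.measurableSet.inter hU.measurableSet
  set δ : ℕ → ℝ := fun k => 1 / ((k : ℝ) + 1) with hδdef
  have hδ0 : ∀ k, 0 < δ k := fun k => Nat.one_div_pos_of_nat
  have hδ : Tendsto δ atTop (𝓝 0) := tendsto_one_div_add_atTop_nhds_zero_nat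
  set m : ℕ → ℝ := fun k => (dirProb n (dirCap θ₀ (δ k))).toReal with hm
  have hmpos : ∀ k, 0 < m k := fun k =>
    ENNReal.toReal_pos (dirProb_dirCap_pos θ₀ (hδ0 k)) (dirProb_ne_top _)
  -- The tolerance is m k · δ k, so that the discrepancy still tends to 0 after division by the
  -- strength m k.
  choose q hq1 hq2 hq3 using fun k => hΩ.exists_near_chord hU hEU hA h₁ h₂ hxE hL hseg hx hyΩ hy
    (measurable_beam (x₀ := x₀) (θ₀ := θ₀) (D := D) (δ := δ k) hEm) beam_nonneg beam_le_one
    (fun _ hp => beam_of_notMem hp) (hδ0 k) (mul_pos (hmpos k) (hδ0 k))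
  have hqL : Tendsto (fun k => backExit Ω (q k)) atTop (𝓝 L) := by
    rw [tendsto_iff_dist_tendsto_zero]
    exact squeeze_zero (fun _ => dist_nonneg) hq2 (by simpa using hδ.const_mul 3)
  have l₁ := h₁.tendsto_mildReal_beam hn hU hEU hxE hL hseg hx hδ0 hδ hq1 hqL
  have l₂ := h₂.tendsto_mildReal_beam hn hU hEU hxE hL hseg hx hδ0 hδ hq1 hqL
  have hsub : Tendsto (fun k => mildReal Ω σ₁ (beam E x₀ θ₀ D (δ k)) (q k) / m k -
      mildReal Ω σ₂ (beam E x₀ θ₀ D (δ k)) (q k) / m k) atTop (𝓝 0) := by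
    refine squeeze_zero_norm (fun k => ?_) hδ
    rw [← sub_div, norm_div, Real.norm_of_nonneg (hmpos k).le, div_le_iff₀ (hmpos k), mul_comm]
    exact hq3 k
  have heq := tendsto_nhds_unique (l₁.sub l₂) hsub
  have ha₁ := attenuation_pos (σ := σ₁) (x₀, -θ₀) L
  have ha₂ := attenuation_pos (σ := σ₂) (x₀, -θ₀) L
  -- The common limit determines the square of the attenuation, and attenuations are positive.
  exact (pow_left_inj₀ ha₁.le ha₂.le two_ne_zero).1 (by linarith)

end Chord

/-! ### Arbitrary chords as limits of transversal ones. -/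

section Approximation

variable {n : ℕ} {Ω E U : Set (Space n)} {σ σ₁ σ₂ : Space n → ℝ} {M D L : ℝ} {x y : Space n}
  {θ₁ : Dir n}

lemma exists_dir (hxy : x ≠ y) : ∃ θ : Dir n, y = x + dist x y • (θ : Space n) := by
  have hne : dist x y ≠ 0 := dist_ne_zero.2 hxy
  refine ⟨⟨(dist x y)⁻¹ • (y - x), ?_⟩, ?_⟩
  · rw [mem_sphere_zero_iff_norm, norm_smul, norm_inv, Real.norm_of_nonneg dist_nonneg,
      ← dist_eq_norm, dist_comm y x, inv_mul_cancel₀ hne]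
  · simp only [smul_smul, mul_inv_cancel₀ hne, one_smul]
    abel

/-- Every chord is a limit of lines whose two ends are transversal. -/
lemma IsSmoothBoundedDomain.exists_transversal [NeZero n] (hΩ : IsSmoothBoundedDomain Ω)
    (hx : x ∈ frontier Ω) (hy : x + L • (θ₁ : Space n) ∈ frontier Ω) (hL : 0 < L)
    (hseg : ∀ s ∈ Ioo 0 L, x + s • (θ₁ : Space n) ∈ Ω) {ε : ℝ} (hε : 0 < ε) :
    ∃ p : Space n × Dir n, p.1 ∈ Ω ∧ dist p (x + (L / 2) • (θ₁ : Space n), θ₁) < ε ∧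
      |backExit Ω p - L / 2| < ε ∧ |backExit Ω (p.1, -p.2) - L / 2| < ε ∧
      inner ℝ (outwardNormal Ω (entry Ω p).1) (p.2 : Space n) < 0 ∧
      0 < inner ℝ (outwardNormal Ω (exitPair Ω p).1) (p.2 : Space n) := by
  have ho := hΩ.isOpen
  have hb := hΩ.isBounded
  set z : Space n := x + (L / 2) • (θ₁ : Space n) with hz
  -- Lower bound for both half lengths of nearby lines, from lower semicontinuity; a ≥ 0 also
  -- ensures that their base points lie in Ω.
  set a : ℝ := max 0 (L / 2 - ε) with ha
  have ha0 : 0 ≤ a := le_max_left _ _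
  have haL : a < L / 2 := max_lt (half_pos hL) (by linarith)
  have hzb : a < backExit Ω (z, θ₁) := (lt_backExit_iff ho hb).2 fun r hr => by
    have : backPoint (z, θ₁) r = x + (L / 2 - r) • (θ₁ : Space n) := by
      simp only [backPoint, hz, sub_smul]; abel
    rw [this]
    exact hseg _ ⟨by linarith [hr.2], by linarith [hr.1]⟩
  have hze : a < backExit Ω (z, -θ₁) := (lt_backExit_iff ho hb).2 fun r hr => by
    have : backPoint (z, -θ₁) r = x + (L / 2 + r) • (θ₁ : Space n) := by
      simp only [backPoint_neg_dir, hz, add_smul]; abel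
    rw [this]
    exact hseg _ ⟨by linarith [hr.1], by linarith [hr.2]⟩
  have hneg : Continuous fun p : Space n × Dir n => ((p.1, -p.2) : Space n × Dir n) := by fun_prop
  have hN : IsOpen ({p : Space n × Dir n | a < backExit Ω p} ∩
      {p | a < backExit Ω (p.1, -p.2)}) :=
    (isOpen_lt_backExit ho hb a).inter ((isOpen_lt_backExit ho hb a).preimage hneg)
  obtain ⟨r, hr, hrε, hrN⟩ : ∃ r > 0, r ≤ ε ∧ Metric.ball (z, θ₁) r ⊆
      {p : Space n × Dir n | a < backExit Ω p} ∩ {p | a < backExit Ω (p.1, -p.2)} := by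
    obtain ⟨r, hr, hrN⟩ := Metric.mem_nhds_iff.1 (hN.mem_nhds (x := (z, θ₁)) ⟨hzb, hze⟩)
    exact ⟨min r ε, lt_min hr hε, min_le_right _ _,
      (Metric.ball_subset_ball (min_le_left _ _)).trans hrN⟩
  obtain ⟨η, hη0, hηr, hηLr, hηL⟩ : ∃ η > 0, η < r ∧ 4 * η < L * r ∧ 2 * η < L := by
    have h1 : min r (min (L * r) L) ≤ r := min_le_left _ _
    have h2 : min r (min (L * r) L) ≤ L * r := (min_le_right _ _).trans (min_le_left _ _)
    have h3 : min r (min (L * r) L) ≤ L := (min_le_right _ _).trans (min_le_right _ _)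
    have h0 : 0 < min r (min (L * r) L) := by positivity
    refine ⟨min r (min (L * r) L) / 8, by positivity, ?_, ?_, ?_⟩ <;> linarith
  -- Upper semicontinuity may fail for the chord itself, for instance at tangential ends. Both ends
  -- are therefore moved slightly to exterior points, so that lines near the segment from p to q
  -- must leave Ω within its length. The smallness of η keeps direction and midpoint within r.
  obtain ⟨p, hpx, hpn⟩ := hΩ.exists_notMem_closure hx hη0
  obtain ⟨q, hqy, hqn⟩ := hΩ.exists_notMem_closure hy hη0
  rw [dist_eq_norm] at hpx hqy
  have hvec : q - p - L • (θ₁ : Space n) = (q - (x + L • (θ₁ : Space n))) - (p - x) := by abel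
  have hvecn : ‖q - p - L • (θ₁ : Space n)‖ ≤ 2 * η := by
    rw [hvec]; linarith [norm_sub_le (q - (x + L • (θ₁ : Space n))) (p - x)]
  have hLθ : ‖L • (θ₁ : Space n)‖ = L := by
    rw [norm_smul, norm_dir, mul_one, Real.norm_of_nonneg hL.le]
  have hd : |dist p q - L| ≤ 2 * η := by
    rw [dist_comm, dist_eq_norm, ← hLθ]
    exact (abs_norm_sub_norm_le _ _).trans hvecn
  have hpq : p ≠ q := by
    rintro rfl
    rw [dist_self, zero_sub, abs_neg, abs_of_pos hL] at hd
    linarith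
  obtain ⟨θ, hθ⟩ := exists_dir hpq
  set d := dist p q with hdef
  have hd0 : 0 ≤ d := dist_nonneg
  have hθd : dist θ θ₁ < r := by
    rw [Subtype.dist_eq, dist_eq_norm]
    have e : L • ((θ : Space n) - θ₁) = (L - d) • (θ : Space n) + (q - p - L • (θ₁ : Space n)) := by
      rw [hθ, smul_sub, sub_smul]; abel
    have h1 : L * ‖(θ : Space n) - θ₁‖ ≤ 4 * η := by
      calc L * ‖(θ : Space n) - θ₁‖ = ‖L • ((θ : Space n) - θ₁)‖ := by
            rw [norm_smul, Real.norm_of_nonneg hL.le]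
        _ ≤ |L - d| + 2 * η := by
            rw [e]
            refine (norm_add_le _ _).trans (add_le_add ?_ hvecn)
            rw [norm_smul, norm_dir, mul_one, Real.norm_eq_abs]
        _ ≤ 4 * η := by rw [abs_sub_comm]; linarith
    exact lt_of_mul_lt_mul_left (h1.trans_lt hηLr) hL.le
  set w : Space n := p + (d / 2) • (θ : Space n) with hw
  have hwz : dist w z < r := by
    have e : w - z = (1 / 2 : ℝ) • ((p - x) + (q - (x + L • (θ₁ : Space n)))) := by
      rw [hθ, hw, hz]; module
    rw [dist_eq_norm, e, norm_smul, Real.norm_of_nonneg (by norm_num)]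
    linarith [norm_add_le (p - x) (q - (x + L • (θ₁ : Space n)))]
  have hℓ0 : 0 ≤ d / 2 := by positivity
  have hbp : backPoint (w, θ) (d / 2) ∉ closure Ω := by
    rwa [show backPoint (w, θ) (d / 2) = p by simp [backPoint, hw]]
  have hep : backPoint (w, -θ) (d / 2) ∉ closure Ω := by
    rwa [backPoint_neg_dir, show w + (d / 2) • (θ : Space n) = q by
      rw [hw, add_assoc, ← add_smul, add_halves]; exact hθ.symm]
  have hnear : ∀ᶠ g : Space n × Dir n in 𝓝 (w, θ), backExit Ω g ≤ d / 2 ∧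
      backExit Ω (g.1, -g.2) ≤ d / 2 ∧ g ∈ Metric.ball (z, θ₁) r := by
    refine (eventually_backExit_le hℓ0 hbp).and
      ((hneg.continuousAt.eventually (eventually_backExit_le hℓ0 hep)).and ?_)
    exact Metric.isOpen_ball.mem_nhds (Metric.mem_ball.2 (max_lt hwz hθd))
  have hgood := (ae_prod_restrict_iff hΩ.isOpen.measurableSet).1
    (hΩ.ae_inner_entry_neg.and hΩ.ae_inner_exitPair_pos)
  -- Almost every line is transversal at both ends, so one such line satisfies all these open
  -- conditions.
  obtain ⟨g, hg, hgb, hge, hgz⟩ := (Measure.dense_of_ae hgood).inter_nhds_nonempty hnear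
  have hgN := hrN hgz
  have hgΩ : g.1 ∈ Ω := by
    simpa using (lt_backExit_iff ho hb).1 hgN.1 0 ⟨le_rfl, ha0⟩
  have haε : L / 2 - ε ≤ a := le_max_right _ _
  rw [abs_le] at hd
  refine ⟨g, hgΩ, (Metric.mem_ball.1 hgz).trans_le hrε, ?_, ?_, hg hgΩ⟩
  · rw [abs_lt]
    constructor <;> linarith [show a < backExit Ω g from hgN.1]
  · rw [abs_lt]
    constructor <;> linarith [show a < backExit Ω (g.1, -g.2) from hgN.2]

/-- At a transversal end the line leaves the closure immediately, which supplies the two exterior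
conditions of `attenuation_chord_eq`. -/
lemma IsSmoothBoundedDomain.attenuation_eq_of_transversal [NeZero n]
    (hΩ : IsSmoothBoundedDomain Ω) (hn : 2 ≤ n) (hU : IsOpen U) (hEU : E = frontier Ω ∩ U)
    (hA : localAlbedo Ω E σ₁ = localAlbedo Ω E σ₂) (h₁ : IsMedium Ω σ₁ M D)
    (h₂ : IsMedium Ω σ₂ M D) {p : Space n × Dir n} (hp : p.1 ∈ Ω) (hpU : (entry Ω p).1 ∈ U)
    (hneg : inner ℝ (outwardNormal Ω (entry Ω p).1) (p.2 : Space n) < 0)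
    (hpos : 0 < inner ℝ (outwardNormal Ω (exitPair Ω p).1) (p.2 : Space n)) :
    attenuation σ₁ ((entry Ω p).1, -p.2) (backExit Ω p + backExit Ω (p.1, -p.2)) =
      attenuation σ₂ ((entry Ω p).1, -p.2) (backExit Ω p + backExit Ω (p.1, -p.2)) := by
  have ho := hΩ.isOpen
  have hb := hΩ.isBounded
  have hx := entry_mem_frontier ho hb hp
  have hy := exitPair_mem_frontier ho hb hp
  have hb0 := backExit_pos ho hb hp
  have he0 : 0 < backExit Ω (p.1, -p.2) := backExit_pos ho hb (p := (p.1, -p.2)) hp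
  have hend : (entry Ω p).1 + (backExit Ω p + backExit Ω (p.1, -p.2)) • (p.2 : Space n) =
      (exitPair Ω p).1 := by
    simp only [entry, exitPair, backPoint, add_smul]; abel
  refine hΩ.attenuation_chord_eq hn hU hEU hA h₁ h₂ (by rw [hEU]; exact ⟨hx, hpU⟩)
    (add_pos hb0 he0) (fun s hs => ?_) ?_ ?_ ?_
  · rcases le_or_gt s (backExit Ω p) with h | h
    · have := backPoint_mem_of_lt (Ω := Ω) (p := p) (s := backExit Ω p - s) (by linarith)
        (by linarith [hs.1])
      convert this using 1
      simp only [entry, backPoint, sub_smul]; abel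
    · have := backPoint_mem_of_lt (Ω := Ω) (p := (p.1, -p.2)) (s := s - backExit Ω p)
        (by linarith) (by linarith [hs.2])
      rw [backPoint_neg_dir] at this
      convert this using 1
      simp only [entry, backPoint, sub_smul]; abel
  · refine ((hΩ.eventually_notMem_of_inner_pos hx (v := -(p.2 : Space n))
      (by rw [inner_neg_right]; linarith)).mono fun t ht => ?_).frequently
    simpa only [backPoint, smul_neg, ← sub_eq_add_neg] using ht
  · rw [hend]
    exact fun h => (ho.frontier_eq ▸ hy : (exitPair Ω p).1 ∈ closure Ω \ Ω).2 h
  · rw [hend]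
    refine ((hΩ.eventually_notMem_of_inner_pos hy hpos).mono fun t ht => ?_).frequently
    rwa [backPoint_neg_dir]

/-- The attenuations over all chords from a point of `E` agree. -/
theorem IsSmoothBoundedDomain.attenuation_eq [NeZero n]
    (hΩ : IsSmoothBoundedDomain Ω) (hn : 2 ≤ n) (hU : IsOpen U) (hEU : E = frontier Ω ∩ U)
    (hA : localAlbedo Ω E σ₁ = localAlbedo Ω E σ₂) (h₁ : IsMedium Ω σ₁ M D)
    (h₂ : IsMedium Ω σ₂ M D) (hx : x ∈ E) (hy : x + L • (θ₁ : Space n) ∈ frontier Ω)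
    (hL : 0 < L) (hseg : ∀ s ∈ Ioo 0 L, x + s • (θ₁ : Space n) ∈ Ω) :
    attenuation σ₁ (x, -θ₁) L = attenuation σ₂ (x, -θ₁) L := by
  subst hEU
  -- The attenuation depends continuously on point, direction and length, so equality passes from
  -- transversal lines to the chord; U is open, so their entry points are eventually in U.
  choose p hpΩ hpz hpb hpe hneg hpos using fun k : ℕ =>
    hΩ.exists_transversal hx.1 hy hL hseg (Nat.one_div_pos_of_nat (α := ℝ) (n := k))
  have h0 : Tendsto (fun k : ℕ => 1 / ((k : ℝ) + 1)) atTop (𝓝 0) :=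
    tendsto_one_div_add_atTop_nhds_zero_nat
  have hplim : Tendsto p atTop (𝓝 (x + (L / 2) • (θ₁ : Space n), θ₁)) :=
    tendsto_iff_dist_tendsto_zero.2
      (squeeze_zero (fun _ => dist_nonneg) (fun k => (hpz k).le) h0)
  have hblim : Tendsto (fun k => backExit Ω (p k)) atTop (𝓝 (L / 2)) :=
    tendsto_iff_dist_tendsto_zero.2
      (squeeze_zero (fun _ => dist_nonneg) (fun k => (hpb k).le) h0)
  have helim : Tendsto (fun k => backExit Ω ((p k).1, -(p k).2)) atTop (𝓝 (L / 2)) :=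
    tendsto_iff_dist_tendsto_zero.2
      (squeeze_zero (fun _ => dist_nonneg) (fun k => (hpe k).le) h0)
  have hx' : backPoint (x + (L / 2) • (θ₁ : Space n), θ₁) (L / 2) = x := by simp [backPoint]
  have hent : Tendsto (fun k => (entry Ω (p k)).1) atTop (𝓝 x) := by
    have := (continuous_backPoint.tendsto _).comp (hplim.prodMk_nhds hblim)
    rwa [hx'] at this
  have hdir : Tendsto (fun k => -(p k).2) atTop (𝓝 (-θ₁)) :=
    ((continuous_neg.comp continuous_snd).tendsto _).comp hplim
  have hlen : Tendsto (fun k => backExit Ω (p k) + backExit Ω ((p k).1, -(p k).2)) atTop (𝓝 L) := by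
    simpa using hblim.add helim
  have htrip := (hent.prodMk_nhds hdir).prodMk_nhds hlen
  have l₁ := ((continuous_attenuation h₁.continuous).tendsto _).comp htrip
  have l₂ := ((continuous_attenuation h₂.continuous).tendsto _).comp htrip
  refine tendsto_nhds_unique_of_eventuallyEq l₁ l₂ ?_
  filter_upwards [hent.eventually (hU.mem_nhds hx.2)] with k hk
  exact hΩ.attenuation_eq_of_transversal hn hU rfl hA h₁ h₂ (hpΩ k) hk (hneg k) (hpos k)

lemma segmentIntegral_add_smul (φ : Space n → ℝ) (x : Space n) (θ : Dir n) (hL : 0 < L) :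
    segmentIntegral φ x (x + L • (θ : Space n)) =
      ∫ s in (0 : ℝ)..L, φ (x + s • (θ : Space n)) := by
  have hd : dist x (x + L • (θ : Space n)) = L := by
    rw [dist_self_add_right, norm_smul, norm_dir, mul_one, Real.norm_of_nonneg hL.le]
  have he : ∀ t : ℝ, AffineMap.lineMap x (x + L • (θ : Space n)) t =
      x + (t * L) • (θ : Space n) := by
    intro t
    rw [AffineMap.lineMap_apply, vsub_eq_sub, vadd_eq_add, add_sub_cancel_left, smul_smul, add_comm]
  simp only [segmentIntegral, hd, he]
  rw [intervalIntegral.integral_comp_mul_right (fun s => φ (x + s • (θ : Space n))) hL.ne',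
    zero_mul, one_mul, smul_eq_mul, mul_inv_cancel_left₀ hL.ne']

/-- A nonnegative bounded continuous extension. -/
lemma exists_extension (hb : Bornology.IsBounded Ω) (hσ : ContinuousOn σ (closure Ω))
    (hpos : ∀ x ∈ Ω, 0 < σ x) :
    ∃ τ : Space n → ℝ, Continuous τ ∧ (∀ x, 0 ≤ τ x) ∧ (∃ M, ∀ x, τ x ≤ M) ∧
      ∀ x ∈ closure Ω, τ x = σ x := by
  have hcpt : IsCompact (closure Ω) := hb.isCompact_closure
  obtain ⟨M, hM⟩ := hcpt.bddAbove_image hσ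
  -- Positivity in Ω leaves σ ≥ 0 on the boundary, by continuity; truncating between 0 and the
  -- maximum M then leaves σ unchanged on the closure.
  have hnn : ∀ x ∈ closure Ω, 0 ≤ σ x := by
    intro x hx
    have h1 : (closure Ω) ⊆ {x | x ∈ closure Ω ∧ 0 ≤ σ x} :=
      closure_minimal (fun x hx => ⟨subset_closure hx, (hpos x hx).le⟩)
        (by
          have := hσ.preimage_isClosed_of_isClosed isClosed_closure (isClosed_Ici (a := (0 : ℝ)))
          exact this)
    exact (h1 hx).2
  obtain ⟨g, hg⟩ := ContinuousMap.exists_restrict_eq isClosed_closure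
    (⟨(closure Ω).domRestrict σ, hσ.domRestrict⟩ : C(closure Ω, ℝ))
  have hg' : ∀ x ∈ closure Ω, g x = σ x := fun x hx => by
    exact congrArg (fun f : C(closure Ω, ℝ) => f ⟨x, hx⟩) hg
  refine ⟨fun x => max 0 (min (g x) M), by fun_prop, fun x => le_max_left _ _,
    ⟨max 0 M, fun x => max_le_max le_rfl (min_le_right _ _)⟩, fun x hx => ?_⟩
  simp only [hg' x hx]
  rw [min_eq_left (hM (mem_image_of_mem _ hx)), max_eq_right (hnn x hx)]

end Approximation

end RTE

/-! ### The theorem. -/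

theorem theorem1 (n : ℕ) (hn : 3 ≤ n) (Ω : Set (RTE.Space n))
    (hΩ : RTE.IsSmoothBoundedDomain Ω)
    (E : Set (RTE.Space n)) (hE : ∃ U : Set (RTE.Space n), IsOpen U ∧ E = frontier Ω ∩ U)
    (hscan : RTE.CanBeScannedFrom Ω E)
    (σ₁ σ₂ : RTE.Space n → ℝ)
    (hσ₁ : ContinuousOn σ₁ (closure Ω)) (hσ₁_pos : ∀ x ∈ Ω, 0 < σ₁ x)
    (hσ₂ : ContinuousOn σ₂ (closure Ω)) (hσ₂_pos : ∀ x ∈ Ω, 0 < σ₂ x)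
    (hA : RTE.localAlbedo Ω E σ₁ = RTE.localAlbedo Ω E σ₂) :
    ∀ x ∈ closure Ω, σ₁ x = σ₂ x := by
  have : NeZero n := ⟨by omega⟩
  obtain ⟨U, hU, hEU⟩ := hE
  obtain ⟨τ₁, hc₁, hn₁, ⟨M₁, hM₁⟩, he₁⟩ := RTE.exists_extension hΩ.isBounded hσ₁ hσ₁_pos
  obtain ⟨τ₂, hc₂, hn₂, ⟨M₂, hM₂⟩, he₂⟩ := RTE.exists_extension hΩ.isBounded hσ₂ hσ₂_pos
  -- The summand 1 merely makes the diameter bound positive.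
  have hdist : ∀ x ∈ Ω, ∀ y ∈ Ω, dist x y ≤ Metric.diam Ω + 1 := fun x hx y hy =>
    (Metric.dist_le_diam_of_mem hΩ.isBounded hx hy).trans (by linarith)
  have hdiam : 0 < Metric.diam Ω + 1 := by linarith [Metric.diam_nonneg (s := Ω)]
  have h₁ : RTE.IsMedium Ω τ₁ (max M₁ M₂) (Metric.diam Ω + 1) :=
    ⟨hΩ.isOpen, hΩ.isBounded, hc₁, hn₁, fun x => (hM₁ x).trans (le_max_left _ _), hdiam, hdist⟩
  have h₂ : RTE.IsMedium Ω τ₂ (max M₁ M₂) (Metric.diam Ω + 1) :=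
    ⟨hΩ.isOpen, hΩ.isBounded, hc₂, hn₂, fun x => (hM₂ x).trans (le_max_right _ _), hdiam, hdist⟩
  have hAτ : RTE.localAlbedo Ω E τ₁ = RTE.localAlbedo Ω E τ₂ := by
    rw [RTE.localAlbedo_congr fun x hx => he₁ x (subset_closure hx), hA,
      RTE.localAlbedo_congr fun x hx => he₂ x (subset_closure hx)]
  have hzero := hscan (fun x => τ₁ x - τ₂ x) (hc₁.sub hc₂).continuousOn fun x hx y hy hxy hseg => by
    obtain ⟨θ, hθ⟩ := RTE.exists_dir hxy
    have hL : 0 < dist x y := dist_pos.2 hxy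
    generalize dist x y = L at hθ hL
    subst hθ
    have hchord : ∀ s ∈ Ioo 0 L, x + s • (θ : RTE.Space n) ∈ Ω := fun s hs => hseg <| by
      rw [openSegment_eq_image']
      refine ⟨s / L, ⟨div_pos hs.1 hL, (div_lt_one hL).2 hs.2⟩, ?_⟩
      simp only [add_sub_cancel_left, smul_smul, div_mul_cancel₀ _ hL.ne']
    have hatt := hΩ.attenuation_eq (by omega) hU hEU hAτ h₁ h₂ hx hy hL hchord
    -- Equal attenuations have equal exponents, which are minus the integrals of τ₁ and τ₂ over the
    -- chord.
    simp only [RTE.attenuation, Real.exp_eq_exp, neg_inj, RTE.backPoint_neg_dir] at hatt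
    have hray : ∀ {τ : RTE.Space n → ℝ}, Continuous τ →
        IntervalIntegrable (fun s : ℝ => τ (x + s • (θ : RTE.Space n))) volume 0 L := fun hτ =>
      (hτ.comp (by fun_prop : Continuous fun s : ℝ => x + s • (θ : RTE.Space n))
        ).intervalIntegrable _ _
    rw [RTE.segmentIntegral_add_smul _ _ _ hL, intervalIntegral.integral_sub (hray hc₁) (hray hc₂),
      hatt, sub_self]
  intro x hx
  rw [← he₁ x hx, ← he₂ x hx]
  exact sub_eq_zero.1 (hzero x hx)
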